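/- There exists a nonempty bounded pseudoconvex domain (connected open set) $\Omega\subseteq\mathbb{C}^2$ with boundary of class $\mathcal{C}^{1,1}$ such that * $\overline{\Omega}$ has a Stein neighborhood basis, i.e. for every open set $V\supseteq\overline{\Omega}$ there is an open pseudoconvex (equivalently, Stein) set $D\subseteq\mathbb{C}^2$ with $\overline{\Omega}\subseteq D\subseteq V$; * $\overline{\Omega}$ is not $s$-H-convex for any real number $s\geq 1$. Here an open set $U\subseteq\mathbb{C}^n$ is called pseudoconvex if there is a continuous plurisubharmonic function $u\colon U\to\mathbb{R}$ such that $\{z\in U\colon u(z)\leq c\}$ is compact for every $c\in\mathbb{R}$. An open set $\emptyset\neq U\subsetneq\mathbb{R}^k$ has boundary of class $\mathcal{C}^{1,1}$ if every boundary point of $U$ has an open neighborhood $V$ with a function $r\colon V\to\mathbb{R}$ of class $\mathcal{C}^{1,1}$ (differentiable with Lipschitz gradient) such that $\nabla r$ vanishes nowhere on $V$ and $U\cap V=\{x\in V\colon r(x)<0\}$. Given a real number $s\geq 1$, a nonempty compact set $K\subseteq\mathbb{C}^n$ is called $s$-H-convex if there is a constant $0<C\leq 1$ such that for every $0<\epsilon\leq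 1$ there is an open pseudoconvex set $\Omega_\epsilon\subseteq\mathbb{C}^n$ with $$\{z\in\mathbb{C}^n\colon d(z,K)<C\epsilon^s\}\subseteq\Omega_\epsilon\subseteq\{z\in\mathbb{C}^n\colon d(z,K)<\epsilon\},$$ where $d(\cdot,K)$ denotes the Euclidean distance to $K$. -/

import Mathlib

/-- `ℂⁿ` with its Euclidean norm. -/
abbrev Cn (n : ℕ) : Type := EuclideanSpace ℂ (Fin n)

/-- `u` is a continuous plurisubharmonic function on the set `U ⊆ ℂⁿ` (used for open `U`): it is
continuous on `U` and satisfies the sub-mean value inequality on every closed affine complex disc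
`{a + ζ b : |ζ| ≤ 1}` contained in `U`. Only the values of `u` on `U` matter. -/
def ContinuousPlurisubharmonicOn {n : ℕ} (u : Cn n → ℝ) (U : Set (Cn n)) : Prop :=
  ContinuousOn u U ∧
    ∀ a b : Cn n, (∀ ζ : ℂ, ‖ζ‖ ≤ 1 → a + ζ • b ∈ U) →
      u a ≤ Real.circleAverage (fun ζ : ℂ => u (a + ζ • b)) 0 1

/-- An open set `U ⊆ ℂⁿ` is pseudoconvex if it carries a continuous plurisubharmonic exhaustion
function. -/
def IsOpenPseudoconvex {n : ℕ} (U : Set (Cn n)) : Prop :=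
  IsOpen U ∧
    ∃ u : Cn n → ℝ, ContinuousPlurisubharmonicOn u U ∧
      ∀ c : ℝ, IsCompact {z | z ∈ U ∧ u z ≤ c}

/-- `K` has a Stein neighborhood basis: every open set containing `K` contains an open
pseudoconvex set containing `K` (open subsets of `ℂⁿ` are Stein iff they are pseudoconvex). -/
def HasSteinNhdBasis {n : ℕ} (K : Set (Cn n)) : Prop :=
  ∀ V : Set (Cn n), IsOpen V → K ⊆ V → ∃ D : Set (Cn n), IsOpenPseudoconvex D ∧ K ⊆ D ∧ D ⊆ V

/-- `s`-H-convexity of a nonempty compact set `K ⊆ ℂⁿ`, for a real number `s ≥ 1`. -/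
def IsSHConvex {n : ℕ} (s : ℝ) (K : Set (Cn n)) : Prop :=
  ∃ C : ℝ, 0 < C ∧ C ≤ 1 ∧
    ∀ ε : ℝ, 0 < ε → ε ≤ 1 →
      ∃ D : Set (Cn n), IsOpenPseudoconvex D ∧
        {z | Metric.infDist z K < C * ε ^ s} ⊆ D ∧
        D ⊆ {z | Metric.infDist z K < ε}

/-- `r` is of class `C^{1,1}` on the open set `V`: differentiable with Lipschitz derivative. -/
def IsC11On {E : Type*} [NormedAddCommGroup E] [NormedSpace ℝ E] (r : E → ℝ) (V : Set E) : Prop :=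
  DifferentiableOn ℝ r V ∧ ∃ L : NNReal, LipschitzOnWith L (fderiv ℝ r) V

/-- The open set `∅ ≠ U ≠ E` has boundary of class `C^{1,1}`: near every boundary point it is the
negativity set of a `C^{1,1}` function whose differential vanishes nowhere. -/
def HasC11Boundary {E : Type*} [NormedAddCommGroup E] [NormedSpace ℝ E] (U : Set E) : Prop :=
  IsOpen U ∧ U.Nonempty ∧ U ≠ Set.univ ∧
    ∀ p ∈ frontier U, ∃ V : Set E, IsOpen V ∧ p ∈ V ∧
      ∃ r : E → ℝ, IsC11On r V ∧ (∀ x ∈ V, fderiv ℝ r x ≠ 0) ∧ U ∩ V = {x | x ∈ V ∧ r x < 0}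

/-! The domain is a worm: with t = log|z|, the fibre over z is the disc |w - e^{it}|² < 1 - lam(t).
For |t| ≤ π/2 the discs have radius one and 0 lies on every boundary circle, so the closure K
contains the annulus {|t| ≤ π/2} × {0}. At t = ±(π/2 + u) the term sin² u in `lam` cuts the disc
about e^{it} down to radius cos u, which would just touch the real axis at -sin u; the further term
E exp(-1/u) opens a gap that is flat to infinite order.

Failure of s-H-convexity. The two boundary circles of the annulus {|t| ≤ π/2 + u} × {-sin u} are
within O(E exp(-1/u)) of K. If a pseudoconvex D contains the Cε^s-neighbourhood of K, these circles
lie in D for all u ≤ 8ε once ε is small, and the annulus u = 0 lies in D. The continuity principle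
`annulus_mem_of_isOpenPseudoconvex` puts (1, -sin 8ε) into D, yet this point is farther than ε from
K.

Pseudoconvexity. In the coordinate ζ = log z, multiplying `rho` by exp(Im ζ) gives |w e^{-iζ/2}|² -
2 Re(w e^{-iζ}) + exp(Im ζ) lam(Re ζ). The last term is subharmonic when lam'' + lam ≥ 0; this is
used as the existence of sinusoidal tangents below the profile (`exists_tangent_lam`), which
survives its lack of C² smoothness. Hence -log(-rho) has pluriharmonic minorants
(`hasHolSupport_neg_log_rho`).

Stein neighbourhoods. For the closed worm with parameter E₀, start from the open worm with a
slightly smaller E. Its fibres {t : rho < 0} over the w-plane are intervals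
(`ordConnected_rho_neg`), and each is lengthened at both ends by κ log(4/|w|). The shifts are
pluriharmonic, so pseudoconvexity survives. The lengthening blows up at w = 0, where it is cut off
by |t| < Re b(w), with b built from a fourth root of w + θ⁴. The result lies near the closed worm
and contains it except possibly where |w| = 2; a small dilation in w recovers those points. -/

open Complex Filter Metric Set Topology

/-! ### Plurisubharmonicity from holomorphic support functions -/

/-- `u` is supported from below at `p` by the real part of a function holomorphic near `p`. -/
def HasHolSupport {E : Type*} [NormedAddCommGroup E] [NormedSpace ℂ E] (u : E → ℝ) (p : E) :
    Prop :=
  ∃ F : E → ℂ, (∀ᶠ x in 𝓝 p, DifferentiableAt ℂ F x) ∧ (F p).re = u p ∧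
    ∀ᶠ x in 𝓝 p, (F x).re ≤ u x

theorem HasHolSupport.of_le {E : Type*} [NormedAddCommGroup E] [NormedSpace ℂ E] {u v : E → ℝ}
    {p : E} (hv : HasHolSupport v p) (hle : ∀ᶠ x in 𝓝 p, v x ≤ u x) (heq : v p = u p) :
    HasHolSupport u p := by
  obtain ⟨F, hF, hFp, hFle⟩ := hv
  exact ⟨F, hF, hFp.trans heq, by filter_upwards [hFle, hle] with x h1 h2 using h1.trans h2⟩

theorem HasHolSupport.comp {E E' : Type*} [NormedAddCommGroup E] [NormedSpace ℂ E]
    [NormedAddCommGroup E'] [NormedSpace ℂ E'] {u : E' → ℝ} {f : E → E'} {p : E}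
    (hu : HasHolSupport u (f p)) (hf : ∀ᶠ x in 𝓝 p, DifferentiableAt ℂ f x) :
    HasHolSupport (u ∘ f) p := by
  obtain ⟨F, hF, hFp, hFle⟩ := hu
  have hc : Tendsto f (𝓝 p) (𝓝 (f p)) := hf.self_of_nhds.continuousAt
  refine ⟨F ∘ f, ?_, hFp, hc.eventually hFle⟩
  filter_upwards [hf, hc.eventually hF] with x h1 h2 using h2.comp x h1

/-- Negative frequencies are conjugates of positive ones on the circle, and Re(c · conj(z^m)) =
Re(conj(c) · z^m), so polynomials suffice once only real parts matter. -/
theorem exists_entire_re_eq_of_mem_span_fourier [Fact (0 < 2 * Real.pi)]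
    {g : C(AddCircle (2 * Real.pi), ℂ)}
    (hg : g ∈ Submodule.span ℂ (range (@fourier (2 * Real.pi)))) (c : ℂ) :
    ∃ P : ℂ → ℂ, Differentiable ℂ P ∧
      ∀ x, (P (AddCircle.toCircle x : ℂ)).re = (c * g x).re := by
  induction hg using Submodule.span_induction generalizing c with
  | mem g hg =>
    obtain ⟨n, rfl⟩ := hg
    obtain ⟨m, rfl | rfl⟩ := n.eq_nat_or_neg
    · refine ⟨fun z => c * z ^ m, by fun_prop, fun x => ?_⟩
      have h : (fourier (m : ℤ) x : ℂ) = (AddCircle.toCircle x : ℂ) ^ m := by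
        rw [fourier_apply, natCast_zsmul, AddCircle.toCircle_nsmul, Circle.coe_pow]
      rw [h]
    · refine ⟨fun z => (starRingEnd ℂ) c * z ^ m, by fun_prop, fun x => ?_⟩
      have h : (fourier (m : ℤ) x : ℂ) = (AddCircle.toCircle x : ℂ) ^ m := by
        rw [fourier_apply, natCast_zsmul, AddCircle.toCircle_nsmul, Circle.coe_pow]
      rw [fourier_neg, h, ← Complex.conj_re (c * _), map_mul, Complex.conj_conj]
  | zero => exact ⟨fun _ => 0, by fun_prop, fun x => by simp⟩
  | add g h _ _ hg hh =>
    obtain ⟨P, hP, hP'⟩ := hg c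
    obtain ⟨Q, hQ, hQ'⟩ := hh c
    refine ⟨fun z => P z + Q z, hP.add hQ, fun x => ?_⟩
    rw [Complex.add_re, hP', hQ', ← Complex.add_re, ContinuousMap.add_apply, mul_add]
  | smul a g _ hg =>
    obtain ⟨P, hP, hP'⟩ := hg (c * a)
    exact ⟨P, hP, fun x => by rw [hP', ContinuousMap.smul_apply, smul_eq_mul, mul_assoc]⟩

/-- Density of trigonometric polynomials; this stands in for solving the Dirichlet problem on the
disc. -/
theorem exists_entire_re_approx_on_sphere {v : ℂ → ℝ} (hv : ContinuousOn v (sphere 0 1)) {ε : ℝ}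
    (hε : 0 < ε) :
    ∃ P : ℂ → ℂ, Differentiable ℂ P ∧ ∀ ζ ∈ sphere (0 : ℂ) 1, |v ζ - (P ζ).re| < ε := by
  have : Fact (0 < 2 * Real.pi) := ⟨Real.two_pi_pos⟩
  have hcont : Continuous fun x : AddCircle (2 * Real.pi) =>
      ((v (AddCircle.toCircle x : ℂ) : ℝ) : ℂ) := by
    refine Complex.continuous_ofReal.comp ?_
    refine hv.comp_continuous ?_ ?_
    · exact continuous_subtype_val.comp AddCircle.continuous_toCircle
    · intro x; exact mem_sphere_zero_iff_norm.2 (Circle.norm_coe _)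
  let f : C(AddCircle (2 * Real.pi), ℂ) := ⟨_, hcont⟩
  have hf : f ∈ closure (Submodule.span ℂ (range (@fourier (2 * Real.pi))) :
      Set C(AddCircle (2 * Real.pi), ℂ)) := by
    have := (@span_fourier_closure_eq_top (2 * Real.pi) _)
    have h2 : f ∈ (Submodule.span ℂ (range (@fourier (2 * Real.pi)))).topologicalClosure := by
      rw [this]; trivial
    exact h2
  obtain ⟨g, hg, hfg⟩ := Metric.mem_closure_iff.1 hf ε hε
  obtain ⟨P, hP, hP'⟩ := exists_entire_re_eq_of_mem_span_fourier hg 1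
  refine ⟨P, hP, fun ζ hζ => ?_⟩
  have hζ' : ζ ∈ Submonoid.unitSphere ℂ := hζ
  obtain ⟨x, hx⟩ := (AddCircle.homeomorphCircle' ).surjective (⟨ζ, hζ'⟩ : Circle)
  have hx' : ((AddCircle.toCircle x : Circle) : ℂ) = ζ := by
    have := congrArg (fun y : Circle => (y : ℂ)) hx
    induction x using QuotientAddGroup.induction_on with
    | H x =>
      rw [AddCircle.homeomorphCircle'_apply_mk] at this
      simpa [AddCircle.toCircle_apply_mk] using this
  have h1 := hP' x
  rw [hx', one_mul] at h1
  rw [h1]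
  have h2 : dist (f x) (g x) < ε := (ContinuousMap.dist_apply_le_dist x).trans_lt hfg
  have h3 : f x = ((v ζ : ℝ) : ℂ) := by
    change ((v (AddCircle.toCircle x : ℂ) : ℝ) : ℂ) = _
    rw [hx']
  rw [h3, Complex.dist_eq] at h2
  calc |v ζ - (g x).re| = |(((v ζ : ℝ) : ℂ) - g x).re| := by simp
    _ ≤ _ := Complex.abs_re_le_norm _
    _ < ε := h2

/-- A real part of a holomorphic function with a local maximum is locally constant. -/
theorem eventually_re_eq_of_isLocalMax {F : ℂ → ℂ} {c : ℂ}
    (hd : ∀ᶠ z in 𝓝 c, DifferentiableAt ℂ F z) (hc : ∀ᶠ z in 𝓝 c, (F z).re ≤ (F c).re) :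
    ∀ᶠ z in 𝓝 c, (F z).re = (F c).re := by
  have h := eventually_eq_of_isLocalMax_norm (f := fun z => Complex.exp (F z)) (c := c)
    (by filter_upwards [hd] with z hz using hz.cexp)
    (by
      filter_upwards [hc] with z hz
      simpa [Complex.norm_exp] using hz)
  filter_upwards [h] with z hz
  have := congrArg norm hz
  simpa [Complex.norm_exp] using this

/-- Subtract Re P with P entire and Re P close to v on the circle. The maximum principle for v - Re
P bounds v(0) by Re P(0) + ε/2, and Re P(0) is the circle average of Re P. -/
theorem le_circleAverage_of_hasHolSupport {v : ℂ → ℝ} (hv : ContinuousOn v (closedBall 0 1))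
    (hs : ∀ z ∈ ball (0 : ℂ) 1, HasHolSupport v z) : v 0 ≤ Real.circleAverage v 0 1 := by
  have hsub : sphere (0 : ℂ) 1 ⊆ closedBall 0 1 := sphere_subset_closedBall
  refine le_of_forall_pos_le_add fun ε hε => ?_
  obtain ⟨P, hP, hPv⟩ := exists_entire_re_approx_on_sphere (hv.mono hsub) (half_pos hε)
  have hcont : ContinuousOn (fun z => v z - (P z).re) (closedBall 0 1) :=
    hv.sub (Complex.continuous_re.comp hP.continuous).continuousOn
  obtain ⟨z₀, hz₀, hmax⟩ := (isCompact_closedBall (0 : ℂ) 1).exists_isMaxOn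
    (nonempty_closedBall.2 zero_le_one) hcont
  have hmain : v 0 - (P 0).re ≤ ε / 2 := by
    by_contra hcon
    push Not at hcon
    set m := v z₀ - (P z₀).re with hm
    have hm0 : ε / 2 < m := hcon.trans_le (hmax (mem_closedBall_self zero_le_one))
    let S := closedBall (0 : ℂ) 1 ∩ (fun z => v z - (P z).re) ⁻¹' {m}
    have hScl : IsClosed S := hcont.preimage_isClosed_of_isClosed isClosed_closedBall
      isClosed_singleton
    have hSc : IsCompact S := (isCompact_closedBall (0 : ℂ) 1).of_isClosed_subset hScl
      inter_subset_left
    -- Among the maximum points take one of largest modulus. The support function at it makes every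
    -- nearby point a maximum point too, including some of larger modulus.
    obtain ⟨z₁, hz₁, hz₁max⟩ := hSc.exists_isMaxOn ⟨z₀, hz₀, rfl⟩ continuous_norm.continuousOn
    have hz₁m : v z₁ - (P z₁).re = m := hz₁.2
    have hz₁b : z₁ ∈ ball (0 : ℂ) 1 := by
      rcases (mem_closedBall_zero_iff.1 hz₁.1).lt_or_eq with h | h
      · exact mem_ball_zero_iff.2 h
      · have := (abs_lt.1 (hPv z₁ (mem_sphere_zero_iff_norm.2 h))).2
        linarith
    obtain ⟨F, hF, hFz, hFle⟩ := hs z₁ hz₁b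
    have hball : ∀ᶠ z in 𝓝 z₁, z ∈ ball (0 : ℂ) 1 := isOpen_ball.mem_nhds hz₁b
    have hconst := eventually_re_eq_of_isLocalMax (F := fun z => F z - P z) (c := z₁)
      (by filter_upwards [hF] with z hz using hz.sub (hP z))
      (by
        filter_upwards [hFle, hball] with z h1 h2
        have := hmax (ball_subset_closedBall h2)
        simp only [mem_ofPred_eq, sub_re] at this ⊢
        linarith)
    have hS : ∀ᶠ z in 𝓝 z₁, z ∈ S := by
      filter_upwards [hconst, hFle, hball] with z h1 h2 h3
      refine ⟨ball_subset_closedBall h3, ?_⟩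
      have := hmax (ball_subset_closedBall h3)
      simp only [mem_ofPred_eq, sub_re, mem_preimage, mem_singleton_iff] at this h1 ⊢
      linarith
    have hlarger : ∃ᶠ z in 𝓝 z₁, ‖z₁‖ < ‖z‖ := by
      by_contra hno
      simp only [not_frequently, not_lt] at hno
      have := eventually_eq_of_isLocalMax_norm (f := fun z : ℂ => z) (c := z₁)
        (Eventually.of_forall fun z => differentiableAt_id) hno
      have h2 : (𝓝[≠] z₁).NeBot := inferInstance
      obtain ⟨z, h3, h4⟩ := ((this.filter_mono nhdsWithin_le_nhds).and
        (self_mem_nhdsWithin : {z₁}ᶜ ∈ 𝓝[≠] z₁)).exists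
      exact h4 h3
    obtain ⟨z, h1, h2⟩ := (hlarger.and_eventually hS).exists
    exact absurd (hz₁max h2) (not_le.2 h1)
  have hPint : CircleIntegrable (fun z => (P z).re) 0 1 :=
    (Complex.continuous_re.comp hP.continuous).continuousOn.circleIntegrable zero_le_one
  have hvint : CircleIntegrable v 0 1 := (hv.mono hsub).circleIntegrable zero_le_one
  have hPavg : Real.circleAverage (fun z => (P z).re) 0 1 = (P 0).re := by
    have h1 : Real.circleAverage P 0 1 = P 0 := hP.diffContOnCl.circleAverage
    have h2 := Complex.reCLM.circleAverage_comp_comm (f := P) (c := 0) (R := 1)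
      (hP.continuous.continuousOn.circleIntegrable zero_le_one)
    rw [h1] at h2
    exact h2
  have hle : Real.circleAverage (fun z => (P z).re) 0 1 ≤
      Real.circleAverage (fun z => v z + ε / 2) 0 1 := by
    refine Real.circleAverage_mono hPint (hvint.add (circleIntegrable_const _ _ _)) fun z hz => ?_
    have := (abs_lt.1 (hPv z (by simpa using hz))).1
    linarith
  have hadd : Real.circleAverage (fun z => v z + ε / 2) 0 1 = Real.circleAverage v 0 1 + ε / 2 := by
    have := Real.circleAverage_add (c := 0) (R := 1) hvint
      (circleIntegrable_const (ε / 2) (0 : ℂ) 1)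
    rw [Real.circleAverage_const] at this
    exact this
  linarith

/-- The criterion is local and stable under maxima, so the exhaustion functions built below need no
second derivatives. -/
theorem continuousPlurisubharmonicOn_of_hasHolSupport {n : ℕ} {u : Cn n → ℝ} {U : Set (Cn n)}
    (hu : ContinuousOn u U) (hs : ∀ p ∈ U, HasHolSupport u p) :
    ContinuousPlurisubharmonicOn u U := by
  refine ⟨hu, fun a b hab => ?_⟩
  have hd : Differentiable ℂ fun ζ : ℂ => a + ζ • b := by fun_prop
  have h := le_circleAverage_of_hasHolSupport (v := fun ζ : ℂ => u (a + ζ • b))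
    (hu.comp hd.continuous.continuousOn fun ζ hζ => hab ζ (mem_closedBall_zero_iff.1 hζ))
    (fun z hz => (hs _ (hab z (mem_ball_zero_iff.1 hz).le)).comp
      (f := fun ζ : ℂ => a + ζ • b) (Eventually.of_forall hd))
  simpa using h

/-! ### The profile of the worm -/

/-- The profile closing up the ends of the worm: it vanishes for `|t| ≤ π / 2` and equals
`sin² u + E * exp (-1 / u)` for `|t| = π / 2 + u` with small `u > 0`. -/
noncomputable def lam (E t : ℝ) : ℝ :=
  max 0 (-Real.cos t) ^ 2 +
    E * (expNegInvGlue (t - Real.pi / 2) + expNegInvGlue (-t - Real.pi / 2))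

/-- The worm function: `|w - exp (i t)|² - 1 + lam E t`, expanded. -/
noncomputable def rho (E t : ℝ) (w : ℂ) : ℝ :=
  w.re ^ 2 + w.im ^ 2 - 2 * (w.re * Real.cos t + w.im * Real.sin t) + lam E t

theorem lam_neg (E t : ℝ) : lam E (-t) = lam E t := by
  simp only [lam, Real.cos_neg, neg_neg]; ring

theorem lam_nonneg {E : ℝ} (hE : 0 ≤ E) (t : ℝ) : 0 ≤ lam E t := by
  have h1 := expNegInvGlue.nonneg (t - Real.pi / 2)
  have h2 := expNegInvGlue.nonneg (-t - Real.pi / 2)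
  unfold lam; positivity

theorem continuous_lam (E : ℝ) : Continuous (lam E) := by
  have h : Continuous expNegInvGlue := expNegInvGlue.contDiff (n := 0).continuous
  unfold lam; fun_prop

theorem continuous_rho (E : ℝ) : Continuous fun q : ℝ × ℂ => rho E q.1 q.2 := by
  have h := continuous_lam E
  unfold rho; fun_prop

theorem lam_eq_zero {E t : ℝ} (ht : |t| ≤ Real.pi / 2) : lam E t = 0 := by
  obtain ⟨h1, h2⟩ := abs_le.1 ht
  have h3 : 0 ≤ Real.cos t := Real.cos_nonneg_of_neg_pi_div_two_le_of_le h1 h2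
  rw [lam, max_eq_left (by linarith), expNegInvGlue.zero_of_nonpos (by linarith),
    expNegInvGlue.zero_of_nonpos (by linarith)]
  ring

theorem lam_pi_div_two_add {E u : ℝ} (h0 : 0 ≤ u) (h1 : u ≤ 1) :
    lam E (Real.pi / 2 + u) = Real.sin u ^ 2 + E * expNegInvGlue u := by
  have hpi := Real.pi_gt_three
  have hs : 0 ≤ Real.sin u := Real.sin_nonneg_of_nonneg_of_le_pi h0 (by linarith)
  have hc : -Real.cos (Real.pi / 2 + u) = Real.sin u := by
    rw [add_comm, Real.cos_add_pi_div_two]; ring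
  rw [lam, hc, max_eq_right hs, expNegInvGlue.zero_of_nonpos (by linarith : -(Real.pi / 2 + u) - _ ≤ 0)]
  ring_nf

theorem lam_lt_lam {E E' t : ℝ} (h : E' < E) (ht : Real.pi / 2 < |t|) : lam E' t < lam E t := by
  have h1 := expNegInvGlue.nonneg (t - Real.pi / 2)
  have h2 := expNegInvGlue.nonneg (-t - Real.pi / 2)
  have h3 : 0 < expNegInvGlue (t - Real.pi / 2) + expNegInvGlue (-t - Real.pi / 2) := by
    rcases lt_abs.1 ht with h | h
    · have := expNegInvGlue.pos_of_pos (sub_pos.2 h); linarith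
    · have := expNegInvGlue.pos_of_pos (sub_pos.2 h); linarith
  unfold lam
  nlinarith

theorem lam_le_lam {E E' : ℝ} (h : E' ≤ E) (t : ℝ) : lam E' t ≤ lam E t := by
  have h1 := expNegInvGlue.nonneg (t - Real.pi / 2)
  have h2 := expNegInvGlue.nonneg (-t - Real.pi / 2)
  unfold lam
  nlinarith

theorem lam_pos {E t : ℝ} (hE : 0 < E) (ht : Real.pi / 2 < |t|) : 0 < lam E t :=
  (lam_nonneg le_rfl t).trans_lt (lam_lt_lam hE ht)

/-- E ≥ e² makes E exp(-1/u) reach 1 by u = 1/2. The discs thus vanish within the range where lam''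
+ lam ≥ 0 is available. -/
theorem one_le_lam {E t : ℝ} (hE : Real.exp 2 ≤ E) (ht : Real.pi / 2 + 1 / 2 ≤ |t|) :
    1 ≤ lam E t := by
  have h0 : 0 < Real.exp 2 := Real.exp_pos 2
  have key : ∀ s : ℝ, 1 / 2 ≤ s → Real.exp (-2) ≤ expNegInvGlue s := by
    intro s hs
    refine le_trans ?_ (expNegInvGlue.monotone hs)
    rw [expNegInvGlue, if_neg (by norm_num)]
    norm_num
  have h1 := expNegInvGlue.nonneg (t - Real.pi / 2)
  have h2 := expNegInvGlue.nonneg (-t - Real.pi / 2)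
  have h3 : Real.exp (-2) ≤ expNegInvGlue (t - Real.pi / 2) + expNegInvGlue (-t - Real.pi / 2) := by
    rcases le_abs.1 ht with h | h
    · have := key (t - Real.pi / 2) (by linarith); linarith
    · have := key (-t - Real.pi / 2) (by linarith); linarith
  have h4 : Real.exp 2 * Real.exp (-2) = 1 := by rw [← Real.exp_add]; simp
  have h5 := Real.exp_pos (-2)
  have h6 : 0 ≤ max 0 (-Real.cos t) ^ 2 := by positivity
  unfold lam
  nlinarith

/-- This says that the squared radius 1 - lam is at most sin² t, the squared distance from the
centre e^{it} to the real axis. -/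
theorem sq_cos_le_lam {E t : ℝ} (hE : 0 ≤ E) (ht : Real.cos t ≤ 0) : Real.cos t ^ 2 ≤ lam E t := by
  have h1 := expNegInvGlue.nonneg (t - Real.pi / 2)
  have h2 := expNegInvGlue.nonneg (-t - Real.pi / 2)
  rw [lam, max_eq_right (by linarith)]
  nlinarith [mul_nonneg hE (add_nonneg h1 h2)]

/-! ### Sinusoidal convexity -/

/-- A function with `f'' + f ≥ 0` lies above its sinusoidal tangents. -/
theorem cos_sin_tangent_le {f f' f'' : ℝ → ℝ} {s : Set ℝ} (hs : Convex ℝ s)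
    (h1 : ∀ u ∈ s, HasDerivAt f (f' u) u) (h2 : ∀ u ∈ s, HasDerivAt f' (f'' u) u)
    (h3 : ∀ u ∈ s, 0 ≤ f'' u + f u) {u₀ u₁ : ℝ} (hu₀ : u₀ ∈ s) (hu₁ : u₁ ∈ s)
    (hd : |u₁ - u₀| ≤ Real.pi) :
    f u₀ * Real.cos (u₁ - u₀) + f' u₀ * Real.sin (u₁ - u₀) ≤ f u₁ := by
  obtain ⟨hd1, hd2⟩ := abs_le.1 hd
  have hderiv : ∀ u ∈ s, HasDerivAt
      (fun u => f u * Real.cos (u₁ - u) + f' u * Real.sin (u₁ - u))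
      ((f'' u + f u) * Real.sin (u₁ - u)) u := by
    intro u hu
    have hc : HasDerivAt (fun u => u₁ - u) (-1) u := by
      simpa using (hasDerivAt_id u).const_sub u₁
    have := ((h1 u hu).mul hc.cos).add ((h2 u hu).mul hc.sin)
    refine this.congr_deriv ?_
    ring
  have hend : f u₁ * Real.cos (u₁ - u₁) + f' u₁ * Real.sin (u₁ - u₁) = f u₁ := by simp
  rcases le_total u₀ u₁ with h | h
  · have hsub : Icc u₀ u₁ ⊆ s := hs.ordConnected.out hu₀ hu₁
    have := monotoneOn_of_deriv_nonneg (convex_Icc u₀ u₁)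
      (fun u hu => (hderiv u (hsub hu)).continuousAt.continuousWithinAt)
      (fun u hu => (hderiv u (hsub (interior_subset hu))).differentiableAt.differentiableWithinAt)
      (fun u hu => by
        have hu' := interior_subset hu
        rw [(hderiv u (hsub hu')).deriv]
        exact mul_nonneg (h3 u (hsub hu')) (Real.sin_nonneg_of_nonneg_of_le_pi
          (by linarith [hu'.2]) (by linarith [hu'.1])))
      (left_mem_Icc.2 h) (right_mem_Icc.2 h) h
    simpa only [hend] using this
  · have hsub : Icc u₁ u₀ ⊆ s := hs.ordConnected.out hu₁ hu₀
    have := antitoneOn_of_deriv_nonpos (convex_Icc u₁ u₀)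
      (fun u hu => (hderiv u (hsub hu)).continuousAt.continuousWithinAt)
      (fun u hu => (hderiv u (hsub (interior_subset hu))).differentiableAt.differentiableWithinAt)
      (fun u hu => by
        have hu' := interior_subset hu
        rw [(hderiv u (hsub hu')).deriv]
        exact mul_nonpos_of_nonneg_of_nonpos (h3 u (hsub hu'))
          (Real.sin_nonpos_of_nonpos_of_neg_pi_le (by linarith [hu'.1]) (by linarith [hu'.2])))
      (left_mem_Icc.2 h) (right_mem_Icc.2 h) h
    simpa only [hend] using this

/-- Here f'' + f = 2cos² u - sin² u + E exp(-1/u)(1 + u⁻³(u⁻¹ - 2)), which is nonnegative because u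
< 1/2. -/
theorem exists_tangent_sq_sin_add_exp {E u₀ : ℝ} (hE : 0 ≤ E) (hu₀ : u₀ ∈ Ioo (0 : ℝ) (1 / 2)) :
    ∃ b : ℝ, ∀ u ∈ Ioo (0 : ℝ) (1 / 2),
      (Real.sin u₀ ^ 2 + E * expNegInvGlue u₀) * Real.cos (u - u₀) + b * Real.sin (u - u₀) ≤
        Real.sin u ^ 2 + E * expNegInvGlue u := by
  have hpi := Real.pi_gt_three
  let f : ℝ → ℝ := fun u => Real.sin u ^ 2 + E * Real.exp (-u⁻¹)
  let f' : ℝ → ℝ := fun u => 2 * Real.sin u * Real.cos u + E * (Real.exp (-u⁻¹) * u⁻¹ ^ 2)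
  let f'' : ℝ → ℝ := fun u => 2 * Real.cos u ^ 2 - 2 * Real.sin u ^ 2 +
    E * (Real.exp (-u⁻¹) * (u⁻¹ ^ 4 - 2 * u⁻¹ ^ 3))
  have hinv : ∀ u : ℝ, u ≠ 0 → HasDerivAt (fun u : ℝ => u⁻¹) (-u⁻¹ ^ 2) u := by
    intro u hu
    simpa using hasDerivAt_inv hu
  have hexp : ∀ u : ℝ, u ≠ 0 → HasDerivAt (fun u : ℝ => Real.exp (-u⁻¹))
      (Real.exp (-u⁻¹) * u⁻¹ ^ 2) u := by
    intro u hu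
    simpa using (hinv u hu).neg.exp
  have hglue : ∀ u ∈ Ioo (0 : ℝ) (1 / 2), expNegInvGlue u = Real.exp (-u⁻¹) := by
    intro u hu
    rw [expNegInvGlue, if_neg (not_le.2 hu.1)]
  refine ⟨f' u₀, fun u hu => ?_⟩
  have := cos_sin_tangent_le (f := f) (f' := f') (f'' := f'') (convex_Ioo (0 : ℝ) (1 / 2))
    (fun u hu => by
      have := ((Real.hasDerivAt_sin u).pow 2).add ((hexp u hu.1.ne').const_mul E)
      refine this.congr_deriv ?_
      simp [f'])
    (fun u hu => by
      have := (((Real.hasDerivAt_sin u).const_mul 2).mul (Real.hasDerivAt_cos u)).add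
        (((hexp u hu.1.ne').mul ((hinv u hu.1.ne').pow 2)).const_mul E)
      refine this.congr_deriv ?_
      simp only [f'', Pi.pow_apply, Nat.cast_ofNat, Nat.add_one_sub_one, pow_one]
      ring)
    (fun u hu => by
      have h1 : Real.sin u ≤ 1 / 2 := (Real.sin_le hu.1.le).trans hu.2.le
      have h2 : 0 ≤ Real.sin u := Real.sin_nonneg_of_nonneg_of_le_pi hu.1.le (by linarith [hu.2])
      have h3 := Real.sin_sq_add_cos_sq u
      have h4 : 2 ≤ u⁻¹ := by
        rw [le_inv_comm₀ (by norm_num) hu.1]; linarith [hu.2]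
      have h5 : 0 ≤ E * (Real.exp (-u⁻¹) * (u⁻¹ ^ 4 - 2 * u⁻¹ ^ 3)) := by
        have : 0 ≤ u⁻¹ ^ 3 * (u⁻¹ - 2) := mul_nonneg (by positivity) (by linarith)
        have h6 : u⁻¹ ^ 4 - 2 * u⁻¹ ^ 3 = u⁻¹ ^ 3 * (u⁻¹ - 2) := by ring
        rw [h6]; positivity
      have h6 : 0 ≤ E * Real.exp (-u⁻¹) := by positivity
      simp only [f, f'']
      nlinarith)
    hu₀ hu (by rw [abs_le]; constructor <;> linarith [hu.1, hu.2, hu₀.1, hu₀.2])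
  simpa only [f, ← hglue u hu, ← hglue u₀ hu₀] using this

/-- The profile is not C² at π/2, so the two sides are glued by hand: a zero tangent on the flat
part, and beyond it the smooth tangent, shown to be nonpositive over the flat part. -/
theorem exists_tangent_lam_of_nonneg {E t₀ : ℝ} (hE : 0 ≤ E) (h0 : 0 ≤ t₀)
    (ht₀ : t₀ < Real.pi / 2 + 1 / 2) :
    ∃ b : ℝ, ∀ t, t < Real.pi / 2 + 1 / 2 → |t - t₀| < Real.pi →
      lam E t₀ * Real.cos (t - t₀) + b * Real.sin (t - t₀) ≤ lam E t := by
  have hpi := Real.pi_gt_three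
  rcases le_or_gt t₀ (Real.pi / 2) with h | h
  · refine ⟨0, fun t _ _ => ?_⟩
    rw [lam_eq_zero (abs_le.2 ⟨by linarith, h⟩)]
    simpa using lam_nonneg hE t
  obtain ⟨b, hb⟩ := exists_tangent_sq_sin_add_exp hE (u₀ := t₀ - Real.pi / 2)
    ⟨by linarith, by linarith⟩
  have hlam : ∀ t, Real.pi / 2 ≤ t → t ≤ Real.pi / 2 + 1 / 2 → lam E t =
      Real.sin (t - Real.pi / 2) ^ 2 + E * expNegInvGlue (t - Real.pi / 2) := by
    intro t h1 h2
    rw [← lam_pi_div_two_add (by linarith) (by linarith), add_sub_cancel]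
  have hb' : ∀ t ∈ Ioo (Real.pi / 2) (Real.pi / 2 + 1 / 2),
      lam E t₀ * Real.cos (t - t₀) + b * Real.sin (t - t₀) ≤ lam E t := by
    intro t ht
    have := hb (t - Real.pi / 2) ⟨by linarith [ht.1], by linarith [ht.2]⟩
    rw [← hlam t ht.1.le ht.2.le, ← hlam t₀ h.le ht₀.le] at this
    simpa using this
  have hend : lam E t₀ * Real.cos (Real.pi / 2 - t₀) + b * Real.sin (Real.pi / 2 - t₀) ≤ 0 := by
    have hlim : lam E (Real.pi / 2) = 0 := lam_eq_zero (abs_le.2 ⟨by linarith, le_rfl⟩)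
    rw [← hlim]
    have hmem : Ioo (Real.pi / 2) (Real.pi / 2 + 1 / 2) ∈ 𝓝[>] (Real.pi / 2) :=
      Ioo_mem_nhdsGT (by linarith)
    have hc : Continuous fun t => lam E t₀ * Real.cos (t - t₀) + b * Real.sin (t - t₀) := by
      fun_prop
    refine le_of_tendsto_of_tendsto (b := 𝓝[>] (Real.pi / 2))
      ((hc.tendsto _).mono_left nhdsWithin_le_nhds)
      (((continuous_lam E).tendsto _).mono_left nhdsWithin_le_nhds) ?_
    filter_upwards [hmem] with t ht using hb' t ht
  refine ⟨b, fun t ht htd => ?_⟩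
  rcases lt_or_ge (Real.pi / 2) t with h' | h'
  · exact hb' t ⟨h', ht⟩
  refine le_trans ?_ (lam_nonneg hE t)
  obtain ⟨hd1, hd2⟩ := abs_lt.1 htd
  have hs1 : 0 < Real.sin (t₀ - Real.pi / 2) :=
    Real.sin_pos_of_pos_of_lt_pi (by linarith) (by linarith)
  have hs2 : 0 ≤ Real.sin (t₀ - t) :=
    Real.sin_nonneg_of_nonneg_of_le_pi (by linarith) (by linarith)
  have hs3 : 0 ≤ Real.sin (Real.pi / 2 - t) :=
    Real.sin_nonneg_of_nonneg_of_le_pi (by linarith) (by linarith)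
  -- The value of a sinusoid at π/2 is a combination of its values at t and t₀ with nonnegative
  -- weights. It is nonpositive at π/2 and nonnegative at t₀, hence nonpositive at t.
  have hid : (lam E t₀ * Real.cos (Real.pi / 2 - t₀) + b * Real.sin (Real.pi / 2 - t₀)) *
      Real.sin (t₀ - t) = (lam E t₀ * Real.cos (t - t₀) + b * Real.sin (t - t₀)) *
      Real.sin (t₀ - Real.pi / 2) + lam E t₀ * Real.sin (Real.pi / 2 - t) := by
    have e1 : Real.pi / 2 - t = (Real.pi / 2 - t₀) - (t - t₀) := by ring
    have e2 : t₀ - t = -(t - t₀) := by ring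
    have e3 : t₀ - Real.pi / 2 = -(Real.pi / 2 - t₀) := by ring
    rw [e1, e2, e3, Real.sin_sub (Real.pi / 2 - t₀), Real.sin_neg, Real.sin_neg]
    ring
  have h4 := mul_nonneg (lam_nonneg hE t₀) hs3
  have h5 := mul_nonpos_of_nonpos_of_nonneg hend hs2
  by_contra hcon
  push Not at hcon
  have := mul_pos hcon hs1
  linarith

theorem exists_tangent_lam {E t₀ : ℝ} (hE : 0 ≤ E) (ht₀ : |t₀| < Real.pi / 2 + 1 / 2) :
    ∃ b : ℝ, ∀ t, |t| < Real.pi / 2 + 1 / 2 → |t - t₀| < Real.pi →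
      lam E t₀ * Real.cos (t - t₀) + b * Real.sin (t - t₀) ≤ lam E t := by
  rcases le_total 0 t₀ with h | h
  · obtain ⟨b, hb⟩ := exists_tangent_lam_of_nonneg hE h (lt_of_abs_lt ht₀)
    exact ⟨b, fun t ht htd => hb t (lt_of_abs_lt ht) htd⟩
  · obtain ⟨b, hb⟩ := exists_tangent_lam_of_nonneg hE (neg_nonneg.2 h) 
      (by linarith [(abs_lt.1 ht₀).1])
    refine ⟨-b, fun t ht htd => ?_⟩
    have := hb (-t) (by linarith [(abs_lt.1 ht).1]) (by rwa [← abs_neg, neg_sub_neg, neg_sub])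
    rw [lam_neg, lam_neg, show -t - -t₀ = -(t - t₀) by ring, Real.cos_neg, Real.sin_neg] at this
    linarith

/-- The chord form of sinusoidal convexity: weight the tangent at t₂, evaluated at t₁ and t₃, so
that its sine part cancels. -/
theorem lam_mul_sin_le {E t₁ t₂ t₃ : ℝ} (hE : 0 ≤ E) (h1 : |t₁| < Real.pi / 2 + 1 / 2)
    (h3 : |t₃| < Real.pi / 2 + 1 / 2) (h12 : t₁ < t₂) (h23 : t₂ < t₃) (h13 : t₃ - t₁ < Real.pi) :
    lam E t₂ * Real.sin (t₃ - t₁) ≤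
      lam E t₁ * Real.sin (t₃ - t₂) + lam E t₃ * Real.sin (t₂ - t₁) := by
  rw [abs_lt] at h1 h3
  have h2 : |t₂| < Real.pi / 2 + 1 / 2 := abs_lt.2 ⟨by linarith, by linarith⟩
  obtain ⟨b, hb⟩ := exists_tangent_lam hE h2
  have k1 := hb t₁ (abs_lt.2 h1) (abs_lt.2 ⟨by linarith, by linarith⟩)
  have k3 := hb t₃ (abs_lt.2 h3) (abs_lt.2 ⟨by linarith, by linarith⟩)
  have s1 : 0 ≤ Real.sin (t₃ - t₂) :=
    Real.sin_nonneg_of_nonneg_of_le_pi (by linarith) (by linarith)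
  have s2 : 0 ≤ Real.sin (t₂ - t₁) :=
    Real.sin_nonneg_of_nonneg_of_le_pi (by linarith) (by linarith)
  have m1 := mul_le_mul_of_nonneg_right k1 s1
  have m3 := mul_le_mul_of_nonneg_right k3 s2
  have e1 : t₃ - t₁ = (t₃ - t₂) + (t₂ - t₁) := by ring
  have e2 : t₁ - t₂ = -(t₂ - t₁) := by ring
  rw [e1, Real.sin_add]
  rw [e2, Real.cos_neg, Real.sin_neg] at m1
  nlinarith

/-! ### Geometry of the discs and of the fibres over the w-plane -/

theorem rho_conj (E t : ℝ) (w : ℂ) : rho E (-t) ((starRingEnd ℂ) w) = rho E t w := by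
  simp [rho, lam_neg]

theorem rho_eq_norm (E t : ℝ) (w : ℂ) :
    rho E t w = ‖w - Complex.exp (t * I)‖ ^ 2 - 1 + lam E t := by
  rw [← Complex.normSq_eq_norm_sq, Complex.normSq_apply, rho]
  have h := Real.sin_sq_add_cos_sq t
  simp only [sub_re, sub_im, Complex.exp_ofReal_mul_I_re, Complex.exp_ofReal_mul_I_im]
  linear_combination -h

theorem norm_sq_add_lam_lt {E t : ℝ} {w : ℂ} (h : rho E t w < 0) :
    ‖w‖ ^ 2 + lam E t < 2 * (w.re * Real.cos t + w.im * Real.sin t) := by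
  rw [← Complex.normSq_eq_norm_sq, Complex.normSq_apply]
  unfold rho at h; linarith

theorem re_mul_cos_add_le_norm (t : ℝ) (w : ℂ) :
    w.re * Real.cos t + w.im * Real.sin t ≤ ‖w‖ := by
  refine le_of_sq_le_sq ?_ (norm_nonneg w)
  rw [← Complex.normSq_eq_norm_sq, Complex.normSq_apply]
  nlinarith [Real.sin_sq_add_cos_sq t, sq_nonneg (w.re * Real.sin t - w.im * Real.cos t)]

theorem abs_lt_of_rho_neg {E t : ℝ} {w : ℂ} (hE : Real.exp 2 ≤ E) (h : rho E t w < 0) :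
    |t| < Real.pi / 2 + 1 / 2 := by
  by_contra hcon
  have := one_le_lam hE (not_lt.1 hcon)
  rw [rho_eq_norm] at h
  nlinarith [sq_nonneg ‖w - Complex.exp (t * I)‖]

theorem norm_lt_two_of_rho_neg {E t : ℝ} {w : ℂ} (hE : 0 ≤ E) (h : rho E t w < 0) : ‖w‖ < 2 := by
  have h1 := norm_sq_add_lam_lt h
  have h2 := re_mul_cos_add_le_norm t w
  have h3 := lam_nonneg hE t
  by_contra hcon
  nlinarith

theorem im_pos_of_rho_neg {E t : ℝ} {w : ℂ} (hE : 0 ≤ E) (h : rho E t w < 0)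
    (ht : Real.pi / 2 ≤ t) (ht' : t < Real.pi / 2 + 1 / 2) : 0 < w.im := by
  have hpi := Real.pi_gt_three
  have hc : Real.cos t ≤ 0 :=
    Real.cos_nonpos_of_pi_div_two_le_of_le ht (by linarith)
  have hs : 0 < Real.sin t := Real.sin_pos_of_pos_of_lt_pi (by linarith) (by linarith)
  have := sq_cos_le_lam hE hc
  unfold rho at h
  by_contra hcon
  push Not at hcon
  nlinarith [sq_nonneg (w.re - Real.cos t), mul_nonneg (neg_nonneg.2 hcon) hs.le, sq_nonneg w.im]

theorem mem_slitPlane_of_rho_neg {E t : ℝ} {w : ℂ} (hE : 0 ≤ E) (h : rho E t w < 0) :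
    w ∈ Complex.slitPlane := by
  rw [Complex.mem_slitPlane_iff]
  by_contra hcon
  push Not at hcon
  obtain ⟨h1, h2⟩ := hcon
  unfold rho at h
  rw [h2] at h
  rcases le_total (Real.cos t) 0 with hc | hc
  · have := sq_cos_le_lam hE hc
    nlinarith [sq_nonneg (w.re - Real.cos t)]
  · nlinarith [lam_nonneg hE t, mul_nonneg (neg_nonneg.2 h1) hc, sq_nonneg w.re]

/-- Let X, Y be the coordinates of w rotated by t₁ and t₃ = t₁ + π + d. The first disc forces X > 0.
Since t₁ ≥ -π/2, lam(t₃) ≥ cos² t₃ ≥ sin² d, which completes the square (Y + sin d)² and leaves X² +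
2X cos d > 0. -/
theorem false_of_rho_neg_of_pi_le {E t₁ t₃ : ℝ} {w : ℂ} (hE : Real.exp 2 ≤ E)
    (h1 : rho E t₁ w < 0) (h3 : rho E t₃ w < 0) (h13 : Real.pi ≤ t₃ - t₁)
    (ht : -(Real.pi / 2) ≤ t₁) : False := by
  have hpi := Real.pi_gt_three
  have hE0 : 0 ≤ E := (Real.exp_pos 2).le.trans hE
  obtain ⟨a1, a2⟩ := abs_lt.1 (abs_lt_of_rho_neg hE h1)
  obtain ⟨b1, b2⟩ := abs_lt.1 (abs_lt_of_rho_neg hE h3)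
  set d := t₃ - t₁ - Real.pi with hd
  have hc3 : Real.cos t₃ ≤ 0 :=
    Real.cos_nonpos_of_pi_div_two_le_of_le (by linarith) (by linarith)
  have hlam := sq_cos_le_lam hE0 hc3
  have hsd : 0 ≤ Real.sin d := Real.sin_nonneg_of_nonneg_of_le_pi (by linarith) (by linarith)
  have hcd : 0 ≤ Real.cos d :=
    Real.cos_nonneg_of_neg_pi_div_two_le_of_le (by linarith) (by linarith)
  have hs : Real.sin d ≤ -Real.cos t₃ := by
    have : -Real.cos t₃ = Real.sin (t₃ - Real.pi / 2) := by rw [Real.sin_sub_pi_div_two]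
    rw [this]
    exact Real.sin_le_sin_of_le_of_le_pi_div_two (by linarith) (by linarith) (by linarith)
  have ht3 : t₃ = (t₁ + d) + Real.pi := by rw [hd]; ring
  have hc : Real.cos t₃ = -(Real.cos t₁ * Real.cos d - Real.sin t₁ * Real.sin d) := by
    rw [ht3, Real.cos_add_pi, Real.cos_add]
  have hs' : Real.sin t₃ = -(Real.sin t₁ * Real.cos d + Real.cos t₁ * Real.sin d) := by
    rw [ht3, Real.sin_add_pi, Real.sin_add]
  have hsq : Real.sin d ^ 2 ≤ Real.cos t₃ ^ 2 := by nlinarith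
  have hX := norm_sq_add_lam_lt h1
  have hlam1 := lam_nonneg hE0 t₁
  set X := w.re * Real.cos t₁ + w.im * Real.sin t₁ with hXdef
  set Y := -w.re * Real.sin t₁ + w.im * Real.cos t₁ with hYdef
  have hXpos : 0 < X := by nlinarith [sq_nonneg ‖w‖]
  have hXY : w.re ^ 2 + w.im ^ 2 = X ^ 2 + Y ^ 2 := by
    rw [hXdef, hYdef]
    linear_combination (-(w.re ^ 2 + w.im ^ 2)) * Real.sin_sq_add_cos_sq t₁
  have hXY' : w.re * Real.cos t₃ + w.im * Real.sin t₃ = -(X * Real.cos d + Y * Real.sin d) := by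
    rw [hc, hs', hXdef, hYdef]; ring
  unfold rho at h3
  rw [hXY, hXY'] at h3
  nlinarith [sq_nonneg (Y + Real.sin d), mul_nonneg hXpos.le hcd, mul_pos hXpos hXpos]

theorem sub_lt_pi_of_rho_neg {E t₁ t₃ : ℝ} {w : ℂ} (hE : Real.exp 2 ≤ E)
    (h1 : rho E t₁ w < 0) (h3 : rho E t₃ w < 0) : t₃ - t₁ < Real.pi := by
  have hpi := Real.pi_gt_three
  have hE0 : 0 ≤ E := (Real.exp_pos 2).le.trans hE
  by_contra hcon
  push Not at hcon
  rcases le_or_gt (-(Real.pi / 2)) t₁ with h | h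
  · exact false_of_rho_neg_of_pi_le hE h1 h3 hcon h
  -- Conjugating w reverses time. This reduces t₃ ≤ π/2 to the case above; if instead both times lie
  -- beyond ∓π/2, then w is in both the lower and the upper half-plane.
  have h1' := h1
  have h3' := h3
  rw [← rho_conj] at h1' h3'
  rcases le_or_gt t₃ (Real.pi / 2) with h' | h'
  · exact false_of_rho_neg_of_pi_le hE h3' h1' (by linarith) (by linarith)
  · have k1 := im_pos_of_rho_neg hE0 h3 h'.le (abs_lt.1 (abs_lt_of_rho_neg hE h3)).2
    have k2 := im_pos_of_rho_neg hE0 h1' (by linarith) (abs_lt.1 (abs_lt_of_rho_neg hE h1')).2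
    simp at k2
    linarith

/-- All three parts of `rho` obey the chord inequality: the term linear in (cos t, sin t) with
equality, `lam` by `lam_mul_sin_le`, and the constant ‖w‖² because sine is subadditive here. -/
theorem ordConnected_rho_neg {E : ℝ} (hE : Real.exp 2 ≤ E) (w : ℂ) :
    OrdConnected {t : ℝ | rho E t w < 0} := by
  have hE0 : 0 ≤ E := (Real.exp_pos 2).le.trans hE
  refine ⟨fun t₁ h1 t₃ h3 t₂ h2 => ?_⟩
  simp only [mem_ofPred_eq] at h1 h3 ⊢
  rcases h2.1.eq_or_lt with h | h12
  · rwa [← h]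
  rcases h2.2.eq_or_lt with h | h23
  · rwa [h]
  have h13 := sub_lt_pi_of_rho_neg hE h1 h3
  have hl := lam_mul_sin_le hE0 (abs_lt_of_rho_neg hE h1) (abs_lt_of_rho_neg hE h3) h12 h23 h13
  have s1 : 0 < Real.sin (t₃ - t₂) := Real.sin_pos_of_pos_of_lt_pi (by linarith) (by linarith)
  have s2 : 0 < Real.sin (t₂ - t₁) := Real.sin_pos_of_pos_of_lt_pi (by linarith) (by linarith)
  have s3 : 0 < Real.sin (t₃ - t₁) := Real.sin_pos_of_pos_of_lt_pi (by linarith) (by linarith)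
  have e1 : t₃ - t₁ = (t₃ - t₂) + (t₂ - t₁) := by ring
  have s4 : Real.sin (t₃ - t₁) ≤ Real.sin (t₃ - t₂) + Real.sin (t₂ - t₁) := by
    rw [e1, Real.sin_add]
    nlinarith [Real.cos_le_one (t₃ - t₂), Real.cos_le_one (t₂ - t₁)]
  have id1 : (w.re * Real.cos t₂ + w.im * Real.sin t₂) * Real.sin (t₃ - t₁) =
      (w.re * Real.cos t₁ + w.im * Real.sin t₁) * Real.sin (t₃ - t₂) +
      (w.re * Real.cos t₃ + w.im * Real.sin t₃) * Real.sin (t₂ - t₁) := by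
    rw [Real.sin_sub, Real.sin_sub, Real.sin_sub]
    ring
  have hfin : rho E t₂ w * Real.sin (t₃ - t₁) < 0 := by
    unfold rho at h1 h3 ⊢
    have m1 := mul_neg_of_neg_of_pos h1 s1
    have m3 := mul_neg_of_neg_of_pos h3 s2
    nlinarith [mul_nonneg (add_nonneg (sq_nonneg w.re) (sq_nonneg w.im)) (sub_nonneg.2 s4)]
  by_contra hcon
  push Not at hcon
  nlinarith [mul_nonneg hcon s3.le]

/-! ### Support functions for the worm -/

/-- Where it is negative, the worm function `ρ` makes `-log (-ρ)` supported from below by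
pluriharmonic functions, in the coordinates `(log z, w)`. -/
theorem hasHolSupport_neg_log_rho {E : ℝ} (hE : Real.exp 2 ≤ E) {q₀ : ℂ × ℂ}
    (h : rho E q₀.1.re q₀.2 < 0) :
    HasHolSupport (fun q : ℂ × ℂ => -Real.log (-rho E q.1.re q.2)) q₀ := by
  have hE0 : 0 ≤ E := (Real.exp_pos 2).le.trans hE
  have ht₀ := abs_lt_of_rho_neg hE h
  obtain ⟨b, hb⟩ := exists_tangent_lam hE0 ht₀
  set t₀ := q₀.1.re with ht₀def
  set a := lam E t₀ with ha
  -- |f|² is exp(Im ζ)|w|². In Q it is replaced by the minorant |f|² - |f - f₀|², and `lam` by its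
  -- tangent sinusoid, whose product with exp(Im ζ) is the real part of (a + bi)e^{it₀}e^{-iζ}.
  let f : ℂ × ℂ → ℂ := fun q => q.2 * Complex.exp (-I * q.1 / 2)
  let Q : ℂ × ℂ → ℂ := fun q => 2 * (starRingEnd ℂ) (f q₀) * f q - (Complex.normSq (f q₀) : ℂ) +
    ((a + b * I) * Complex.exp (t₀ * I) - 2 * q.2) * Complex.exp (-I * q.1)
  have hexp : ∀ q : ℂ × ℂ, Complex.exp (-I * q.1) =
      Real.exp q.1.im * (Real.cos q.1.re - Real.sin q.1.re * I) := by
    intro q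
    have : -I * q.1 = (q.1.im : ℂ) + ((-q.1.re : ℝ) : ℂ) * I := by
      conv_lhs => rw [← Complex.re_add_im q.1]
      push_cast
      ring_nf
      rw [Complex.I_sq]; ring
    rw [this, Complex.exp_add, Complex.exp_mul_I, ← Complex.ofReal_exp, ← Complex.ofReal_cos,
      ← Complex.ofReal_sin, Real.cos_neg, Real.sin_neg]
    push_cast; ring
  have hnormf : ∀ q : ℂ × ℂ, Complex.normSq (f q) =
      Real.exp q.1.im * (q.2.re ^ 2 + q.2.im ^ 2) := by
    intro q
    have h1 : f q * f q = q.2 * q.2 * Complex.exp (-I * q.1) := by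
      simp only [f]
      rw [mul_mul_mul_comm, ← Complex.exp_add]
      ring_nf
    have h2 : Complex.normSq (f q) = ‖f q * f q‖ := by
      rw [norm_mul, ← sq, Complex.normSq_eq_norm_sq]
    rw [h2, h1, norm_mul, norm_mul, Complex.norm_exp, ← sq, ← Complex.normSq_eq_norm_sq,
      Complex.normSq_apply]
    simp
    ring
  have hQ : ∀ q : ℂ × ℂ, (Q q).re = Real.exp q.1.im *
      (q.2.re ^ 2 + q.2.im ^ 2 - 2 * (q.2.re * Real.cos q.1.re + q.2.im * Real.sin q.1.re) +
        (a * Real.cos (q.1.re - t₀) + b * Real.sin (q.1.re - t₀))) -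
      Complex.normSq (f q - f q₀) := by
    intro q
    have h1 : (2 * (starRingEnd ℂ) (f q₀) * f q - (Complex.normSq (f q₀) : ℂ)).re =
        Complex.normSq (f q) - Complex.normSq (f q - f q₀) := by
      simp only [Complex.normSq_apply, sub_re, sub_im, mul_re, mul_im, conj_re, conj_im, ofReal_re,
        re_ofNat, im_ofNat]
      ring
    have h2 : (((a + b * I) * Complex.exp (t₀ * I) - 2 * q.2) * Complex.exp (-I * q.1)).re =
        Real.exp q.1.im * (-2 * (q.2.re * Real.cos q.1.re + q.2.im * Real.sin q.1.re) +
        (a * Real.cos (q.1.re - t₀) + b * Real.sin (q.1.re - t₀))) := by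
      rw [hexp, Complex.exp_mul_I, ← Complex.ofReal_cos, ← Complex.ofReal_sin, Real.cos_sub,
        Real.sin_sub]
      simp only [mul_re, mul_im, sub_re, sub_im, add_re, add_im, ofReal_re, ofReal_im, I_re, I_im,
        re_ofNat, im_ofNat]
      ring
    simp only [Q]
    rw [Complex.add_re, h1, h2, hnormf q]
    ring
  have hQ₀ : (Q q₀).re = Real.exp q₀.1.im * rho E q₀.1.re q₀.2 := by
    rw [hQ, ← ht₀def]
    simp only [sub_self, Real.cos_zero, Real.sin_zero, rho, map_zero]
    ring
  set y₀ : ℝ := -(Real.exp q₀.1.im * rho E t₀ q₀.2) with hy₀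
  have hy₀pos : 0 < y₀ := by
    rw [hy₀]; nlinarith [Real.exp_pos q₀.1.im]
  have hcont : ContinuousAt (fun q : ℂ × ℂ => rho E q.1.re q.2) q₀ :=
    ((continuous_rho E).comp (by fun_prop :
      Continuous fun q : ℂ × ℂ => (q.1.re, q.2))).continuousAt
  have hneg : ∀ᶠ q : ℂ × ℂ in 𝓝 q₀, rho E q.1.re q.2 < 0 := hcont.eventually_lt_const h
  have hnear : ∀ᶠ q : ℂ × ℂ in 𝓝 q₀, |q.1.re - t₀| < Real.pi := by
    have : ContinuousAt (fun q : ℂ × ℂ => |q.1.re - t₀|) q₀ := by fun_prop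
    refine this.eventually_lt_const ?_
    simp [ht₀def, Real.pi_pos]
  have hlog : ∀ q : ℂ × ℂ, rho E q.1.re q.2 < 0 → -Real.log (-rho E q.1.re q.2) =
      q.1.im - Real.log (-(Real.exp q.1.im * rho E q.1.re q.2)) := by
    intro q hq
    rw [← mul_neg, Real.log_mul (Real.exp_pos _).ne' (by linarith), Real.log_exp]; ring
  -- -log(-rho) = Im ζ - log y with y = -exp(Im ζ) rho. Here Im ζ = Re(-iζ), and -log y is bounded
  -- below by its tangent line at y₀, then by Re Q ≤ -y.
  refine ⟨fun q => -I * q.1 + ((-Real.log y₀ + 1 : ℝ) : ℂ) + Q q / (y₀ : ℂ), ?_, ?_, ?_⟩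
  · refine Eventually.of_forall fun q => ?_
    simp only [Q, f]
    fun_prop
  · simp only [add_re, ofReal_re, Complex.div_ofReal_re, hQ₀, ← ht₀def]
    rw [hlog q₀ h, ← ht₀def, ← hy₀]
    have : Real.exp q₀.1.im * rho E t₀ q₀.2 = -y₀ := by rw [hy₀]; ring
    rw [this]
    simp
    field_simp
    ring
  · filter_upwards [hneg, hnear] with q hq hqn
    rw [hlog q hq]
    have hy : 0 < -(Real.exp q.1.im * rho E q.1.re q.2) := by
      nlinarith [Real.exp_pos q.1.im]
    set y := -(Real.exp q.1.im * rho E q.1.re q.2) with hydef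
    have h1 : Real.log y ≤ Real.log y₀ + (y / y₀ - 1) := by
      have := Real.log_le_sub_one_of_pos (div_pos hy hy₀pos)
      rw [Real.log_div hy.ne' hy₀pos.ne'] at this
      linarith
    have h2 : (Q q).re ≤ -y := by
      rw [hQ, hydef, neg_neg]
      have := hb q.1.re (abs_lt_of_rho_neg hE hq) hqn
      have h3 := Complex.normSq_nonneg (f q - f q₀)
      have h4 := Real.exp_pos q.1.im
      unfold rho
      nlinarith
    have h3 : (Q q).re / y₀ ≤ -(y / y₀) := by
      rw [← neg_div]
      exact div_le_div_of_nonneg_right h2 hy₀pos.le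
    simp only [add_re, ofReal_re, Complex.div_ofReal_re]
    simp
    linarith

theorem HasHolSupport.congr {E : Type*} [NormedAddCommGroup E] [NormedSpace ℂ E] {u v : E → ℝ}
    {p : E} (hv : HasHolSupport v p) (h : v =ᶠ[𝓝 p] u) : HasHolSupport u p :=
  hv.of_le h.le h.self_of_nhds

theorem exists_local_log {z₀ : ℂ} (hz : z₀ ≠ 0) :
    ∃ L : ℂ → ℂ, ∀ᶠ z in 𝓝 z₀, DifferentiableAt ℂ L z ∧ (L z).re = Real.log ‖z‖ := by
  refine ⟨fun z => Complex.log (z / z₀) + (Real.log ‖z₀‖ : ℂ), ?_⟩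
  have hc : ContinuousAt (fun z : ℂ => z / z₀) z₀ := by fun_prop
  have h1 : ∀ᶠ z in 𝓝 z₀, z / z₀ ∈ slitPlane :=
    hc.eventually_mem (isOpen_slitPlane.mem_nhds (by simp [hz]))
  filter_upwards [h1, isOpen_ne.mem_nhds hz] with z hz1 hz2
  constructor
  · have : DifferentiableAt ℂ (fun z : ℂ => z / z₀) z := by fun_prop
    exact (this.clog hz1).add_const _
  · rw [Complex.add_re, Complex.log_re, norm_div, Complex.ofReal_re,
      Real.log_div (norm_ne_zero_iff.2 hz2) (norm_ne_zero_iff.2 hz)]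
    ring

/-! ### Boundedness, pseudoconvexity, connectedness and closure -/

theorem abs_lt_of_rho_nonpos {E t : ℝ} {w : ℂ} (hE : Real.exp 2 ≤ E) (h : rho E t w ≤ 0) :
    |t| < Real.pi / 2 + 1 := by
  by_contra hcon
  push Not at hcon
  have key : ∀ s : ℝ, 1 ≤ s → Real.exp (-1) ≤ expNegInvGlue s := by
    intro s hs
    refine le_trans ?_ (expNegInvGlue.monotone hs)
    rw [expNegInvGlue, if_neg (by norm_num)]
    norm_num
  have h1 := expNegInvGlue.nonneg (t - Real.pi / 2)
  have h2 := expNegInvGlue.nonneg (-t - Real.pi / 2)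
  have h3 : Real.exp (-1) ≤ expNegInvGlue (t - Real.pi / 2) + expNegInvGlue (-t - Real.pi / 2) := by
    rcases le_abs.1 hcon with h | h
    · have := key (t - Real.pi / 2) (by linarith); linarith
    · have := key (-t - Real.pi / 2) (by linarith); linarith
  have h4 : Real.exp 2 * Real.exp (-1) = Real.exp 1 := by rw [← Real.exp_add]; norm_num
  have h5 := Real.exp_pos (-1)
  have h6 : 0 ≤ max 0 (-Real.cos t) ^ 2 := by positivity
  have h7 : 1 < Real.exp 1 := Real.one_lt_exp_iff.2 one_pos
  have h8 : 1 < lam E t := by unfold lam; nlinarith [Real.exp_pos 2]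
  rw [rho_eq_norm] at h
  nlinarith [sq_nonneg ‖w - Complex.exp (t * I)‖]

theorem norm_le_two_of_rho_nonpos {E t : ℝ} {w : ℂ} (hE : 0 ≤ E) (h : rho E t w ≤ 0) :
    ‖w‖ ≤ 2 := by
  have h2 := re_mul_cos_add_le_norm t w
  have h3 := lam_nonneg hE t
  have h4 : ‖w‖ ^ 2 = w.re ^ 2 + w.im ^ 2 := by
    rw [← Complex.normSq_eq_norm_sq, Complex.normSq_apply]; ring
  unfold rho at h
  by_contra hcon
  nlinarith

theorem lam_mul_lt {E t σ : ℝ} (hE : 0 < E) (h0 : 0 ≤ σ) (h1 : σ < 1) (ht : Real.pi / 2 < |t|)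
    (ht' : |t| ≤ Real.pi / 2 + 1) : lam E (σ * t) < lam E t := by
  wlog hpos : 0 ≤ t generalizing t
  · have := this (t := -t) (by rwa [abs_neg]) (by rwa [abs_neg]) (by linarith)
    rwa [mul_neg, lam_neg, lam_neg] at this
  have hpi := Real.pi_gt_three
  rw [abs_of_nonneg hpos] at ht ht'
  have hlt : σ * t < t := by nlinarith
  rcases le_or_gt (σ * t) (Real.pi / 2) with h | h
  · rw [lam_eq_zero (abs_le.2 ⟨by nlinarith, h⟩)]
    exact lam_pos hE (by rwa [abs_of_nonneg hpos])
  · have e1 : σ * t = Real.pi / 2 + (σ * t - Real.pi / 2) := by ring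
    have e2 : t = Real.pi / 2 + (t - Real.pi / 2) := by ring
    rw [e1]
    nth_rewrite 2 [e2]
    rw [lam_pi_div_two_add (by linarith) (by linarith),
      lam_pi_div_two_add (by linarith) (by linarith)]
    have hs : Real.sin (σ * t - Real.pi / 2) < Real.sin (t - Real.pi / 2) :=
      Real.sin_lt_sin_of_lt_of_le_pi_div_two (by linarith) (by linarith) (by linarith)
    have hs0 : 0 ≤ Real.sin (σ * t - Real.pi / 2) :=
      Real.sin_nonneg_of_nonneg_of_le_pi (by linarith) (by linarith)
    have hg : expNegInvGlue (σ * t - Real.pi / 2) ≤ expNegInvGlue (t - Real.pi / 2) :=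
      expNegInvGlue.monotone (by linarith)
    nlinarith

theorem lam_mul_le {E t σ : ℝ} (hE : 0 < E) (h0 : 0 ≤ σ) (h1 : σ ≤ 1)
    (ht' : |t| ≤ Real.pi / 2 + 1) : lam E (σ * t) ≤ lam E t := by
  rcases h1.eq_or_lt with rfl | h1
  · rw [one_mul]
  rcases le_or_gt |t| (Real.pi / 2) with h | h
  · rw [lam_eq_zero h, lam_eq_zero]
    rw [abs_mul, abs_of_nonneg h0]
    nlinarith [abs_nonneg t]
  · exact (lam_mul_lt hE h0 h1 h ht').le

/-- The worm domain. -/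
def wormDomain (E : ℝ) : Set (Cn 2) := {x | x 0 ≠ 0 ∧ rho E (Real.log ‖x 0‖) (x 1) < 0}

/-- The closed sublevel sets of the worm function. -/
def wormSublevel (E c : ℝ) : Set (Cn 2) := {x | x 0 ≠ 0 ∧ rho E (Real.log ‖x 0‖) (x 1) ≤ c}

theorem continuous_coord {n : ℕ} (i : Fin n) : Continuous fun x : Cn n => x i := by fun_prop

theorem continuousAt_log_norm_coord {x : Cn 2} (hx : x 0 ≠ 0) :
    ContinuousAt (fun x : Cn 2 => Real.log ‖x 0‖) x :=
  ((continuous_coord 0).norm.continuousAt).log (norm_ne_zero_iff.2 hx)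

theorem continuousAt_rho_coord (E : ℝ) {x : Cn 2} (hx : x 0 ≠ 0) :
    ContinuousAt (fun x : Cn 2 => rho E (Real.log ‖x 0‖) (x 1)) x :=
  (continuous_rho E).continuousAt.comp (f := fun x : Cn 2 => (Real.log ‖x 0‖, x 1))
    ((continuousAt_log_norm_coord hx).prodMk (continuous_coord 1).continuousAt)

theorem isOpen_wormDomain (E : ℝ) : IsOpen (wormDomain E) := by
  rw [isOpen_iff_mem_nhds]
  rintro x ⟨hx, hx'⟩
  filter_upwards [(isOpen_ne.preimage (continuous_coord (n := 2) 0)).mem_nhds hx,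
    (continuousAt_rho_coord E hx).eventually_lt_const hx'] with y h1 h2 using ⟨h1, h2⟩

theorem norm_le_add_coord (x : Cn 2) : ‖x‖ ≤ ‖x 0‖ + ‖x 1‖ := by
  rw [EuclideanSpace.norm_eq, Fin.sum_univ_two]
  refine Real.sqrt_le_iff.2 ⟨by positivity, ?_⟩
  nlinarith [norm_nonneg (x 0), norm_nonneg (x 1)]

theorem norm_coord_le (x : Cn 2) (i : Fin 2) : ‖x i‖ ≤ ‖x‖ := PiLp.norm_apply_le x i

theorem exp_neg_three_le_of_mem_wormSublevel {E c : ℝ} (hE : Real.exp 2 ≤ E) (hc : c ≤ 0)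
    {x : Cn 2} (hx : x ∈ wormSublevel E c) :
    Real.exp (-3) ≤ ‖x 0‖ ∧ ‖x 0‖ ≤ Real.exp 3 ∧ ‖x 1‖ ≤ 2 := by
  have hpi := Real.pi_lt_d2
  have hE0 : 0 ≤ E := (Real.exp_pos 2).le.trans hE
  obtain ⟨h1, h2⟩ := abs_lt.1 (abs_lt_of_rho_nonpos hE (hx.2.trans hc))
  have hpos := norm_pos_iff.2 hx.1
  refine ⟨?_, ?_, norm_le_two_of_rho_nonpos hE0 (hx.2.trans hc)⟩
  · rw [← Real.le_log_iff_exp_le hpos]; linarith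
  · rw [← Real.log_le_iff_le_exp hpos]; linarith

theorem isCompact_wormSublevel {E c : ℝ} (hE : Real.exp 2 ≤ E) (hc : c ≤ 0) :
    IsCompact (wormSublevel E c) := by
  refine Metric.isCompact_of_isClosed_isBounded ?_ ?_
  · have hs : IsClosed {x : Cn 2 | Real.exp (-3) ≤ ‖x 0‖} :=
      isClosed_le continuous_const (continuous_coord 0).norm
    have hcont : ContinuousOn (fun x : Cn 2 => rho E (Real.log ‖x 0‖) (x 1))
        {x : Cn 2 | Real.exp (-3) ≤ ‖x 0‖} := fun x hx =>
      (continuousAt_rho_coord E (norm_pos_iff.1 ((Real.exp_pos _).trans_le hx))).continuousWithinAt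
    have := hcont.preimage_isClosed_of_isClosed hs (isClosed_Iic (a := c))
    have heq : wormSublevel E c = {x : Cn 2 | Real.exp (-3) ≤ ‖x 0‖} ∩
        (fun x : Cn 2 => rho E (Real.log ‖x 0‖) (x 1)) ⁻¹' Iic c := by
      ext x
      constructor
      · intro hx
        exact ⟨(exp_neg_three_le_of_mem_wormSublevel hE hc hx).1, hx.2⟩
      · intro hx
        exact ⟨norm_pos_iff.1 ((Real.exp_pos _).trans_le hx.1), hx.2⟩
    rwa [heq]
  · refine (Metric.isBounded_closedBall (x := (0 : Cn 2)) (r := Real.exp 3 + 2)).subset ?_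
    intro x hx
    obtain ⟨-, h2, h3⟩ := exp_neg_three_le_of_mem_wormSublevel hE hc hx
    rw [mem_closedBall_zero_iff]
    exact (norm_le_add_coord x).trans (add_le_add h2 h3)

theorem wormDomain_subset_wormSublevel (E : ℝ) : wormDomain E ⊆ wormSublevel E 0 :=
  fun _ hx => ⟨hx.1, hx.2.le⟩

theorem isBounded_wormDomain {E : ℝ} (hE : Real.exp 2 ≤ E) : Bornology.IsBounded (wormDomain E) :=
  (isCompact_wormSublevel hE le_rfl).isBounded.subset (wormDomain_subset_wormSublevel E)

theorem isOpenPseudoconvex_wormDomain {E : ℝ} (hE : Real.exp 2 ≤ E) :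
    IsOpenPseudoconvex (wormDomain E) := by
  refine ⟨isOpen_wormDomain E, fun x => -Real.log (-rho E (Real.log ‖x 0‖) (x 1)), ?_, fun c => ?_⟩
  · refine continuousPlurisubharmonicOn_of_hasHolSupport ?_ ?_
    · intro x hx
      exact ((continuousAt_rho_coord E hx.1).neg.log
        (neg_ne_zero.2 hx.2.ne)).neg.continuousWithinAt
    · intro x hx
      obtain ⟨L, hL⟩ := exists_local_log hx.1
      have hL' := (continuous_coord (n := 2) 0).continuousAt.tendsto.eventually (l₁ := 𝓝 x) hL
      have h0 := hL'.self_of_nhds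
      have := (hasHolSupport_neg_log_rho hE (q₀ := (L (x 0), x 1))
        (by simpa [h0.2] using hx.2)).comp (f := fun x : Cn 2 => (L (x 0), x 1)) (p := x) (by
          filter_upwards [hL'] with y hy
          have h1 : DifferentiableAt ℂ (fun y : Cn 2 => y 0) y := by fun_prop
          have h2 : DifferentiableAt ℂ (fun y : Cn 2 => y 1) y := by fun_prop
          exact (hy.1.comp y h1).prodMk h2)
      refine this.congr ?_
      filter_upwards [hL'] with y hy
      simp [hy.2]
  · have : {x | x ∈ wormDomain E ∧ -Real.log (-rho E (Real.log ‖x 0‖) (x 1)) ≤ c} =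
        wormSublevel E (-Real.exp (-c)) := by
      ext x
      simp only [mem_ofPred_eq, wormDomain, wormSublevel]
      constructor
      · rintro ⟨⟨h1, h2⟩, h3⟩
        refine ⟨h1, ?_⟩
        have := (Real.le_log_iff_exp_le (neg_pos.2 h2)).1 (neg_le.1 h3)
        linarith
      · rintro ⟨h1, h2⟩
        have h4 := Real.exp_pos (-c)
        have h5 : rho E (Real.log ‖x 0‖) (x 1) < 0 := by linarith
        refine ⟨⟨h1, h5⟩, neg_le.1 ?_⟩
        rw [Real.le_log_iff_exp_le (neg_pos.2 h5)]
        linarith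
    rw [this]
    exact isCompact_wormSublevel hE (by linarith [Real.exp_pos (-c)])

/-- Connectedness is read off from this parametrization by log|z|, arg z and the rescaled disc
coordinate. -/
theorem wormDomain_eq_image (E : ℝ) : wormDomain E =
    (fun q : ℝ × ℝ × ℂ => (!₂[Complex.exp (q.1 + q.2.1 * I),
      Complex.exp (q.1 * I) + (Real.sqrt (1 - lam E q.1) : ℂ) * q.2.2] : Cn 2)) ''
      ({t | lam E t < 1} ×ˢ univ ×ˢ ball 0 1) := by
  ext x
  constructor
  · rintro ⟨h1, h2⟩
    set t := Real.log ‖x 0‖ with ht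
    rw [rho_eq_norm] at h2
    have hpos : 0 < 1 - lam E t := by nlinarith [sq_nonneg ‖x 1 - Complex.exp (t * I)‖]
    have hsq := Real.sqrt_pos.2 hpos
    have hsqC : (Real.sqrt (1 - lam E t) : ℂ) ≠ 0 := by exact_mod_cast hsq.ne'
    refine ⟨(t, Complex.arg (x 0), (x 1 - Complex.exp (t * I)) / (Real.sqrt (1 - lam E t) : ℂ)),
      ⟨by simpa using hpos, trivial, ?_⟩, ?_⟩
    · rw [mem_ball_zero_iff, norm_div, Complex.norm_real, Real.norm_of_nonneg hsq.le,
        div_lt_one hsq]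
      exact Real.lt_sqrt_of_sq_lt (by linarith)
    · ext i
      fin_cases i
      · simp only [Fin.zero_eta, Matrix.cons_val_zero]
        rw [Complex.exp_add, ht, ← Complex.ofReal_exp, Real.exp_log (norm_pos_iff.2 h1)]
        exact Complex.norm_mul_exp_arg_mul_I (x 0)
      · simp only [Fin.mk_one, Matrix.cons_val_one, Matrix.cons_val_fin_one]
        rw [mul_div_cancel₀ _ hsqC]; ring
  · rintro ⟨⟨t, s, v⟩, ⟨h1, -, h3⟩, rfl⟩
    have hn : Real.log ‖Complex.exp (t + s * I)‖ = t := by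
      rw [Complex.norm_exp]; simp
    refine ⟨by simp, ?_⟩
    simp only [Matrix.cons_val_zero, Matrix.cons_val_one, Matrix.cons_val_fin_one]
    simp only [mem_ofPred_eq] at h1
    rw [hn, rho_eq_norm, add_sub_cancel_left, norm_mul, Complex.norm_real,
      Real.norm_of_nonneg (Real.sqrt_nonneg _), mul_pow, Real.sq_sqrt (by linarith)]
    have h3' : ‖v‖ < 1 := mem_ball_zero_iff.1 h3
    have h4 : ‖v‖ ^ 2 < 1 := by nlinarith [norm_nonneg v]
    nlinarith

theorem isConnected_wormDomain {E : ℝ} (hE : Real.exp 2 ≤ E) : IsConnected (wormDomain E) := by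
  have hE0 : 0 < E := (Real.exp_pos 2).trans_le hE
  rw [wormDomain_eq_image E]
  have h0 : (0 : ℝ) ∈ {t | lam E t < 1} := by
    simp only [mem_ofPred_eq]
    rw [lam_eq_zero (by simpa using (half_pos Real.pi_pos).le)]
    exact one_pos
  have hstar : StarConvex ℝ (0 : ℝ) {t | lam E t < 1} := by
    rw [starConvex_zero_iff]
    intro t ht a ha0 ha1
    simp only [mem_ofPred_eq] at ht ⊢
    have hlt : |t| ≤ Real.pi / 2 + 1 := by
      by_contra hcon
      push Not at hcon
      exact absurd ht (not_lt.2 (one_le_lam hE (by linarith)))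
    exact (lam_mul_le hE0 ha0 ha1 hlt).trans_lt ht
  have hconn : IsConnected ({t | lam E t < 1} ×ˢ (univ : Set ℝ) ×ˢ ball (0 : ℂ) 1) :=
    (hstar.isPathConnected h0).isConnected.prod (isConnected_univ.prod
      ((convex_ball 0 1).isConnected (nonempty_ball.2 one_pos)))
  refine hconn.image _ (Continuous.continuousOn ?_)
  have hl := continuous_lam E
  refine (PiLp.continuous_toLp 2 _).comp (continuous_pi fun i => ?_)
  fin_cases i
  · simp only [Fin.zero_eta, Matrix.cons_val_zero]; fun_prop
  · simp only [Fin.mk_one, Matrix.cons_val_one, Matrix.cons_val_fin_one]; fun_prop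

theorem closure_wormDomain {E : ℝ} (hE : Real.exp 2 ≤ E) :
    closure (wormDomain E) = wormSublevel E 0 := by
  have hE0 : 0 < E := (Real.exp_pos 2).trans_le hE
  refine subset_antisymm (closure_minimal (wormDomain_subset_wormSublevel E)
    (isCompact_wormSublevel hE le_rfl).isClosed) ?_
  rintro x ⟨hx0, hx1⟩
  set t := Real.log ‖x 0‖ with ht
  have hlt := abs_lt_of_rho_nonpos hE hx1
  rw [rho_eq_norm] at hx1
  set e : ℂ := Complex.exp (t * I) with he
  -- Time and displacement from the disc centre are both multiplied by σ < 1. Strictness comes from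
  -- σ² < 1 when |t| ≤ π/2, and from the strict decrease of `lam` otherwise.
  let γ : ℝ → Cn 2 := fun σ => !₂[x 0 * Complex.exp (((σ - 1) * t : ℝ) : ℂ),
    Complex.exp ((σ * t : ℝ) * I) + σ * (x 1 - e)]
  have hγ : Continuous γ := by
    refine (PiLp.continuous_toLp 2 _).comp (continuous_pi fun i => ?_)
    fin_cases i
    · simp only [Fin.zero_eta, Matrix.cons_val_zero]; fun_prop
    · simp only [Fin.mk_one, Matrix.cons_val_one, Matrix.cons_val_fin_one]; fun_prop
  have hγ1 : γ 1 = x := by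
    ext i
    fin_cases i
    · simp [γ]
    · simp [γ, he]
  have hmem : ∀ σ ∈ Ioo (0 : ℝ) 1, γ σ ∈ wormDomain E := by
    intro σ hσ
    have hn : Real.log ‖x 0 * Complex.exp (((σ - 1) * t : ℝ) : ℂ)‖ = σ * t := by
      rw [norm_mul, Complex.norm_exp, Complex.ofReal_re,
        Real.log_mul (norm_ne_zero_iff.2 hx0) (Real.exp_pos _).ne', Real.log_exp, ← ht]
      ring
    refine ⟨mul_ne_zero hx0 (Complex.exp_ne_zero _), ?_⟩
    simp only [γ, Matrix.cons_val_zero, Matrix.cons_val_one,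
      Matrix.cons_val_fin_one]
    rw [hn, rho_eq_norm, add_sub_cancel_left, norm_mul, Complex.norm_real,
      Real.norm_of_nonneg hσ.1.le, mul_pow]
    have h1 := lam_mul_le hE0 hσ.1.le hσ.2.le hlt.le
    have h2 : σ ^ 2 < 1 := by nlinarith [hσ.1, hσ.2]
    rcases le_or_gt |t| (Real.pi / 2) with h | h
    · have h3 : lam E (σ * t) = 0 := by
        apply lam_eq_zero
        rw [abs_mul, abs_of_pos hσ.1]
        nlinarith [abs_nonneg t, hσ.1, hσ.2]
      rw [lam_eq_zero h] at hx1
      rw [h3]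
      nlinarith [sq_nonneg ‖x 1 - e‖, sq_nonneg σ]
    · have h3 := lam_mul_lt hE0 hσ.1.le hσ.2 h hlt.le
      nlinarith [sq_nonneg ‖x 1 - e‖]
  have hnhds : Ioo (0 : ℝ) 1 ∈ 𝓝[<] (1 : ℝ) := Ioo_mem_nhdsLT one_pos
  refine mem_closure_of_tendsto (b := 𝓝[<] (1 : ℝ)) (f := γ) ?_
    (by filter_upwards [hnhds] with σ hσ using hmem σ hσ)
  have := (hγ.tendsto 1).mono_left (nhdsWithin_le_nhds (s := Iio 1))
  rwa [hγ1] at this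

/-! ### Regularity of the boundary -/

theorem hasDerivAt_max_zero_sq (y : ℝ) :
    HasDerivAt (fun y : ℝ => max 0 y ^ 2) (2 * max 0 y) y := by
  rcases lt_trichotomy y 0 with h | h | h
  · rw [max_eq_left h.le, mul_zero]
    refine (hasDerivAt_const y (0 : ℝ)).congr_of_eventuallyEq ?_
    filter_upwards [isOpen_Iio.mem_nhds h] with x hx
    rw [max_eq_left (le_of_lt hx)]; simp
  · subst h
    simp only [max_self, mul_zero]
    rw [hasDerivAt_iff_isLittleO]
    have h1 : (fun x : ℝ => x ^ 2) =o[𝓝 0] fun x : ℝ => x := Asymptotics.isLittleO_pow_id one_lt_two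
    have h2 : (fun x : ℝ => max 0 x ^ 2) =O[𝓝 0] fun x : ℝ => x ^ 2 := by
      refine Asymptotics.IsBigO.of_bound 1 (Eventually.of_forall fun x => ?_)
      rw [one_mul, Real.norm_of_nonneg (sq_nonneg _), Real.norm_of_nonneg (sq_nonneg _)]
      rcases le_total 0 x with h | h
      · rw [max_eq_right h]
      · rw [max_eq_left h]; nlinarith
    simpa using h2.trans_isLittleO h1
  · rw [max_eq_right h.le]
    have := (hasDerivAt_id y).pow 2
    refine (this.congr_of_eventuallyEq ?_).congr_deriv (by simp)
    filter_upwards [isOpen_Ioi.mem_nhds h] with x hx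
    rw [max_eq_right (le_of_lt hx)]; simp

/-- The derivative S' + 2 max(0, N) N' is a C¹ function of the pair (max(0, N), x), and this pair
depends Lipschitz-continuously on x. -/
theorem exists_isC11On_add_max_zero_sq {F : Type*} [NormedAddCommGroup F] [NormedSpace ℝ F]
    {S N : F → ℝ} {p : F} (hS : ContDiffAt ℝ 2 S p) (hN : ContDiffAt ℝ 2 N p) :
    ∃ V : Set F, IsOpen V ∧ p ∈ V ∧ IsC11On (fun x => S x + max 0 (N x) ^ 2) V := by
  have hS' : ContDiffAt ℝ 1 (fderiv ℝ S) p := hS.fderiv_right (by norm_num)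
  have hN' : ContDiffAt ℝ 1 (fderiv ℝ N) p := hN.fderiv_right (by norm_num)
  have hmain : ContDiffAt ℝ 1 (fun q : ℝ × F => fderiv ℝ S q.2 + (2 * q.1) • fderiv ℝ N q.2)
      (max 0 (N p), p) := by
    have h1 : ContDiffAt ℝ 1 (fun q : ℝ × F => fderiv ℝ S q.2) (max 0 (N p), p) :=
      hS'.comp (max 0 (N p), p) contDiffAt_snd
    have h2 : ContDiffAt ℝ 1 (fun q : ℝ × F => fderiv ℝ N q.2) (max 0 (N p), p) :=
      hN'.comp (max 0 (N p), p) contDiffAt_snd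
    exact h1.add ((contDiffAt_const.mul contDiffAt_fst).smul h2)
  obtain ⟨K, s, hs, hK⟩ := hmain.exists_lipschitzOnWith
  obtain ⟨K', s', hs', hK'⟩ := (hN.of_le one_le_two).exists_lipschitzOnWith
  have hcont : ContinuousAt (fun x => (max 0 (N x), x)) p :=
    ContinuousAt.prodMk (continuousAt_const.max hN.continuousAt) continuousAt_id
  have hev : ∀ᶠ x in 𝓝 p, x ∈ s' ∧ (max 0 (N x), x) ∈ s ∧
      DifferentiableAt ℝ S x ∧ DifferentiableAt ℝ N x := by
    have h1 := hS.eventually (by decide)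
    have h2 := hN.eventually (by decide)
    filter_upwards [hs', hcont.preimage_mem_nhds hs, h1, h2] with x k1 k2 k3 k4
    exact ⟨k1, k2, k3.differentiableAt (by decide), k4.differentiableAt (by decide)⟩
  obtain ⟨V, hV, hVo, hpV⟩ := _root_.eventually_nhds_iff.1 hev
  have hderiv : ∀ x ∈ V, HasFDerivAt (fun x => S x + max 0 (N x) ^ 2)
      (fderiv ℝ S x + (2 * max 0 (N x)) • fderiv ℝ N x) x := by
    intro x hx
    obtain ⟨-, -, h3, h4⟩ := hV x hx
    exact h3.hasFDerivAt.add ((hasDerivAt_max_zero_sq (N x)).comp_hasFDerivAt x h4.hasFDerivAt)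
  refine ⟨V, hVo, hpV, fun x hx => (hderiv x hx).differentiableAt.differentiableWithinAt,
    K * max K' 1, ?_⟩
  have hlip : LipschitzOnWith (max K' 1) (fun x => (max 0 (N x), x)) V := by
    have h1 : LipschitzOnWith K' (fun x => max 0 (N x)) V := by
      intro x hx y hy
      refine le_trans ?_ (hK' (hV x hx).1 (hV y hy).1)
      rw [edist_dist, edist_dist]
      refine ENNReal.ofReal_le_ofReal ?_
      rw [Real.dist_eq, Real.dist_eq]
      simpa [max_comm] using abs_max_sub_max_le_abs (N x) (N y) 0
    exact h1.prodMk (LipschitzWith.id.lipschitzOnWith)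
  have := hK.comp hlip (fun x hx => (hV x hx).2.1)
  intro x hx y hy
  rw [(hderiv x hx).fderiv, (hderiv y hy).fderiv]
  exact this hx hy

theorem exists_deriv_lam_pos {E t : ℝ} (hE : 0 ≤ E) (h1 : Real.pi / 2 < t)
    (h2 : t < Real.pi / 2 + 1) : ∃ l, 0 < l ∧ HasDerivAt (lam E) l t := by
  have hpi := Real.pi_gt_three
  set u := t - Real.pi / 2 with hu
  have hu0 : 0 < u := by linarith
  have hinv : HasDerivAt (fun u : ℝ => Real.exp (-u⁻¹)) (Real.exp (-u⁻¹) * u⁻¹ ^ 2) u := by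
    have := (hasDerivAt_inv hu0.ne').neg.exp
    simpa using this
  have hf := ((Real.hasDerivAt_sin u).pow 2).add (hinv.const_mul E)
  have hf2 := HasDerivAt.comp_sub_const (x := t) (a := Real.pi / 2) hf
  have hs : 0 < Real.sin u := Real.sin_pos_of_pos_of_lt_pi hu0 (by linarith)
  have hc : 0 < Real.cos u := Real.cos_pos_of_mem_Ioo ⟨by linarith, by linarith⟩
  refine ⟨_, ?_, hf2.congr_of_eventuallyEq ?_⟩
  · simp only [Nat.cast_ofNat, Nat.add_one_sub_one, pow_one]
    positivity
  · filter_upwards [Ioo_mem_nhds h1 h2] with x hx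
    have e : x = Real.pi / 2 + (x - Real.pi / 2) := by ring
    rw [e, lam_pi_div_two_add (by linarith [hx.1]) (by linarith [hx.2]), expNegInvGlue,
      if_neg (by linarith [hx.1])]
    simp

theorem exists_deriv_lam_ne_zero {E t : ℝ} (hE : 0 ≤ E) (h1 : Real.pi / 2 < |t|)
    (h2 : |t| < Real.pi / 2 + 1) : ∃ l, l ≠ 0 ∧ HasDerivAt (lam E) l t := by
  rcases le_total 0 t with h | h
  · rw [abs_of_nonneg h] at h1 h2
    obtain ⟨l, hl, hd⟩ := exists_deriv_lam_pos hE h1 h2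
    exact ⟨l, hl.ne', hd⟩
  · rw [abs_of_nonpos h] at h1 h2
    obtain ⟨l, hl, hd⟩ := exists_deriv_lam_pos hE h1 h2
    refine ⟨-l, (neg_neg_of_pos hl).ne, ?_⟩
    have := hd.scomp t (hasDerivAt_neg t)
    simp only [smul_eq_mul, neg_mul, one_mul] at this
    refine this.congr_of_eventuallyEq (Eventually.of_forall fun x => ?_)
    simp [lam_neg]

theorem contDiffAt_log_norm_coord {p : Cn 2} (hp : p 0 ≠ 0) :
    ContDiffAt ℝ 2 (fun x : Cn 2 => Real.log ‖x 0‖) p := by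
  have h0 : ContDiffAt ℝ 2 (fun x : Cn 2 => x 0) p := by fun_prop
  exact (h0.norm ℝ hp).log (norm_ne_zero_iff.2 hp)

/-- Off the disc centre the radial derivative in w is positive. At the centre lam = 1, so |t| > π/2,
and the derivative in log|z| equals lam'(t) ≠ 0. -/
theorem fderiv_rho_ne_zero {E : ℝ} (hE : Real.exp 2 ≤ E) {p : Cn 2} (hp : p 0 ≠ 0)
    (hrho : rho E (Real.log ‖p 0‖) (p 1) = 0)
    (hd : DifferentiableAt ℝ (fun x : Cn 2 => rho E (Real.log ‖x 0‖) (x 1)) p) :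
    fderiv ℝ (fun x : Cn 2 => rho E (Real.log ‖x 0‖) (x 1)) p ≠ 0 := by
  intro hzero
  have hE0 : 0 ≤ E := (Real.exp_pos 2).le.trans hE
  have hF := hd.hasFDerivAt
  rw [hzero] at hF
  set t := Real.log ‖p 0‖ with ht
  set e : ℂ := Complex.exp (t * I) with he
  have hcurve : ∀ γ : ℝ → Cn 2, DifferentiableAt ℝ γ 0 → γ 0 = p →
      HasDerivAt (fun τ => rho E (Real.log ‖γ τ 0‖) (γ τ 1)) 0 0 := by
    intro γ hγ hγ0
    rw [← hγ0] at hF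
    exact (hF.comp_hasDerivAt (0 : ℝ) hγ.hasDerivAt).congr_deriv (by simp)
  by_cases hw : p 1 = e
  · have hlam : lam E t = 1 := by
      rw [rho_eq_norm, hw, ← he] at hrho
      simp only [sub_self, norm_zero] at hrho
      linarith
    have h1 : Real.pi / 2 < |t| := by
      by_contra hcon
      rw [lam_eq_zero (not_lt.1 hcon)] at hlam
      norm_num at hlam
    obtain ⟨l, hl, hlam'⟩ := exists_deriv_lam_ne_zero hE0 h1 (abs_lt_of_rho_nonpos hE hrho.le)
    have hdiff : DifferentiableAt ℝ
        (fun τ : ℝ => p + (Real.exp τ - 1) • (!₂[p 0, 0] : Cn 2)) 0 := by fun_prop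
    have := hcurve _ hdiff (by simp)
    have h2 : HasDerivAt (fun τ : ℝ => 1 - 2 * Real.cos τ + lam E (t + τ)) l 0 := by
      have h3 : HasDerivAt (fun τ : ℝ => lam E (t + τ)) l 0 := by
        refine HasDerivAt.comp_const_add (f := lam E) t 0 ?_
        simpa using hlam'
      have h4 := ((Real.hasDerivAt_cos 0).const_mul 2).const_sub 1
      exact (h4.add h3).congr_deriv (by simp)
    refine hl ((this.congr_of_eventuallyEq (Eventually.of_forall fun τ => ?_)).unique h2).symm |>.elim
    have e0 : (p + (Real.exp τ - 1) • (!₂[p 0, 0] : Cn 2)) 0 = p 0 * (Real.exp τ : ℂ) := by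
      simp; ring
    have e1 : (p + (Real.exp τ - 1) • (!₂[p 0, 0] : Cn 2)) 1 = p 1 := by simp
    have hn : Real.log ‖p 0 * (Real.exp τ : ℂ)‖ = t + τ := by
      rw [norm_mul, Complex.norm_real, Real.norm_of_nonneg (Real.exp_pos τ).le,
        Real.log_mul (norm_ne_zero_iff.2 hp) (Real.exp_pos τ).ne', Real.log_exp, ht]
    simp only [e0, e1]
    rw [hn, hw, he, rho, Complex.exp_ofReal_mul_I_re, Complex.exp_ofReal_mul_I_im]
    have : Real.cos τ = Real.cos (t + τ) * Real.cos t + Real.sin (t + τ) * Real.sin t := by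
      rw [← Real.cos_sub]; ring_nf
    rw [this]
    linear_combination -Real.sin_sq_add_cos_sq t
  · have hdiff : DifferentiableAt ℝ (fun τ : ℝ => p + τ • (!₂[0, p 1 - e] : Cn 2)) 0 := by
      fun_prop
    have := hcurve _ hdiff (by simp)
    have h2 : HasDerivAt (fun τ : ℝ => (1 + τ) ^ 2 * ‖p 1 - e‖ ^ 2 - 1 + lam E t)
        (2 * ‖p 1 - e‖ ^ 2) 0 := by
      have h3 := ((hasDerivAt_id (0 : ℝ)).const_add 1).pow 2
      have h4 := ((h3.mul_const (‖p 1 - e‖ ^ 2)).sub_const 1).add_const (lam E t)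
      simpa using h4
    have h5 := (this.congr_of_eventuallyEq (Eventually.of_forall fun τ => ?_)).unique h2
    · have : 0 < ‖p 1 - e‖ := norm_pos_iff.2 (sub_ne_zero.2 hw)
      nlinarith
    · have e0 : (p + τ • (!₂[0, p 1 - e] : Cn 2)) 0 = p 0 := by simp
      have e1 : (p + τ • (!₂[0, p 1 - e] : Cn 2)) 1 = p 1 + (τ : ℂ) * (p 1 - e) := by simp
      simp only [e0, e1]
      rw [← ht, rho_eq_norm, ← he]
      have : p 1 + (τ : ℂ) * (p 1 - e) - e = ((1 + τ : ℝ) : ℂ) * (p 1 - e) := by push_cast; ring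
      rw [this, norm_mul, Complex.norm_real, mul_pow, Real.norm_eq_abs, sq_abs]

theorem hasC11Boundary_wormDomain {E : ℝ} (hE : Real.exp 2 ≤ E) :
    HasC11Boundary (wormDomain E) := by
  refine ⟨isOpen_wormDomain E, (isConnected_wormDomain hE).nonempty, ?_, ?_⟩
  · intro h
    have : (0 : Cn 2) ∈ wormDomain E := by rw [h]; trivial
    exact this.1 rfl
  intro p hp
  have hpc : p ∈ wormSublevel E 0 := by
    rw [← closure_wormDomain hE]; exact frontier_subset_closure hp
  have hpn : p ∉ wormDomain E := by
    rw [(isOpen_wormDomain E).frontier_eq] at hp; exact hp.2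
  have hp0 : p 0 ≠ 0 := hpc.1
  have hrho : rho E (Real.log ‖p 0‖) (p 1) = 0 :=
    le_antisymm hpc.2 (not_lt.1 fun h => hpn ⟨hp0, h⟩)
  have hlog := contDiffAt_log_norm_coord hp0
  have hg : ContDiff ℝ 2 expNegInvGlue := expNegInvGlue.contDiff (n := 2)
  have hre : ContDiffAt ℝ 2 (fun x : Cn 2 => (x 1).re) p :=
    Complex.reCLM.contDiff.contDiffAt.comp p (by fun_prop : ContDiffAt ℝ 2 (fun x : Cn 2 => x 1) p)
  have him : ContDiffAt ℝ 2 (fun x : Cn 2 => (x 1).im) p :=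
    Complex.imCLM.contDiff.contDiffAt.comp p (by fun_prop : ContDiffAt ℝ 2 (fun x : Cn 2 => x 1) p)
  have hS : ContDiffAt ℝ 2 (fun x : Cn 2 => (x 1).re ^ 2 + (x 1).im ^ 2 -
      2 * ((x 1).re * Real.cos (Real.log ‖x 0‖) + (x 1).im * Real.sin (Real.log ‖x 0‖)) +
      E * (expNegInvGlue (Real.log ‖x 0‖ - Real.pi / 2) +
        expNegInvGlue (-Real.log ‖x 0‖ - Real.pi / 2))) p := by
    have g1 := hg.contDiffAt.comp p (hlog.sub (contDiffAt_const (c := Real.pi / 2)))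
    have g2 := hg.contDiffAt.comp p (hlog.neg.sub (contDiffAt_const (c := Real.pi / 2)))
    exact (((hre.pow 2).add (him.pow 2)).sub (contDiffAt_const.mul
      ((hre.mul hlog.cos).add (him.mul hlog.sin)))).add (contDiffAt_const.mul (g1.add g2))
  obtain ⟨V, hVo, hpV, hVd, L, hL⟩ := exists_isC11On_add_max_zero_sq hS hlog.cos.neg
  have heq : (fun x : Cn 2 => ((x 1).re ^ 2 + (x 1).im ^ 2 -
      2 * ((x 1).re * Real.cos (Real.log ‖x 0‖) + (x 1).im * Real.sin (Real.log ‖x 0‖)) +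
      E * (expNegInvGlue (Real.log ‖x 0‖ - Real.pi / 2) +
        expNegInvGlue (-Real.log ‖x 0‖ - Real.pi / 2))) +
      max 0 (-Real.cos (Real.log ‖x 0‖)) ^ 2) =
      fun x : Cn 2 => rho E (Real.log ‖x 0‖) (x 1) := by
    funext x
    simp only [rho, lam]
    ring
  rw [heq] at hVd hL
  have hne := fderiv_rho_ne_zero hE hp0 hrho (hVd.differentiableAt (hVo.mem_nhds hpV))
  have hcont : ContinuousAt (fderiv ℝ fun x : Cn 2 => rho E (Real.log ‖x 0‖) (x 1)) p :=
    hL.continuousOn.continuousAt (hVo.mem_nhds hpV)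
  have hev : ∀ᶠ x in 𝓝 p, x ∈ V ∧ x 0 ≠ 0 ∧
      fderiv ℝ (fun x : Cn 2 => rho E (Real.log ‖x 0‖) (x 1)) x ≠ 0 :=
    (hVo.eventually_mem hpV).and (((isOpen_ne.preimage (continuous_coord (n := 2) 0)).eventually_mem
      hp0).and (hcont.eventually_ne hne))
  obtain ⟨W, hW, hWo, hpW⟩ := _root_.eventually_nhds_iff.1 hev
  refine ⟨W, hWo, hpW, fun x => rho E (Real.log ‖x 0‖) (x 1),
    ⟨hVd.mono fun x hx => (hW x hx).1, L, hL.mono fun x hx => (hW x hx).1⟩,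
    fun x hx => (hW x hx).2.2, ?_⟩
  ext x
  constructor
  · rintro ⟨h1, h2⟩; exact ⟨h2, h1.2⟩
  · rintro ⟨h1, h2⟩; exact ⟨⟨(hW x h1).2.1, h2⟩, h1⟩

/-! ### The continuity principle and failure of s-H-convexity -/

theorem circleAverage_lt_of_le_of_lt {v : ℂ → ℝ} {m : ℝ} (hv : ContinuousOn v (sphere 0 1))
    (hle : ∀ ζ ∈ sphere (0 : ℂ) 1, v ζ ≤ m) (hlt : v 1 < m) : Real.circleAverage v 0 1 < m := by
  have hcm : Continuous fun θ : ℝ => circleMap (0 : ℂ) 1 θ := continuous_circleMap 0 1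
  have hmem : ∀ θ : ℝ, circleMap (0 : ℂ) 1 θ ∈ sphere (0 : ℂ) 1 := fun θ =>
    circleMap_mem_sphere 0 zero_le_one θ
  have hc : Continuous fun θ : ℝ => v (circleMap 0 1 θ) := hv.comp_continuous hcm hmem
  have h := intervalIntegral.integral_lt_integral_of_continuousOn_of_le_of_exists_lt
    Real.two_pi_pos hc.continuousOn (continuousOn_const (c := m))
    (fun θ _ => hle _ (hmem θ)) ⟨0, left_mem_Icc.2 Real.two_pi_pos.le, by simpa [circleMap] using hlt⟩
  rw [Real.circleAverage_def, smul_eq_mul, inv_mul_lt_iff₀ Real.two_pi_pos]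
  simpa using h

/-- Maximum principle on the annuli `{r₁ ≤ |z| ≤ r₂} × {w}`. -/
theorem le_on_annulus {u : Cn 2 → ℝ} {D : Set (Cn 2)} (hu : ContinuousPlurisubharmonicOn u D)
    {r₁ r₂ c : ℝ} {w : ℂ} (h0 : 0 ≤ r₁)
    (hA : ∀ x : Cn 2, r₁ ≤ ‖x 0‖ → ‖x 0‖ ≤ r₂ → x 1 = w → x ∈ D)
    (hb : ∀ x : Cn 2, r₁ ≤ ‖x 0‖ → ‖x 0‖ ≤ r₂ → x 1 = w → (‖x 0‖ = r₁ ∨ ‖x 0‖ = r₂) → u x ≤ c) :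
    ∀ x : Cn 2, r₁ ≤ ‖x 0‖ → ‖x 0‖ ≤ r₂ → x 1 = w → u x ≤ c := by
  intro x hx1 hx2 hx3
  by_contra hcon
  push Not at hcon
  let A : Set (Cn 2) := {x | r₁ ≤ ‖x 0‖ ∧ ‖x 0‖ ≤ r₂ ∧ x 1 = w}
  have hAD : A ⊆ D := fun x hx => hA x hx.1 hx.2.1 hx.2.2
  have hAc : IsCompact A := by
    refine Metric.isCompact_of_isClosed_isBounded ?_ ?_
    · exact (isClosed_le continuous_const (continuous_coord 0).norm).inter
        ((isClosed_le (continuous_coord 0).norm continuous_const).inter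
          (isClosed_eq (continuous_coord 1) continuous_const))
    · refine (Metric.isBounded_closedBall (x := (0 : Cn 2)) (r := r₂ + ‖w‖)).subset ?_
      intro x hx
      rw [mem_closedBall_zero_iff]
      refine (norm_le_add_coord x).trans (add_le_add hx.2.1 ?_)
      rw [hx.2.2]
  have hcont : ContinuousOn u A := hu.1.mono hAD
  obtain ⟨x₀, hx₀, hmax⟩ := hAc.exists_isMaxOn ⟨x, hx1, hx2, hx3⟩ hcont
  set m := u x₀ with hm
  have hcm : c < m := hcon.trans_le (hmax ⟨hx1, hx2, hx3⟩)
  let S := A ∩ u ⁻¹' {m}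
  have hSc : IsCompact S := hAc.of_isClosed_subset
    (hcont.preimage_isClosed_of_isClosed hAc.isClosed isClosed_singleton) inter_subset_left
  -- Take a maximum point of largest |z|. The disc about it in the z-direction reaches larger |z| at
  -- ζ = 1, where u < m, so the circle average falls below m.
  obtain ⟨p, hp, hpmax⟩ := hSc.exists_isMaxOn ⟨x₀, hx₀, rfl⟩
    ((continuous_coord (n := 2) 0).norm.continuousOn)
  have hpm : u p = m := hp.2
  have hpA : p ∈ A := hp.1
  have hlt1 : r₁ < ‖p 0‖ := by
    refine lt_of_le_of_ne hpA.1 fun h => ?_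
    have := hb p hpA.1 hpA.2.1 hpA.2.2 (Or.inl h.symm)
    linarith
  have hlt2 : ‖p 0‖ < r₂ := by
    refine lt_of_le_of_ne hpA.2.1 fun h => ?_
    have := hb p hpA.1 hpA.2.1 hpA.2.2 (Or.inr h)
    linarith
  set R := ‖p 0‖ with hR
  have hRpos : 0 < R := h0.trans_lt hlt1
  set δ := min (R - r₁) (r₂ - R) with hδ
  have hδpos : 0 < δ := lt_min (by linarith) (by linarith)
  have hδ1 : δ ≤ R - r₁ := min_le_left _ _
  have hδ2 : δ ≤ r₂ - R := min_le_right _ _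
  let b : Cn 2 := !₂[(δ / R : ℝ) * p 0, 0]
  have hb0 : ∀ ζ : ℂ, (p + ζ • b) 0 = p 0 + ζ * ((δ / R : ℝ) * p 0) := by
    intro ζ; simp [b]
  have hb1 : ∀ ζ : ℂ, (p + ζ • b) 1 = w := by
    intro ζ; simp [b, hpA.2.2]
  have hnb : ∀ ζ : ℂ, ‖ζ‖ ≤ 1 → ‖ζ * ((δ / R : ℝ) * p 0)‖ ≤ δ := by
    intro ζ hζ
    rw [norm_mul, norm_mul, Complex.norm_real, Real.norm_of_nonneg (by positivity), ← hR,
      div_mul_cancel₀ _ hRpos.ne']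
    nlinarith
  have hdisc : ∀ ζ : ℂ, ‖ζ‖ ≤ 1 → p + ζ • b ∈ A := by
    intro ζ hζ
    have h1 := hnb ζ hζ
    have h2 := norm_add_le (p 0) (ζ * ((δ / R : ℝ) * p 0))
    have h3 := norm_sub_norm_le (p 0) (-(ζ * ((δ / R : ℝ) * p 0)))
    rw [sub_neg_eq_add, norm_neg] at h3
    refine ⟨?_, ?_, hb1 ζ⟩
    · rw [hb0]; linarith
    · rw [hb0]; linarith
  have hsub := hu.2 p b fun ζ hζ => hAD (hdisc ζ hζ)
  have hd : Continuous fun ζ : ℂ => p + ζ • b := by fun_prop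
  have hone : u (p + (1 : ℂ) • b) < m := by
    refine lt_of_le_of_ne (hmax (hdisc 1 (by simp))) fun h => ?_
    have hS : p + (1 : ℂ) • b ∈ S := ⟨hdisc 1 (by simp), h⟩
    have := hpmax hS
    simp only [mem_ofPred_eq] at this
    rw [hb0] at this
    have e : p 0 + 1 * ((δ / R : ℝ) * p 0) = ((1 + δ / R : ℝ) : ℂ) * p 0 := by push_cast; ring
    rw [e, norm_mul, Complex.norm_real, Real.norm_of_nonneg (by positivity), ← hR, add_mul,
      div_mul_cancel₀ _ hRpos.ne'] at this
    linarith
  have := circleAverage_lt_of_le_of_lt (v := fun ζ : ℂ => u (p + ζ • b)) (m := m)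
    (hcont.comp hd.continuousOn fun ζ hζ => hdisc ζ (mem_sphere_zero_iff_norm.1 hζ).le)
    (fun ζ hζ => hmax (hdisc ζ (mem_sphere_zero_iff_norm.1 hζ).le)) hone
  linarith

/-- Continuity principle for a family of annuli whose boundary circles stay in a pseudoconvex
set. -/
theorem annulus_mem_of_isOpenPseudoconvex {D : Set (Cn 2)} (hD : IsOpenPseudoconvex D)
    {R : ℝ → ℝ} {ω : ℝ → ℂ} (hR : Continuous R) (hω : Continuous ω) (hRpos : ∀ v, 0 < R v)
    (hb : ∀ v, ∀ x : Cn 2, |Real.log ‖x 0‖| = R v → x 0 ≠ 0 → x 1 = ω v → x ∈ D)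
    {v₀ v₁ : ℝ} (hbdd : ∀ v, ∃ v' ∈ Icc v₀ v₁, R v = R v' ∧ ω v = ω v')
    (h0 : ∀ x : Cn 2, |Real.log ‖x 0‖| ≤ R v₀ → x 0 ≠ 0 → x 1 = ω v₀ → x ∈ D) (v : ℝ) (x : Cn 2)
    (hx : |Real.log ‖x 0‖| ≤ R v) (hx0 : x 0 ≠ 0) (hx1 : x 1 = ω v) : x ∈ D := by
  obtain ⟨hDo, u, hu, hcpt⟩ := hD
  let Ψ : ℝ × ℝ × ℝ → Cn 2 := fun q =>
    !₂[Complex.exp ((q.2.1 * R q.1 : ℝ) + (q.2.2 : ℂ) * I), ω q.1]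
  have hΨ : Continuous Ψ := by
    refine (PiLp.continuous_toLp 2 _).comp (continuous_pi fun i => ?_)
    fin_cases i
    · simp only [Fin.zero_eta, Matrix.cons_val_zero]; fun_prop
    · simp only [Fin.mk_one, Matrix.cons_val_one, Matrix.cons_val_fin_one]; fun_prop
  have hΨ0 : ∀ q, Ψ q 0 ≠ 0 := fun q => by simp [Ψ]
  have hΨ1 : ∀ q, Ψ q 1 = ω q.1 := fun q => by simp [Ψ]
  have hΨlog : ∀ q, Real.log ‖Ψ q 0‖ = q.2.1 * R q.1 := by
    intro q
    simp [Ψ, Complex.norm_exp]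
  let Q : Set (ℝ × ℝ) := Icc (-1) 1 ×ˢ Icc (-Real.pi) Real.pi
  have hQ : IsCompact Q := isCompact_Icc.prod isCompact_Icc
  have hΨsurj : ∀ v, ∀ x : Cn 2, |Real.log ‖x 0‖| ≤ R v → x 0 ≠ 0 → x 1 = ω v →
      ∃ q ∈ Q, Ψ (v, q) = x ∧ q.1 = Real.log ‖x 0‖ / R v := by
    intro v x hx hx0 hx1
    refine ⟨(Real.log ‖x 0‖ / R v, Complex.arg (x 0)), ⟨?_, (Complex.neg_pi_lt_arg _).le,
      Complex.arg_le_pi _⟩, ?_, rfl⟩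
    · refine abs_le.1 ?_
      rw [abs_div, abs_of_pos (hRpos v)]
      exact (div_le_one (hRpos v)).2 hx
    · ext i
      fin_cases i
      · simp only [Ψ, Fin.zero_eta, Matrix.cons_val_zero]
        rw [div_mul_cancel₀ _ (hRpos v).ne', Complex.exp_add, ← Complex.ofReal_exp,
          Real.exp_log (norm_pos_iff.2 hx0)]
        exact Complex.norm_mul_exp_arg_mul_I (x 0)
      · simp [Ψ, hx1]
  let Γ : Set (Cn 2) := Ψ '' (Icc v₀ v₁ ×ˢ ({-1, 1} : Set ℝ) ×ˢ Icc (-Real.pi) Real.pi)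
  have hΓc : IsCompact Γ := (isCompact_Icc.prod (((Set.finite_singleton (1 : ℝ)).insert
    (-1)).isCompact.prod isCompact_Icc)).image hΨ
  have hΓD : Γ ⊆ D := by
    rintro _ ⟨⟨v, τ, θ⟩, ⟨-, hτ, -⟩, rfl⟩
    refine hb v _ ?_ (hΨ0 _) (hΨ1 _)
    rw [hΨlog, abs_mul, abs_of_pos (hRpos v)]
    have : |τ| = 1 := by
      rcases hτ with h | h
      · simp only at h; rw [h]; simp
      · simp only [mem_singleton_iff] at h; rw [h]; simp
    simp [this]
  obtain ⟨c, hc⟩ := (hΓc.image_of_continuousOn (hu.1.mono hΓD)).bddAbove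
  have hbc : ∀ v, ∀ x : Cn 2, |Real.log ‖x 0‖| = R v → x 0 ≠ 0 → x 1 = ω v → u x ≤ c := by
    intro v x hx hx0 hx1
    obtain ⟨v', hv', e1, e2⟩ := hbdd v
    rw [e1] at hx
    rw [e2] at hx1
    obtain ⟨q, hq, hqx, hq1⟩ := hΨsurj v' x hx.le hx0 hx1
    refine hc ⟨x, ⟨(v', q), ⟨hv', ?_, hq.2⟩, hqx⟩, rfl⟩
    have : |q.1| = 1 := by
      rw [hq1, abs_div, hx, abs_of_pos (hRpos v'), div_self (hRpos v').ne']
    rcases (abs_eq zero_le_one).1 this with h | h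
    · exact Or.inr h
    · exact Or.inl h
  -- O is open by compactness of the annuli. It is closed because the maximum principle keeps its
  -- annuli in the compact sublevel {u ≤ c}, with c a bound for u on all boundary circles.
  let O : Set ℝ := {v | ∀ q ∈ Q, Ψ (v, q) ∈ D}
  have hann : ∀ v ∈ O, ∀ x : Cn 2, |Real.log ‖x 0‖| ≤ R v → x 0 ≠ 0 → x 1 = ω v → x ∈ D := by
    intro v hv x hx hx0 hx1
    obtain ⟨q, hq, hqx, -⟩ := hΨsurj v x hx hx0 hx1
    rw [← hqx]; exact hv q hq
  have hOc : O = ⋂ q ∈ Q, (fun v => Ψ (v, q)) ⁻¹' {x | x ∈ D ∧ u x ≤ c} := by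
    ext v
    simp only [mem_iInter, mem_preimage, mem_ofPred_eq]
    refine ⟨fun hv q hq => ⟨hv q hq, ?_⟩, fun hv q hq => (hv q hq).1⟩
    have habs : ∀ y : Cn 2, Real.exp (-R v) ≤ ‖y 0‖ → ‖y 0‖ ≤ Real.exp (R v) →
        |Real.log ‖y 0‖| ≤ R v ∧ y 0 ≠ 0 := by
      intro y h1 h2
      have hpos : 0 < ‖y 0‖ := (Real.exp_pos _).trans_le h1
      exact ⟨abs_le.2 ⟨(Real.le_log_iff_exp_le hpos).2 h1, (Real.log_le_iff_le_exp hpos).2 h2⟩,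
        norm_pos_iff.1 hpos⟩
    have hpos : 0 < ‖Ψ (v, q) 0‖ := norm_pos_iff.2 (hΨ0 _)
    have hle : |q.1 * R v| ≤ R v := by
      rw [abs_mul, abs_of_pos (hRpos v)]
      have : |q.1| ≤ 1 := abs_le.2 hq.1
      nlinarith [hRpos v]
    refine le_on_annulus hu (r₁ := Real.exp (-R v)) (r₂ := Real.exp (R v)) (w := ω v)
      (Real.exp_pos _).le ?_ ?_ _ ?_ ?_ (hΨ1 _)
    · intro y h1 h2 h3
      exact hann v hv y (habs y h1 h2).1 (habs y h1 h2).2 h3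
    · intro y h1 h2 h3 h4
      refine hbc v y ?_ (habs y h1 h2).2 h3
      rcases h4 with h | h
      · rw [h, Real.log_exp, abs_neg, abs_of_pos (hRpos v)]
      · rw [h, Real.log_exp, abs_of_pos (hRpos v)]
    · rw [← Real.le_log_iff_exp_le hpos, hΨlog]; exact (abs_le.1 hle).1
    · rw [← Real.log_le_iff_le_exp hpos, hΨlog]; exact (abs_le.1 hle).2
  have hOclosed : IsClosed O := by
    rw [hOc]
    exact isClosed_biInter fun q _ => (hcpt c).isClosed.preimage (hΨ.comp (by fun_prop))
  have hOopen : IsOpen O := by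
    rw [isOpen_iff_mem_nhds]
    intro v hv
    have := hQ.eventually_forall_of_forall_eventually (x₀ := v) (P := fun v q => Ψ (v, q) ∈ D)
      (fun q hq => (hΨ.tendsto (v, q)).eventually (hDo.mem_nhds (hv q hq)))
    exact this
  have h0O : v₀ ∈ O := by
    intro q hq
    refine h0 _ ?_ (hΨ0 _) (hΨ1 _)
    rw [hΨlog, abs_mul, abs_of_pos (hRpos v₀)]
    have : |q.1| ≤ 1 := abs_le.2 hq.1
    nlinarith [hRpos v₀]
  have huniv : O = univ := IsClopen.eq_univ ⟨hOclosed, hOopen⟩ ⟨v₀, h0O⟩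
  exact hann v (by rw [huniv]; trivial) x hx hx0 hx1

theorem infDist_lt_of_coord {K : Set (Cn 2)} {x : Cn 2} {w : ℂ} {η : ℝ}
    (hw : (!₂[x 0, w] : Cn 2) ∈ K) (hd : ‖x 1 - w‖ < η) : infDist x K < η := by
  refine (infDist_le_dist_of_mem hw).trans_lt ?_
  rw [dist_eq_norm]
  refine (norm_le_add_coord _).trans_lt ?_
  simpa using hd

/-- The infinite-order flatness of exp(-1/u) beats every power; this is why one domain serves all s.
-/
theorem exists_small_exp_lt_rpow {E C : ℝ} (hE : 0 < E) (hC : 0 < C) (s : ℝ) :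
    ∃ ε : ℝ, 0 < ε ∧ ε ≤ 1 / 32 ∧ E * expNegInvGlue (8 * ε) < C * ε ^ s / 2 := by
  have h := tendsto_rpow_mul_exp_neg_mul_atTop_nhds_zero s (1 / 8) (by norm_num)
  have h1 := h.eventually (gt_mem_nhds (show (0 : ℝ) < C / (2 * E) by positivity))
  obtain ⟨x, hx1, hx2⟩ := (h1.and (eventually_ge_atTop (32 : ℝ))).exists
  have hxpos : 0 < x := by linarith
  refine ⟨x⁻¹, inv_pos.2 hxpos, ?_, ?_⟩
  · rw [inv_le_comm₀ hxpos (by norm_num)]; linarith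
  · have e1 : expNegInvGlue (8 * x⁻¹) = Real.exp (-(1 / 8) * x) := by
      rw [expNegInvGlue, if_neg (by have := inv_pos.2 hxpos; linarith)]
      congr 1
      field_simp
    rw [e1, Real.inv_rpow hxpos.le]
    have hp : 0 < x ^ s := Real.rpow_pos_of_pos hxpos s
    rw [lt_div_iff₀ (by positivity)] at hx1
    rw [lt_div_iff₀ two_pos, ← div_eq_mul_inv, lt_div_iff₀ hp]
    nlinarith

theorem not_isSHConvex_closure_wormDomain {E : ℝ} (hE : Real.exp 2 ≤ E) {s : ℝ} (hs : 1 ≤ s) :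
    ¬ IsSHConvex s (closure (wormDomain E)) := by
  rintro ⟨C, hC0, hC1, hconv⟩
  have hpi := Real.pi_gt_three
  have hE0 : 0 < E := (Real.exp_pos 2).trans_le hE
  obtain ⟨ε, hε0, hε1, hεE⟩ := exists_small_exp_lt_rpow hE0 hC0 s
  obtain ⟨D, hD, hsub, hDε⟩ := hconv ε hε0 (by linarith)
  set η := C * ε ^ s with hη
  have hεs : 0 < ε ^ s := Real.rpow_pos_of_pos hε0 s
  have hη0 : 0 < η := by positivity
  have hη1 : η ≤ 1 := by
    have : ε ^ s ≤ 1 := Real.rpow_le_one hε0.le (by linarith) (by linarith)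
    nlinarith
  set β := η / 2 with hβ
  -- Clamping extends the family over [0, 8ε] to all of ℝ, as the continuity principle requires.
  let cl : ℝ → ℝ := fun v => max 0 (min v (8 * ε))
  have hcl : Continuous cl := by fun_prop
  have hcl0 : ∀ v, 0 ≤ cl v := fun v => le_max_left _ _
  have hcl1 : ∀ v, cl v ≤ 8 * ε := fun v => max_le (by linarith) (min_le_right _ _)
  have hclid : ∀ v ∈ Icc 0 (8 * ε), cl v = v := by
    intro v hv
    simp only [cl]
    rw [min_eq_left hv.2, max_eq_right hv.1]
  have hmemK : ∀ x : Cn 2, ∀ w : ℂ, x 0 ≠ 0 → rho E (Real.log ‖x 0‖) w < 0 → ‖x 1 - w‖ < η →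
      x ∈ D := by
    intro x w h0 h1 h2
    refine hsub (infDist_lt_of_coord (subset_closure (s := wormDomain E) ⟨?_, ?_⟩) h2)
    · simpa using h0
    · simpa using h1
  -- The sin² terms cancel and leave β² - 2β cos v + E exp(-1/v) for v > 0. It is negative since the
  -- exponential term is below β = η/2 ≤ 1/2 and cos v > 3/4.
  have hedge : ∀ v, 0 ≤ v → v ≤ 8 * ε →
      rho E (Real.pi / 2 + v) (-(Real.sin v : ℂ) + β * I) < 0 := by
    intro v hv0 hv1
    have hc : Real.cos (Real.pi / 2 + v) = -Real.sin v := by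
      rw [add_comm, Real.cos_add_pi_div_two]
    have hs' : Real.sin (Real.pi / 2 + v) = Real.cos v := by
      rw [add_comm, Real.sin_add_pi_div_two]
    have hcos : 1 - v ^ 2 / 2 ≤ Real.cos v := Real.one_sub_sq_div_two_le_cos
    have hg : expNegInvGlue v ≤ expNegInvGlue (8 * ε) := expNegInvGlue.monotone hv1
    have hre : (-(Real.sin v : ℂ) + β * I).re = -Real.sin v := by
      simp only [Complex.add_re, Complex.neg_re, Complex.ofReal_re, Complex.re_ofReal_mul,
        Complex.I_re, mul_zero, add_zero]
    have him : (-(Real.sin v : ℂ) + β * I).im = β := by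
      simp only [Complex.add_im, Complex.neg_im, Complex.ofReal_im, Complex.im_ofReal_mul,
        Complex.I_im, mul_one, neg_zero, zero_add]
    rw [rho, lam_pi_div_two_add hv0 (by linarith), hc, hs', hre, him]
    have hcos' : 3 / 4 < Real.cos v := by nlinarith
    have hgE := mul_le_mul_of_nonneg_left hg hE0.le
    nlinarith
  have hend := annulus_mem_of_isOpenPseudoconvex hD (R := fun v => Real.pi / 2 + cl v)
    (ω := fun v => -(Real.sin (cl v) : ℂ)) (by fun_prop)
    ((Complex.continuous_ofReal.comp (Real.continuous_sin.comp hcl)).neg)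
    (fun v => by have := hcl0 v; positivity)
    (fun v x hx hx0 hx1 => by
      have hR0 : 0 ≤ Real.pi / 2 + cl v := by have := hcl0 v; positivity
      have hβη : β < η := by rw [hβ]; linarith
      have hβ0 : 0 ≤ β := by rw [hβ]; linarith
      rcases (abs_eq hR0).1 hx with h | h
      · refine hmemK x (-(Real.sin (cl v) : ℂ) + β * I) hx0 ?_ ?_
        · rw [h]; exact hedge _ (hcl0 v) (hcl1 v)
        · rw [hx1]; simpa [abs_of_nonneg hβ0] using hβη
      · refine hmemK x ((starRingEnd ℂ) (-(Real.sin (cl v) : ℂ) + β * I)) hx0 ?_ ?_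
        · rw [h, rho_conj]; exact hedge _ (hcl0 v) (hcl1 v)
        · rw [hx1, map_add, map_neg, Complex.conj_ofReal]; simpa [abs_of_nonneg hβ0] using hβη)
    (v₀ := 0) (v₁ := 8 * ε)
    (fun v => ⟨cl v, ⟨hcl0 v, hcl1 v⟩, by rw [hclid _ ⟨hcl0 v, hcl1 v⟩],
      by rw [hclid _ ⟨hcl0 v, hcl1 v⟩]⟩)
    (fun x hx hx0 hx1 => by
      have hz : cl 0 = 0 := hclid 0 ⟨le_rfl, by linarith⟩
      rw [hz] at hx hx1
      simp only [add_zero, Real.sin_zero, Complex.ofReal_zero, neg_zero] at hx hx1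
      -- Over |t| ≤ π/2 the point βe^{it} lies inside the unit disc about e^{it}, at distance β < η
      -- from w = 0.
      refine hmemK x (β * Complex.exp (Real.log ‖x 0‖ * I)) hx0 ?_ ?_
      · have e : (β : ℂ) * Complex.exp (Real.log ‖x 0‖ * I) - Complex.exp (Real.log ‖x 0‖ * I) =
            ((β - 1 : ℝ) : ℂ) * Complex.exp (Real.log ‖x 0‖ * I) := by push_cast; ring
        rw [rho_eq_norm, lam_eq_zero hx, e, norm_mul, Complex.norm_exp_ofReal_mul_I,
          Complex.norm_real, mul_one, Real.norm_eq_abs, sq_abs]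
        nlinarith
      · rw [hx1, zero_sub, norm_neg, norm_mul, Complex.norm_exp_ofReal_mul_I, Complex.norm_real,
          mul_one, Real.norm_of_nonneg (by linarith)]
        linarith)
    (8 * ε) !₂[1, -(Real.sin (8 * ε) : ℂ)]
    (by
      have := hcl0 (8 * ε)
      simp
      positivity)
    (by simp) (by simp [hclid (8 * ε) ⟨by linarith, le_rfl⟩])
  have hlt := hDε hend
  simp only [mem_ofPred_eq] at hlt
  obtain ⟨y, hy, hyd⟩ := (infDist_lt_iff ((isConnected_wormDomain hE).nonempty.closure)).1 hlt
  rw [closure_wormDomain hE] at hy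
  rw [dist_comm, dist_eq_norm] at hyd
  have h0 := (norm_coord_le _ 0).trans_lt hyd
  have h1 := (norm_coord_le _ 1).trans_lt hyd
  simp only [PiLp.sub_apply, Matrix.cons_val_zero, Matrix.cons_val_one,
    Matrix.cons_val_fin_one, sub_neg_eq_add] at h0 h1
  set t := Real.log ‖y 0‖ with ht
  have hnpos : 0 < ‖y 0‖ := norm_pos_iff.2 hy.1
  have hn1 : |‖y 0‖ - 1| < 1 / 32 := by
    have := abs_norm_sub_norm_le (y 0) 1
    rw [norm_one] at this
    linarith
  obtain ⟨hn1, hn2⟩ := abs_lt.1 hn1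
  have ht1 : t ≤ 1 := by
    have := Real.log_le_sub_one_of_pos hnpos
    linarith
  have ht2 : -1 ≤ t := by
    have := Real.one_sub_inv_le_log_of_pos hnpos
    have h2 : ‖y 0‖⁻¹ ≤ 2 := by
      rw [inv_le_comm₀ hnpos two_pos]; linarith
    linarith
  have hcos : 1 / 2 ≤ Real.cos t := by
    have := Real.one_sub_sq_div_two_le_cos (x := t)
    nlinarith
  -- Points of K satisfy Re(w e^{-it}) ≥ 0. With |d| < ε and cos t ≥ 1/2, however, w = d - sin 8ε
  -- gives at most ε - 2ε < 0; hence the factor 8.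
  have hsin : 4 * ε < Real.sin (8 * ε) := by
    have := Real.sin_gt_sub_cube (x := 8 * ε) (by linarith)
    nlinarith [mul_pos hε0 hε0]
  have hr := hy.2
  have hl := lam_nonneg hE0.le t
  unfold rho at hr
  set d := y 1 + (Real.sin (8 * ε) : ℂ) with hd
  have hre : (y 1).re = d.re - Real.sin (8 * ε) := by
    rw [hd, Complex.add_re, Complex.ofReal_re]; ring
  have him : (y 1).im = d.im := by rw [hd, Complex.add_im, Complex.ofReal_im, add_zero]
  have hdn := re_mul_cos_add_le_norm t d
  have hpos : 0 ≤ (y 1).re * Real.cos t + (y 1).im * Real.sin t := by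
    nlinarith [sq_nonneg (y 1).re, sq_nonneg (y 1).im]
  rw [hre, him] at hpos
  nlinarith

/-! ### Tools for building exhaustion functions -/

theorem HasHolSupport.max {E : Type*} [NormedAddCommGroup E] [NormedSpace ℂ E] {u v : E → ℝ}
    {p : E} (hu : HasHolSupport u p) (hv : HasHolSupport v p) :
    HasHolSupport (fun x => max (u x) (v x)) p := by
  rcases le_total (u p) (v p) with h | h
  · exact hv.of_le (Eventually.of_forall fun x => le_max_right _ _) (max_eq_right h).symm
  · exact hu.of_le (Eventually.of_forall fun x => le_max_left _ _) (max_eq_left h).symm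

/-- Composition with a real function that has supporting lines of nonnegative slope. -/
theorem HasHolSupport.of_tangent {E : Type*} [NormedAddCommGroup E] [NormedSpace ℂ E]
    {u v : E → ℝ} {p : E} (hu : HasHolSupport u p) {s : ℝ} (hs : 0 ≤ s)
    (h : ∀ᶠ x in 𝓝 p, v p + s * (u x - u p) ≤ v x) : HasHolSupport v p := by
  obtain ⟨F, hF, hFp, hFle⟩ := hu
  refine ⟨fun x => (v p : ℂ) + s * (F x - (u p : ℂ)), ?_, ?_, ?_⟩
  · filter_upwards [hF] with x hx
    fun_prop
  · simp [hFp]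
  · filter_upwards [hFle, h] with x h1 h2
    have : ((v p : ℂ) + s * (F x - (u p : ℂ))).re = v p + s * ((F x).re - u p) := by simp
    rw [this]
    nlinarith

/-- If `f` is holomorphic with positive real part, `-log (re f)` is supported from below by real
parts of holomorphic functions. -/
theorem hasHolSupport_neg_log_re {E : Type*} [NormedAddCommGroup E] [NormedSpace ℂ E] {v : E → ℝ}
    {f : E → ℂ} {p : E} (hf : ∀ᶠ x in 𝓝 p, DifferentiableAt ℂ f x)
    (hv : ∀ᶠ x in 𝓝 p, (f x).re = v x) (hpos : 0 < v p) :
    HasHolSupport (fun x => -Real.log (v x)) p := by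
  have hfp := hv.self_of_nhds
  have hcont : ContinuousAt (fun x => (f x).re) p :=
    Complex.continuous_re.continuousAt.comp hf.self_of_nhds.continuousAt
  have h1 : HasHolSupport (fun x => -v x) p := by
    refine ⟨fun x => -f x, ?_, ?_, ?_⟩
    · filter_upwards [hf] with x hx using hx.neg
    · simp [hfp]
    · filter_upwards [hv] with x hx
      simp [hx]
  refine h1.of_tangent (s := (v p)⁻¹) (inv_nonneg.2 hpos.le) ?_
  filter_upwards [hv, hcont.eventually (lt_mem_nhds (hfp.symm ▸ hpos))] with x hx hx2
  rw [hx] at hx2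
  have h2 := Real.log_le_sub_one_of_pos (div_pos hx2 hpos)
  rw [Real.log_div hx2.ne' hpos.ne'] at h2
  have h3 : (v p)⁻¹ * (-v x - -v p) = 1 - v x / v p := by field_simp; ring
  rw [h3]
  linarith

/-- A convex increasing function dominating a given sequence of bounds. -/
theorem exists_convex_dominating (K : ℕ → ℝ) :
    ∃ χ : ℝ → ℝ, Continuous χ ∧ (∀ x₀, ∃ s, 0 ≤ s ∧ ∀ x, χ x₀ + s * (x - x₀) ≤ χ x) ∧
      (∀ x, x ≤ χ x) ∧
      ∀ n : ℕ, ∀ x : ℝ, x ≤ n + 1 → (n : ℝ) ≤ x ∨ n = 0 → K (n + 1) < χ x := by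
  -- The hinge at n has risen by at least a n once x ≥ n + 1, where the bound to beat is K (n + 2);
  -- hence the shift by two.
  let a : ℕ → ℝ := fun n => |K (n + 2)| + 1
  have ha : ∀ n, 1 ≤ a n := fun n => by simp only [a]; linarith [abs_nonneg (K (n + 2))]
  have ha0 : ∀ n, 0 ≤ a n := fun n => zero_le_one.trans (ha n)
  let P : ℕ → ℝ → ℝ := fun N x => |K 1| + 1 + ∑ n ∈ Finset.range N, a n * max 0 (x - n)
  let χ : ℝ → ℝ := fun x => P (⌈x⌉₊) x
  have hP : ∀ (N : ℕ) (x : ℝ), x ≤ N → χ x = P N x := by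
    intro N x hx
    simp only [χ, P]
    congr 1
    refine Finset.sum_subset (Finset.range_mono (Nat.ceil_le.2 hx)) fun n _ hn => ?_
    have : x ≤ n := Nat.ceil_le.1 (by simpa using hn)
    rw [max_eq_left (by linarith), mul_zero]
  have hPc : ∀ N, Continuous (P N) := fun N => by simp only [P]; fun_prop
  refine ⟨χ, ?_, ?_, ?_, ?_⟩
  · rw [continuous_iff_continuousAt]
    intro x
    obtain ⟨N, hN⟩ := exists_nat_gt x
    refine (hPc N).continuousAt.congr ?_
    filter_upwards [isOpen_Iio.mem_nhds hN] with y hy using (hP N y (le_of_lt hy)).symm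
  · intro x₀
    refine ⟨∑ n ∈ Finset.range ⌈x₀⌉₊, a n * (if (n : ℝ) ≤ x₀ then 1 else 0),
      Finset.sum_nonneg fun n _ => mul_nonneg (ha0 n) (by split_ifs <;> norm_num), fun x => ?_⟩
    obtain ⟨N, hN⟩ := exists_nat_ge (max x x₀)
    have h1 : x ≤ N := (le_max_left _ _).trans hN
    have h2 : x₀ ≤ N := (le_max_right _ _).trans hN
    have h3 : χ x₀ + (∑ n ∈ Finset.range ⌈x₀⌉₊, a n * (if (n : ℝ) ≤ x₀ then 1 else 0)) * (x - x₀) =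
        |K 1| + 1 + ∑ n ∈ Finset.range ⌈x₀⌉₊, a n * (max 0 (x₀ - n) +
          (if (n : ℝ) ≤ x₀ then 1 else 0) * (x - x₀)) := by
      simp only [χ, P]
      rw [Finset.sum_mul, add_assoc, ← Finset.sum_add_distrib]
      congr 1
      exact Finset.sum_congr rfl fun n _ => by ring
    rw [h3, hP N x h1]
    simp only [P]
    gcongr 1
    refine (Finset.sum_le_sum (g := fun n => a n * max 0 (x - n)) fun n _ => ?_).trans
      (Finset.sum_le_sum_of_subset_of_nonneg (Finset.range_mono (Nat.ceil_le.2 h2)) fun n _ _ =>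
        mul_nonneg (ha0 n) (le_max_left _ _))
    refine mul_le_mul_of_nonneg_left ?_ (ha0 n)
    split_ifs with h
    · rw [max_eq_right (by linarith)]
      refine le_trans (le_of_eq ?_) (le_max_right _ _)
      ring
    · rw [max_eq_left (by linarith)]
      simp
  · intro x
    obtain ⟨N, hN⟩ := exists_nat_ge x
    rw [hP (N + 1) x (by push_cast; linarith)]
    simp only [P]
    have h1 : a 0 * max 0 (x - (0 : ℕ)) ≤ ∑ n ∈ Finset.range (N + 1), a n * max 0 (x - n) :=
      Finset.single_le_sum (f := fun n : ℕ => a n * max 0 (x - n))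
        (fun n _ => mul_nonneg (ha0 n) (le_max_left _ _)) (by simp)
    have h2 : x ≤ max 0 (x - (0 : ℕ)) := by simp
    have h3 := ha 0
    nlinarith [abs_nonneg (K 1), le_max_left 0 (x - ((0 : ℕ) : ℝ))]
  · intro n x hx hn
    rw [hP (n + 1) x (by push_cast; exact hx)]
    simp only [P]
    rcases n with _ | n
    · have : 0 ≤ ∑ n ∈ Finset.range (0 + 1), a n * max 0 (x - n) :=
        Finset.sum_nonneg fun n _ => mul_nonneg (ha0 n) (le_max_left _ _)
      have h2 := le_abs_self (K 1)
      simp only [zero_add] at this ⊢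
      linarith
    · have hn' : ((n : ℝ) + 1) ≤ x := by
        rcases hn with h | h
        · exact_mod_cast h
        · omega
      have h1 : a n * max 0 (x - n) ≤ ∑ n ∈ Finset.range (n + 1 + 1), a n * max 0 (x - n) :=
        Finset.single_le_sum (f := fun n : ℕ => a n * max 0 (x - n))
          (fun n _ => mul_nonneg (ha0 n) (le_max_left _ _)) (by simp)
      have h2 : 1 ≤ max 0 (x - n) := le_max_of_le_right (by linarith)
      have h3 : a n ≤ a n * max 0 (x - n) := le_mul_of_one_le_right (ha0 n) h2
      have h4 := le_abs_self (K (n + 1 + 1))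
      simp only [a] at h3 h1 ⊢
      linarith [abs_nonneg (K 1)]

/-- With ζ a nearest point of the complement, -log|x - ζ| is a harmonic minorant with equality at w.
-/
theorem hasHolSupport_neg_log_infDist {B : Set ℂ} (hB : IsOpen B) (hne : Bᶜ.Nonempty) {w : ℂ}
    (hw : w ∈ B) : HasHolSupport (fun w => -Real.log (infDist w Bᶜ)) w := by
  obtain ⟨ζ, hζ, hd⟩ := hB.isClosed_compl.exists_infDist_eq_dist hne w
  have hwζ : w - ζ ≠ 0 := sub_ne_zero.2 fun h => hζ (h ▸ hw)
  obtain ⟨L, hL⟩ := exists_local_log hwζ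
  have hL' := ((continuous_sub_right ζ).tendsto w).eventually hL
  have hpos : ∀ᶠ x in 𝓝 w, 0 < infDist x Bᶜ := by
    filter_upwards [hB.mem_nhds hw] with x hx
    exact (hB.isClosed_compl.notMem_iff_infDist_pos hne).1 fun h => h hx
  refine ⟨fun x => -L (x - ζ), ?_, ?_, ?_⟩
  · filter_upwards [hL'] with x hx
    have h1 : DifferentiableAt ℂ (fun x : ℂ => x - ζ) x := by fun_prop
    exact (hx.1.comp x h1).neg
  · have := hL'.self_of_nhds.2
    simp only [Complex.neg_re, this, hd, dist_eq_norm]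
  · filter_upwards [hL', hpos] with x hx hx2
    simp only [Complex.neg_re, hx.2, neg_le_neg_iff, ← dist_eq_norm]
    exact Real.log_le_log hx2 (infDist_le_dist_of_mem hζ)

/-- On a bounded planar open set there is a continuous subharmonic exhaustion function dominating
a given function that is continuous on a relatively closed subset. -/
theorem exists_exhaustion_dominating {B F : Set ℂ} (hB : IsOpen B) (hBb : Bornology.IsBounded B)
    (hFB : F ⊆ B) (hF : closure F ∩ B ⊆ F) {k : ℂ → ℝ} (hk : ContinuousOn k F) :
    ∃ M : ℂ → ℝ, ContinuousOn M B ∧ (∀ w ∈ B, HasHolSupport M w) ∧ (∀ w ∈ F, k w < M w) ∧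
      ∀ c, IsCompact {w | w ∈ B ∧ M w ≤ c} := by
  have hne : Bᶜ.Nonempty := by
    rw [nonempty_compl]
    intro h
    rw [h] at hBb
    exact NormedSpace.unbounded_univ ℂ ℂ hBb
  have hcl : IsClosed Bᶜ := hB.isClosed_compl
  have hpos : ∀ w ∈ B, 0 < infDist w Bᶜ := fun w hw =>
    (hcl.notMem_iff_infDist_pos hne).1 fun h => h hw
  have hposB : ∀ w, 0 < infDist w Bᶜ → w ∈ B := fun w hw => by
    by_contra h
    exact hw.ne' (infDist_zero_of_mem h)
  let l : ℂ → ℝ := fun w => -Real.log (infDist w Bᶜ)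
  have hl : ContinuousOn l B := fun w hw =>
    (((continuous_infDist_pt Bᶜ).continuousAt).log (hpos w hw).ne').neg.continuousWithinAt
  have hiff : ∀ w c, (w ∈ B ∧ l w ≤ c) ↔ Real.exp (-c) ≤ infDist w Bᶜ := by
    intro w c
    constructor
    · rintro ⟨h1, h2⟩
      rw [← Real.le_log_iff_exp_le (hpos w h1)]
      exact neg_le.1 h2
    · intro h
      have h1 := (Real.exp_pos _).trans_le h
      refine ⟨hposB w h1, neg_le.1 ?_⟩
      rwa [Real.le_log_iff_exp_le h1]
  have hcpt : ∀ c, IsCompact {w | w ∈ B ∧ l w ≤ c} := by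
    intro c
    refine Metric.isCompact_of_isClosed_isBounded ?_ (hBb.subset fun w hw => hw.1)
    have : {w | w ∈ B ∧ l w ≤ c} = {w | Real.exp (-c) ≤ infDist w Bᶜ} := by
      ext w; exact hiff w c
    rw [this]
    exact isClosed_le continuous_const (continuous_infDist_pt _)
  have hK : ∀ n : ℕ, ∃ C, ∀ w ∈ F, l w ≤ n → k w ≤ C := by
    intro n
    have hc : IsCompact (F ∩ {w | w ∈ B ∧ l w ≤ n}) := by
      refine (hcpt n).of_isClosed_subset (isClosed_of_closure_subset fun w hw => ?_)
        inter_subset_right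
      have h1 : w ∈ {w | w ∈ B ∧ l w ≤ n} :=
        closure_minimal inter_subset_right (hcpt n).isClosed hw
      exact ⟨hF ⟨closure_mono inter_subset_left hw, h1.1⟩, h1⟩
    obtain ⟨C, hC⟩ := (hc.image_of_continuousOn (hk.mono inter_subset_left)).bddAbove
    exact ⟨C, fun w hw hlw => hC ⟨w, ⟨hw, hFB hw, hlw⟩, rfl⟩⟩
  choose K hK using hK
  obtain ⟨χ, hχ, htan, hb, hdom⟩ := exists_convex_dominating K
  have hM : ContinuousOn (χ ∘ l) B := hχ.comp_continuousOn hl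
  refine ⟨χ ∘ l, hM, fun w hw => ?_, fun w hw => ?_, fun c => ?_⟩
  · obtain ⟨s, hs, hst⟩ := htan (l w)
    exact (hasHolSupport_neg_log_infDist hB hne hw).of_tangent hs
      (Eventually.of_forall fun x => hst (l x))
  · have h1 : l w < ⌊l w⌋₊ + 1 := Nat.lt_floor_add_one (l w)
    refine (hK (⌊l w⌋₊ + 1) w hw (by push_cast; exact h1.le)).trans_lt (hdom _ _ h1.le ?_)
    rcases le_total 0 (l w) with h | h
    · exact Or.inl (Nat.floor_le h)
    · exact Or.inr (Nat.floor_of_nonpos h)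
  · have hsub : {w | w ∈ B ∧ (χ ∘ l) w ≤ c} =
        {w | w ∈ B ∧ l w ≤ c} ∩ (χ ∘ l) ⁻¹' Iic c := by
      ext w
      constructor
      · rintro ⟨h1, h2⟩
        have h3 := hb (l w)
        simp only [Function.comp] at h2
        exact ⟨⟨h1, h3.trans h2⟩, h2⟩
      · rintro ⟨⟨h1, -⟩, h2⟩
        exact ⟨h1, h2⟩
    rw [hsub]
    refine (hcpt c).of_isClosed_subset ?_ inter_subset_left
    exact (hM.mono fun w hw => hw.1).preimage_isClosed_of_isClosed (hcpt _).isClosed isClosed_Iic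

/-- Pseudoconvexity is invariant under linear changes of coordinates. -/
theorem IsOpenPseudoconvex.preimage {n : ℕ} {D : Set (Cn n)} (hD : IsOpenPseudoconvex D)
    (e : Cn n ≃L[ℂ] Cn n) : IsOpenPseudoconvex (e ⁻¹' D) := by
  obtain ⟨hDo, u, ⟨huc, hus⟩, hcpt⟩ := hD
  refine ⟨hDo.preimage e.continuous, u ∘ e,
    ⟨huc.comp e.continuous.continuousOn (mapsTo_preimage _ _), fun a b hab => ?_⟩, fun c => ?_⟩
  · have := hus (e a) (e b) fun ζ hζ => by
      have := hab ζ hζ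
      simpa only [mem_preimage, map_add, map_smul] using this
    simpa only [Function.comp, map_add, map_smul] using this
  · exact e.toHomeomorph.isCompact_preimage.2 (hcpt c)

/-! ### The lengthened worm and its pseudoconvexity -/

/-- The set of all `w` over which the worm has a nonempty fibre. -/
def wormShadow (E : ℝ) : Set ℂ := {w | ∃ t, rho E t w < 0}

theorem isOpen_wormShadow (E : ℝ) : IsOpen (wormShadow E) := by
  rw [isOpen_iff_mem_nhds]
  rintro w ⟨t, ht⟩
  have hc : Continuous fun w => rho E t w :=
    (continuous_rho E).comp (continuous_const.prodMk continuous_id)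
  filter_upwards [hc.continuousAt.eventually_lt_const ht] with y hy using ⟨t, hy⟩

theorem norm_lt_two_of_mem_wormShadow {E : ℝ} (hE : 0 ≤ E) {w : ℂ} (hw : w ∈ wormShadow E) :
    ‖w‖ < 2 :=
  let ⟨_, ht⟩ := hw
  norm_lt_two_of_rho_neg hE ht

theorem mem_slitPlane_of_mem_wormShadow {E : ℝ} (hE : 0 ≤ E) {w : ℂ} (hw : w ∈ wormShadow E) :
    w ∈ slitPlane :=
  let ⟨_, ht⟩ := hw
  mem_slitPlane_of_rho_neg hE ht

/-- The fibres of the worm over the `w`-plane have a continuous selection. -/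
theorem exists_continuousOn_rho_neg {E : ℝ} (hE : Real.exp 2 ≤ E) :
    ∃ c : ℂ → ℝ, ContinuousOn c (wormShadow E) ∧ ∀ w ∈ wormShadow E, rho E (c w) w < 0 := by
  obtain ⟨g, hg⟩ := exists_continuous_forall_mem_convex_of_local_const
    (X := wormShadow E) (E := ℝ) (t := fun w => {t | rho E t w < 0})
    (fun w => (ordConnected_rho_neg hE w).convex) (by
      rintro ⟨w, t, ht⟩
      refine ⟨t, ?_⟩
      have hc : Continuous fun w : wormShadow E => rho E t w :=
        (continuous_rho E).comp (continuous_const.prodMk continuous_subtype_val)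
      have hlt : rho E t (⟨w, t, ht⟩ : wormShadow E) < 0 := ht
      exact (hc.tendsto _).eventually_lt_const hlt)
  classical
  refine ⟨fun w => if h : w ∈ wormShadow E then g ⟨w, h⟩ else 0, ?_, fun w hw => ?_⟩
  · rw [continuousOn_iff_continuous_domRestrict]
    convert g.continuous using 1
    ext w
    simp
  · simpa [hw] using hg ⟨w, hw⟩

/-- The time `log ‖x 0‖`, moved by `κ * log (4 / ‖x 1‖)` towards `c (x 1)` in the direction `-σ`,
but not beyond. -/
noncomputable def retractedTime (c : ℂ → ℝ) (κ σ : ℝ) (x : Cn 2) : ℝ :=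
  σ * max (σ * Real.log ‖x 0‖ - κ * Real.log (4 / ‖x 1‖)) (σ * c (x 1))

/-- The worm with every fibre over the `w`-plane lengthened by `κ * log (4 / ‖w‖)` at both ends and
then truncated by `|log ‖z‖| < b w`; over `0` there is only the truncation. -/
def lengthenedWorm (E : ℝ) (c : ℂ → ℝ) (κ δ : ℝ) (b : ℂ → ℂ) : Set (Cn 2) :=
  {x | x 0 ≠ 0 ∧ x 1 ∈ wormShadow E ∪ ball 0 δ ∧ |Real.log ‖x 0‖| < (b (x 1)).re ∧
    (x 1 ∈ wormShadow E → ∀ σ : ℝ, |σ| = 1 → rho E (retractedTime c κ σ x) (x 1) < 0)}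

theorem retractedTime_of_le {c : ℂ → ℝ} {κ σ : ℝ} {x : Cn 2} (hσ : |σ| = 1)
    (h : σ * Real.log ‖x 0‖ - κ * Real.log (4 / ‖x 1‖) ≤ σ * c (x 1)) :
    retractedTime c κ σ x = c (x 1) := by
  have hσ2 : σ * σ = 1 := by rw [← abs_mul_abs_self, hσ, one_mul]
  rw [retractedTime, max_eq_right h, ← mul_assoc, hσ2, one_mul]

theorem retractedTime_of_lt {c : ℂ → ℝ} {κ σ : ℝ} {x : Cn 2} (hσ : |σ| = 1)
    (h : σ * c (x 1) < σ * Real.log ‖x 0‖ - κ * Real.log (4 / ‖x 1‖)) :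
    retractedTime c κ σ x = Real.log ‖x 0‖ - σ * (κ * Real.log (4 / ‖x 1‖)) := by
  have hσ2 : σ * σ = 1 := by rw [← abs_mul_abs_self, hσ, one_mul]
  rw [retractedTime, max_eq_left h.le, mul_sub, ← mul_assoc, hσ2, one_mul]

theorem ContinuousOn.continuousAt_comp_coord {α : Type*} [TopologicalSpace α] {f : ℂ → α}
    {s : Set ℂ} (hf : ContinuousOn f s) (hs : IsOpen s) {x : Cn 2} (hx : x 1 ∈ s) :
    ContinuousAt (fun x : Cn 2 => f (x 1)) x :=
  ((hf (x 1) hx).continuousAt (hs.mem_nhds hx)).comp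
    (f := fun x : Cn 2 => x 1) (continuous_coord 1).continuousAt

theorem continuousAt_shifted_log {κ σ : ℝ} {x : Cn 2} (h0 : x 0 ≠ 0) (h1 : x 1 ≠ 0) :
    ContinuousAt (fun x : Cn 2 => σ * Real.log ‖x 0‖ - κ * Real.log (4 / ‖x 1‖)) x :=
  ((continuousAt_log_norm_coord h0).const_mul σ).sub
    (((continuousAt_const.div (continuous_coord 1).norm.continuousAt (norm_ne_zero_iff.2 h1)).log
      (div_ne_zero four_ne_zero (norm_ne_zero_iff.2 h1))).const_mul κ)

theorem continuousAt_retractedTime {E κ σ : ℝ} {c : ℂ → ℝ} {x : Cn 2} (hE : 0 ≤ E)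
    (hc : ContinuousOn c (wormShadow E)) (h0 : x 0 ≠ 0) (h1 : x 1 ∈ wormShadow E) :
    ContinuousAt (retractedTime c κ σ) x :=
  ((continuousAt_shifted_log h0
    (slitPlane_ne_zero (mem_slitPlane_of_mem_wormShadow hE h1))).max
      ((hc.continuousAt_comp_coord (isOpen_wormShadow E) h1).const_mul σ)).const_mul σ

theorem continuousAt_rho_retractedTime {E κ σ : ℝ} {c : ℂ → ℝ} {x : Cn 2} (hE : 0 ≤ E)
    (hc : ContinuousOn c (wormShadow E)) (h0 : x 0 ≠ 0) (h1 : x 1 ∈ wormShadow E) :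
    ContinuousAt (fun x => rho E (retractedTime c κ σ x) (x 1)) x :=
  (continuous_rho E).continuousAt.comp (f := fun x : Cn 2 => (retractedTime c κ σ x, x 1))
    ((continuousAt_retractedTime hE hc h0 h1).prodMk (continuous_coord 1).continuousAt)

theorem isOpen_ne_zero_coord : IsOpen {x : Cn 2 | x 0 ≠ 0} :=
  isOpen_ne.preimage (continuous_coord (n := 2) 0)

theorem isOpen_setOf_coord_mem {s : Set ℂ} (hs : IsOpen s) : IsOpen {x : Cn 2 | x 1 ∈ s} :=
  hs.preimage (continuous_coord (n := 2) 1)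

/-- The shifted worm function is supported from below by real parts of holomorphic functions. -/
theorem hasHolSupport_neg_log_rho_shift {E κ σ : ℝ} (hE : Real.exp 2 ≤ E) {p : Cn 2}
    (h0 : p 0 ≠ 0) (h1 : p 1 ≠ 0)
    (h : rho E (Real.log ‖p 0‖ - σ * (κ * Real.log (4 / ‖p 1‖))) (p 1) < 0) :
    HasHolSupport (fun x : Cn 2 =>
      -Real.log (-rho E (Real.log ‖x 0‖ - σ * (κ * Real.log (4 / ‖x 1‖))) (x 1))) p := by
  obtain ⟨L, hL⟩ := exists_local_log h0
  obtain ⟨N, hN⟩ := exists_local_log h1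
  have hL' := (continuous_coord (n := 2) 0).continuousAt.tendsto.eventually (l₁ := 𝓝 p) hL
  have hN' := (continuous_coord (n := 2) 1).continuousAt.tendsto.eventually (l₁ := 𝓝 p) hN
  let f : Cn 2 → ℂ × ℂ := fun x =>
    (L (x 0) - ((σ * κ : ℝ) : ℂ) * (((Real.log 4 : ℝ) : ℂ) - N (x 1)), x 1)
  have hre : ∀ᶠ x : Cn 2 in 𝓝 p,
      (f x).1.re = Real.log ‖x 0‖ - σ * (κ * Real.log (4 / ‖x 1‖)) := by
    filter_upwards [hL', hN', (isOpen_setOf_coord_mem isOpen_ne).mem_nhds h1] with x hx hy hx1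
    simp only [f, sub_re, re_ofReal_mul, ofReal_re, hx.2, hy.2]
    rw [Real.log_div four_ne_zero (norm_ne_zero_iff.2 hx1)]
    ring
  have := (hasHolSupport_neg_log_rho hE (q₀ := f p)
    (by rw [hre.self_of_nhds]; exact h)).comp (f := f) (p := p) (by
      filter_upwards [hL', hN'] with y hy hz
      have h1 : DifferentiableAt ℂ (fun y : Cn 2 => y 0) y := by fun_prop
      have h2 : DifferentiableAt ℂ (fun y : Cn 2 => y 1) y := by fun_prop
      have h3 := hy.1.comp y h1
      have h4 := hz.1.comp y h2
      exact (h3.sub (((differentiableAt_const _).sub h4).const_mul _)).prodMk h2)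
  refine this.congr ?_
  filter_upwards [hre] with x hx
  rw [Function.comp, hx]

/-- Since 35 exceeds 32 + π/2 + 1/2, for ‖w‖ ≤ r the lengthening swallows the whole truncated fibre:
the retracted time is c(w), and only the truncation constrains. -/
theorem shifted_log_le_of_norm_le {E κ δ r σ : ℝ} {c : ℂ → ℝ} {b : ℂ → ℂ} (hE : Real.exp 2 ≤ E)
    (hcneg : ∀ w ∈ wormShadow E, rho E (c w) w < 0)
    (hb : ∀ w ∈ wormShadow E ∪ ball 0 δ, (b w).re ≤ 32)
    (hκ : ∀ w ∈ wormShadow E, ‖w‖ ≤ r → 35 ≤ κ * Real.log (4 / ‖w‖))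
    (hσ : |σ| = 1) {x : Cn 2} (hx : x 1 ∈ wormShadow E) (hr : ‖x 1‖ ≤ r)
    (h2 : |Real.log ‖x 0‖| < (b (x 1)).re) :
    σ * Real.log ‖x 0‖ - κ * Real.log (4 / ‖x 1‖) ≤ σ * c (x 1) := by
  have h4 := hκ _ hx hr
  have h5 := hb _ (Or.inl hx)
  have h6 : |σ * Real.log ‖x 0‖| < 32 := by
    rw [abs_mul, hσ, one_mul]; exact h2.trans_le h5
  have h7 : |σ * c (x 1)| < Real.pi / 2 + 1 / 2 := by
    rw [abs_mul, hσ, one_mul]; exact abs_lt_of_rho_neg hE (hcneg _ hx)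
  linarith [(abs_lt.1 h6).2, (abs_lt.1 h7).1, Real.pi_lt_d2]

/-- `max` of the exhaustion `M` of the base with `-log` of the retracted worm function, the latter
being taken into account only for `r ≤ ‖w‖`. -/
noncomputable def retractedExhaustion (E : ℝ) (c : ℂ → ℝ) (κ r : ℝ) (M : ℂ → ℝ) (σ : ℝ)
    (x : Cn 2) : ℝ :=
  max (M (x 1)) (if r ≤ ‖x 1‖ then -Real.log (-rho E (retractedTime c κ σ x) (x 1)) else M (x 1))

/-- Where the retracted time equals c(w), M dominates strictly, so the function is locally M and the
kink of the retraction is invisible. Elsewhere ‖w‖ > r, and it is the maximum of M and a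
pluriharmonically shifted -log(-rho). -/
theorem retractedExhaustion_spec {E κ δ r σ : ℝ} {c M : ℂ → ℝ} {b : ℂ → ℂ} (hE : Real.exp 2 ≤ E)
    (hc : ContinuousOn c (wormShadow E)) (hcneg : ∀ w ∈ wormShadow E, rho E (c w) w < 0)
    (hδr : δ < r)
    (hb : ∀ w ∈ wormShadow E ∪ ball 0 δ, (b w).re ≤ 32)
    (hκ : ∀ w ∈ wormShadow E, ‖w‖ ≤ r → 35 ≤ κ * Real.log (4 / ‖w‖))
    (hMc : ContinuousOn M (wormShadow E ∪ ball 0 δ))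
    (hMs : ∀ w ∈ wormShadow E ∪ ball 0 δ, HasHolSupport M w)
    (hMk : ∀ w ∈ wormShadow E, r ≤ ‖w‖ → -Real.log (-rho E (c w) w) < M w)
    (hσ : |σ| = 1) {p : Cn 2} (hp : p ∈ lengthenedWorm E c κ δ b) :
    ContinuousAt (retractedExhaustion E c κ r M σ) p ∧
      HasHolSupport (retractedExhaustion E c κ r M σ) p := by
  have hE0 : 0 ≤ E := (Real.exp_pos 2).le.trans hE
  obtain ⟨h0, h1, h2, h3⟩ := hp
  have hopen : IsOpen (wormShadow E ∪ ball 0 δ) := (isOpen_wormShadow E).union isOpen_ball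
  have hMc' : ContinuousAt (fun x : Cn 2 => M (x 1)) p := hMc.continuousAt_comp_coord hopen h1
  have hMs' : HasHolSupport (fun x : Cn 2 => M (x 1)) p :=
    HasHolSupport.comp (f := fun x : Cn 2 => x 1) (hMs (p 1) h1)
      (Eventually.of_forall fun x => by fun_prop)
  have caseM : retractedExhaustion E c κ r M σ =ᶠ[𝓝 p] (fun x : Cn 2 => M (x 1)) →
      ContinuousAt (retractedExhaustion E c κ r M σ) p ∧
        HasHolSupport (retractedExhaustion E c κ r M σ) p := fun h =>
    ⟨hMc'.congr h.symm, hMs'.congr h.symm⟩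
  rcases lt_or_ge ‖p 1‖ r with hr | hr
  · apply caseM
    filter_upwards [(isOpen_lt (continuous_coord (n := 2) 1).norm continuous_const).mem_nhds hr]
      with x hx
    rw [retractedExhaustion, if_neg (not_le.2 hx), max_self]
  have hpB : p 1 ∈ wormShadow E := by
    rcases h1 with h | h
    · exact h
    · rw [mem_ball_zero_iff] at h; linarith
  have hcont := continuousAt_rho_retractedTime (κ := κ) (σ := σ) hE0 hc h0 hpB
  have hneg := h3 hpB σ hσ
  have hlog : ContinuousAt
      (fun x : Cn 2 => -Real.log (-rho E (retractedTime c κ σ x) (x 1))) p :=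
    (hcont.neg.log (neg_ne_zero.2 hneg.ne)).neg
  rcases le_or_gt (σ * Real.log ‖p 0‖ - κ * Real.log (4 / ‖p 1‖)) (σ * c (p 1)) with hle | hlt
  · apply caseM
    have h4 : -Real.log (-rho E (retractedTime c κ σ p) (p 1)) < M (p 1) := by
      rw [retractedTime_of_le hσ hle]
      exact hMk _ hpB hr
    filter_upwards [hlog.eventually_lt hMc' h4] with x hx
    rw [retractedExhaustion]
    split_ifs
    · exact max_eq_left hx.le
    · exact max_self _
  · have hrlt : r < ‖p 1‖ := by
      by_contra hcon
      exact hlt.not_ge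
        (shifted_log_le_of_norm_le hE hcneg hb hκ hσ hpB (not_lt.1 hcon) h2)
    have hw0 : p 1 ≠ 0 := slitPlane_ne_zero (mem_slitPlane_of_mem_wormShadow hE0 hpB)
    have hlt' : ∀ᶠ x : Cn 2 in 𝓝 p,
        σ * c (x 1) < σ * Real.log ‖x 0‖ - κ * Real.log (4 / ‖x 1‖) := by
      exact ContinuousAt.eventually_lt
        ((hc.continuousAt_comp_coord (isOpen_wormShadow E) hpB).const_mul σ)
        (continuousAt_shifted_log h0 hw0) hlt
    have heq : (fun x : Cn 2 => max (M (x 1))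
        (-Real.log (-rho E (retractedTime c κ σ x) (x 1)))) =ᶠ[𝓝 p]
        retractedExhaustion E c κ r M σ := by
      filter_upwards [(isOpen_lt continuous_const (continuous_coord (n := 2) 1).norm).mem_nhds hrlt]
        with x hx
      rw [retractedExhaustion, if_pos (le_of_lt hx)]
    refine ⟨ContinuousAt.congr (hMc'.max hlog) heq, (hMs'.max ?_).congr heq⟩
    rw [retractedTime_of_lt hσ hlt] at hneg
    refine (hasHolSupport_neg_log_rho_shift hE h0 hw0 hneg).congr ?_
    filter_upwards [hlt'] with x hx
    rw [retractedTime_of_lt hσ hx]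

theorem continuousOn_re_of_differentiableAt {s : Set ℂ} {b : ℂ → ℂ}
    (hb : ∀ w ∈ s, DifferentiableAt ℂ b w) : ContinuousOn (fun w => (b w).re) s := fun w hw =>
  (Complex.continuous_re.continuousAt.comp (hb w hw).continuousAt).continuousWithinAt

theorem abs_eq_one_iff {σ : ℝ} : |σ| = 1 ↔ σ = 1 ∨ σ = -1 := by
  rw [abs_eq zero_le_one]

/-- The delicate points lie over the δ-ball outside the shadow, where the condition on `rho` can
switch on nearby; as δ < r, it then holds automatically. -/
theorem isOpen_lengthenedWorm {E κ δ r : ℝ} {c : ℂ → ℝ} {b : ℂ → ℂ} (hE : Real.exp 2 ≤ E)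
    (hc : ContinuousOn c (wormShadow E)) (hcneg : ∀ w ∈ wormShadow E, rho E (c w) w < 0)
    (hδr : δ < r) (hbd : ∀ w ∈ wormShadow E ∪ ball 0 δ, DifferentiableAt ℂ b w)
    (hb : ∀ w ∈ wormShadow E ∪ ball 0 δ, (b w).re ≤ 32)
    (hκ : ∀ w ∈ wormShadow E, ‖w‖ ≤ r → 35 ≤ κ * Real.log (4 / ‖w‖)) :
    IsOpen (lengthenedWorm E c κ δ b) := by
  have hE0 : 0 ≤ E := (Real.exp_pos 2).le.trans hE
  have hopen : IsOpen (wormShadow E ∪ ball 0 δ) := (isOpen_wormShadow E).union isOpen_ball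
  rw [isOpen_iff_mem_nhds]
  rintro p ⟨h0, h1, h2, h3⟩
  have hbc : ContinuousAt (fun x : Cn 2 => (b (x 1)).re) p :=
    (continuousOn_re_of_differentiableAt hbd).continuousAt_comp_coord hopen h1
  have e2 : ∀ᶠ x : Cn 2 in 𝓝 p, |Real.log ‖x 0‖| < (b (x 1)).re :=
    (continuousAt_log_norm_coord h0).abs.eventually_lt hbc h2
  have e0 := isOpen_ne_zero_coord.mem_nhds h0
  have e1 := (isOpen_setOf_coord_mem hopen).mem_nhds h1
  by_cases hpB : p 1 ∈ wormShadow E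
  · have e3 : ∀ σ : ℝ, |σ| = 1 → ∀ᶠ x in 𝓝 p, rho E (retractedTime c κ σ x) (x 1) < 0 :=
      fun σ hσ => (continuousAt_rho_retractedTime hE0 hc h0 hpB).eventually_lt_const (h3 hpB σ hσ)
    filter_upwards [e0, e1, e2, e3 1 (by simp), e3 (-1) (by simp)] with x x0 x1 x2 x3 x4
    refine ⟨x0, x1, x2, fun _ σ hσ => ?_⟩
    rcases abs_eq_one_iff.1 hσ with rfl | rfl
    · exact x3
    · exact x4
  · have h4 : p 1 ∈ ball (0 : ℂ) δ := h1.resolve_left hpB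
    filter_upwards [e0, e1, e2, (isOpen_setOf_coord_mem isOpen_ball).mem_nhds h4]
      with x x0 x1 x2 x3
    refine ⟨x0, x1, x2, fun hx σ hσ => ?_⟩
    have hx3 : ‖x 1‖ < δ := mem_ball_zero_iff.1 x3
    rw [retractedTime_of_le hσ
      (shifted_log_le_of_norm_le hE hcneg hb hκ hσ hx (hx3.trans hδr).le x2)]
    exact hcneg _ hx

theorem hasHolSupport_neg_log_truncation {p : Cn 2} (h0 : p 0 ≠ 0) (a : ℝ) {b : ℂ → ℂ} {s : Set ℂ}
    (hs : IsOpen s) (hbd : ∀ w ∈ s, DifferentiableAt ℂ b w) (h1 : p 1 ∈ s)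
    (hpos : 0 < (b (p 1)).re - a * Real.log ‖p 0‖) :
    HasHolSupport (fun x : Cn 2 => -Real.log ((b (x 1)).re - a * Real.log ‖x 0‖)) p := by
  obtain ⟨L, hL⟩ := exists_local_log h0
  have hL' := (continuous_coord (n := 2) 0).continuousAt.tendsto.eventually (l₁ := 𝓝 p) hL
  refine hasHolSupport_neg_log_re (f := fun x : Cn 2 => b (x 1) - (a : ℂ) * L (x 0)) ?_ ?_ hpos
  · filter_upwards [hL', (isOpen_setOf_coord_mem hs).mem_nhds h1] with x hx hx1
    have d1 : DifferentiableAt ℂ (fun y : Cn 2 => y 0) x := by fun_prop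
    have d2 : DifferentiableAt ℂ (fun y : Cn 2 => y 1) x := by fun_prop
    exact ((hbd _ hx1).comp (f := fun y : Cn 2 => y 1) x d2).sub ((hx.1.comp x d1).const_mul _)
  · filter_upwards [hL'] with x hx
    rw [sub_re, re_ofReal_mul, hx.2]

theorem neg_log_le_iff {y c : ℝ} (hy : 0 < y) : -Real.log y ≤ c ↔ Real.exp (-c) ≤ y := by
  rw [neg_le, Real.le_log_iff_exp_le hy]

/-- The lengthened worm is pseudoconvex. -/
theorem isOpenPseudoconvex_lengthenedWorm {E κ δ r : ℝ} {c : ℂ → ℝ} {b : ℂ → ℂ}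
    (hE : Real.exp 2 ≤ E)
    (hc : ContinuousOn c (wormShadow E)) (hcneg : ∀ w ∈ wormShadow E, rho E (c w) w < 0)
    (hδr : δ < r) (hbd : ∀ w ∈ wormShadow E ∪ ball 0 δ, DifferentiableAt ℂ b w)
    (hb : ∀ w ∈ wormShadow E ∪ ball 0 δ, (b w).re ≤ 32)
    (hκ : ∀ w ∈ wormShadow E, ‖w‖ ≤ r → 35 ≤ κ * Real.log (4 / ‖w‖)) :
    IsOpenPseudoconvex (lengthenedWorm E c κ δ b) := by
  have hE0 : 0 ≤ E := (Real.exp_pos 2).le.trans hE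
  have hDo := isOpen_lengthenedWorm hE hc hcneg hδr hbd hb hκ
  set B : Set ℂ := wormShadow E ∪ ball 0 δ with hB
  have hopen : IsOpen B := (isOpen_wormShadow E).union isOpen_ball
  have hbdd : Bornology.IsBounded B :=
    (isBounded_ball (x := (0 : ℂ)) (r := 2)).subset (fun w hw =>
      mem_ball_zero_iff.2 (norm_lt_two_of_mem_wormShadow hE0 hw)) |>.union isBounded_ball
  have hFB : wormShadow E ∩ {w | r ≤ ‖w‖} ⊆ B := fun w hw => Or.inl hw.1
  have hFcl : closure (wormShadow E ∩ {w | r ≤ ‖w‖}) ∩ B ⊆ wormShadow E ∩ {w | r ≤ ‖w‖} := by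
    rintro w ⟨h1, h2⟩
    have h3 : w ∈ {w : ℂ | r ≤ ‖w‖} :=
      closure_minimal inter_subset_right (isClosed_le continuous_const continuous_norm) h1
    refine ⟨h2.resolve_right fun h => ?_, h3⟩
    have h3' : r ≤ ‖w‖ := h3
    linarith [mem_ball_zero_iff.1 h]
  have hk : ContinuousOn (fun w => -Real.log (-rho E (c w) w))
      (wormShadow E ∩ {w | r ≤ ‖w‖}) := by
    refine ContinuousOn.mono ?_ inter_subset_left
    refine (ContinuousOn.log (ContinuousOn.neg ?_) fun w hw => ?_).neg
    · exact (continuous_rho E).comp_continuousOn (f := fun w => (c w, w))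
        (hc.prodMk continuousOn_id)
    · exact neg_ne_zero.2 (hcneg w hw).ne
  obtain ⟨M, hMc, hMs, hMk, hMcpt⟩ := exists_exhaustion_dominating hopen hbdd hFB hFcl hk
  have hspec : ∀ σ : ℝ, |σ| = 1 → ∀ p ∈ lengthenedWorm E c κ δ b, _ := fun σ hσ p hp =>
    retractedExhaustion_spec hE hc hcneg hδr hb hκ hMc hMs (fun w hw hr => hMk w ⟨hw, hr⟩) hσ hp
  have hbc : ContinuousOn (fun w => (b w).re) B := continuousOn_re_of_differentiableAt hbd
  -- One barrier for each side of the truncation and one for each lengthened end; M, contained in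
  -- the latter two, controls the boundary of the base.
  let u : Cn 2 → ℝ := fun x =>
    max (max (-Real.log ((b (x 1)).re - 1 * Real.log ‖x 0‖))
      (-Real.log ((b (x 1)).re - (-1) * Real.log ‖x 0‖)))
    (max (retractedExhaustion E c κ r M 1 x) (retractedExhaustion E c κ r M (-1) x))
  have hpos : ∀ x ∈ lengthenedWorm E c κ δ b, 0 < (b (x 1)).re - 1 * Real.log ‖x 0‖ ∧
      0 < (b (x 1)).re - (-1) * Real.log ‖x 0‖ := fun x hx => by
    have := abs_lt.1 hx.2.2.1
    constructor <;> linarith [this.1, this.2]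
  have hucont : ∀ p ∈ lengthenedWorm E c κ δ b, ContinuousAt u p := by
    intro p hp
    have h1 : ContinuousAt (fun x : Cn 2 => (b (x 1)).re) p :=
      hbc.continuousAt_comp_coord hopen hp.2.1
    have h2 := continuousAt_log_norm_coord hp.1
    exact (((h1.sub (h2.const_mul 1)).log (hpos p hp).1.ne').neg.max
      ((h1.sub (h2.const_mul (-1))).log (hpos p hp).2.ne').neg).max
      ((hspec 1 (by simp) p hp).1.max (hspec (-1) (by simp) p hp).1)
  refine ⟨hDo, u, continuousPlurisubharmonicOn_of_hasHolSupport
    (fun p hp => (hucont p hp).continuousWithinAt) fun p hp => ?_, fun C => ?_⟩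
  · exact ((hasHolSupport_neg_log_truncation hp.1 1 hopen hbd hp.2.1 (hpos p hp).1).max
      (hasHolSupport_neg_log_truncation hp.1 (-1) hopen hbd hp.2.1 (hpos p hp).2)).max
      ((hspec 1 (by simp) p hp).2.max (hspec (-1) (by simp) p hp).2)
  set S := {x | x ∈ lengthenedWorm E c κ δ b ∧ u x ≤ C} with hS
  have hSz : ∀ x ∈ S, Real.exp (-32) ≤ ‖x 0‖ ∧ ‖x 0‖ ≤ Real.exp 32 := by
    rintro x ⟨hx, -⟩
    have h1 := hx.2.2.1.trans_le (hb _ hx.2.1)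
    have h2 := norm_pos_iff.2 hx.1
    rw [← Real.le_log_iff_exp_le h2, ← Real.log_le_iff_le_exp h2]
    exact ⟨(abs_lt.1 h1).1.le, (abs_lt.1 h1).2.le⟩
  have hSM : ∀ x ∈ S, x 1 ∈ {w | w ∈ B ∧ M w ≤ C} := by
    rintro x ⟨hx, hu⟩
    exact ⟨hx.2.1, (le_max_left _ _).trans ((le_max_left _ _).trans ((le_max_right _ _).trans hu))⟩
  refine Metric.isCompact_of_isClosed_isBounded (isClosed_of_closure_subset fun y hy => ?_) ?_
  swap
  · obtain ⟨R, hR⟩ := (isBounded_iff_forall_norm_le (s := B)).1 hbdd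
    refine (isBounded_iff_forall_norm_le).2 ⟨Real.exp 32 + R, fun x hx => ?_⟩
    exact (norm_le_add_coord x).trans (add_le_add (hSz x hx).2 (hR _ (hSM x hx).1))
  have hne : (𝓝[S] y).NeBot := mem_closure_iff_nhdsWithin_neBot.1 hy
  have evS : ∀ᶠ x in 𝓝[S] y, x ∈ S := self_mem_nhdsWithin
  have y0 : y 0 ≠ 0 := by
    have : Real.exp (-32) ≤ ‖y 0‖ :=
      ge_of_tendsto ((continuous_coord (n := 2) 0).norm.continuousAt.mono_left nhdsWithin_le_nhds)
        (evS.mono fun x hx => (hSz x hx).1)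
    exact norm_pos_iff.1 ((Real.exp_pos _).trans_le this)
  have y1 : y 1 ∈ {w | w ∈ B ∧ M w ≤ C} :=
    (hMcpt C).isClosed.mem_of_tendsto
      ((continuous_coord (n := 2) 1).continuousAt.mono_left nhdsWithin_le_nhds)
      (evS.mono hSM)
  have hlim : ContinuousAt (fun x : Cn 2 => (b (x 1)).re) y :=
    hbc.continuousAt_comp_coord hopen y1.1
  have hlog := continuousAt_log_norm_coord y0
  have hexp : 0 < Real.exp (-C) := Real.exp_pos _
  have y2 : |Real.log ‖y 0‖| < (b (y 1)).re := by
    have h1 : Real.exp (-C) ≤ (b (y 1)).re - 1 * Real.log ‖y 0‖ :=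
      ge_of_tendsto ((hlim.sub (hlog.const_mul 1)).mono_left nhdsWithin_le_nhds)
        (evS.mono fun x hx => (neg_log_le_iff (hpos x hx.1).1).1
          ((le_max_left _ _).trans ((le_max_left _ _).trans hx.2)))
    have h2 : Real.exp (-C) ≤ (b (y 1)).re - (-1) * Real.log ‖y 0‖ :=
      ge_of_tendsto ((hlim.sub (hlog.const_mul (-1))).mono_left nhdsWithin_le_nhds)
        (evS.mono fun x hx => (neg_log_le_iff (hpos x hx.1).2).1
          ((le_max_right _ _).trans ((le_max_left _ _).trans hx.2)))
    rw [abs_lt]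
    constructor <;> linarith
  have hyD : y ∈ lengthenedWorm E c κ δ b := by
    refine ⟨y0, y1.1, y2, fun hyB σ hσ => ?_⟩
    rcases le_or_gt ‖y 1‖ r with hr | hr
    · rw [retractedTime_of_le hσ (shifted_log_le_of_norm_le hE hcneg hb hκ hσ hyB hr y2)]
      exact hcneg _ hyB
    have evr : ∀ᶠ x : Cn 2 in 𝓝[S] y, r < ‖x 1‖ := nhdsWithin_le_nhds
      ((isOpen_lt continuous_const (continuous_coord (n := 2) 1).norm).mem_nhds hr)
    have evB : ∀ᶠ x : Cn 2 in 𝓝[S] y, x 1 ∈ wormShadow E := nhdsWithin_le_nhds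
      ((isOpen_setOf_coord_mem (isOpen_wormShadow E)).mem_nhds hyB)
    have : rho E (retractedTime c κ σ y) (y 1) ≤ -Real.exp (-C) := by
      refine le_of_tendsto (x := 𝓝[S] y) ((continuousAt_rho_retractedTime hE0 hc y0 hyB).mono_left
        nhdsWithin_le_nhds) ?_
      filter_upwards [evS, evr, evB] with x hx hxr hxB
      rw [le_neg, ← neg_log_le_iff (neg_pos.2 (hx.1.2.2.2 hxB σ hσ))]
      have h1 : retractedExhaustion E c κ r M σ x ≤ C := by
        rcases abs_eq_one_iff.1 hσ with rfl | rfl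
        · exact (le_max_left _ _).trans ((le_max_right _ _).trans hx.2)
        · exact (le_max_right _ _).trans ((le_max_right _ _).trans hx.2)
      rw [retractedExhaustion, if_pos hxr.le] at h1
      exact (le_max_right _ _).trans h1
    linarith
  exact ⟨hyD, le_of_tendsto ((hucont y hyD).mono_left nhdsWithin_le_nhds)
    (evS.mono fun x hx => hx.2)⟩

/-! ### Covering the closed worm and choosing the truncation -/

theorem differentiableAt_lam (E t : ℝ) : DifferentiableAt ℝ (lam E) t := by
  have h1 : DifferentiableAt ℝ (fun t : ℝ => max 0 (-Real.cos t) ^ 2) t :=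
    (hasDerivAt_max_zero_sq (-Real.cos t)).differentiableAt.comp
      (f := fun t : ℝ => -Real.cos t) t (by fun_prop)
  have hg : Differentiable ℝ expNegInvGlue :=
    (expNegInvGlue.contDiff (n := 1)).differentiable (by norm_num)
  have h2 : DifferentiableAt ℝ (fun t : ℝ => expNegInvGlue (t - Real.pi / 2)) t :=
    (hg _).comp (f := fun t : ℝ => t - Real.pi / 2) t (by fun_prop)
  have h3 : DifferentiableAt ℝ (fun t : ℝ => expNegInvGlue (-t - Real.pi / 2)) t :=
    (hg _).comp (f := fun t : ℝ => -t - Real.pi / 2) t (by fun_prop)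
  exact h1.add ((h2.add h3).const_mul E)

/-- Away from `w = 0` and `‖w‖ = 2`, the closed fibres of the worm are approximated by the open
fibres for a smaller parameter. -/
theorem exists_rho_neg_near {E E₀ t η : ℝ} {w : ℂ} (hE0 : 0 ≤ E) (hE : E < E₀)
    (h : rho E₀ t w ≤ 0) (hw : w ≠ 0) (hw2 : ‖w‖ < 2) (hη : 0 < η) :
    ∃ t', |t' - t| < η ∧ rho E t' w < 0 := by
  by_contra hcon
  push Not at hcon
  have hle : ∀ s, rho E s w ≤ rho E₀ s w := fun s => by
    unfold rho; linarith [lam_le_lam hE.le s]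
  have ht0 : rho E t w = 0 :=
    ((hle t).trans h).antisymm (hcon t (by simpa using hη))
  rcases lt_or_ge (Real.pi / 2) |t| with ht | ht
  · have h1 := lam_lt_lam hE ht
    unfold rho at h ht0
    linarith
  have hlam0 := lam_eq_zero (E := E) ht
  have hlam : HasDerivAt (lam E) 0 t := by
    have hmin : IsLocalMin (lam E) t :=
      Eventually.of_forall fun s => hlam0.trans_le (lam_nonneg hE0 s)
    have h1 := (differentiableAt_lam E t).hasDerivAt
    rwa [hmin.hasDerivAt_eq_zero h1] at h1
  have hd : HasDerivAt (fun s => rho E s w)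
      (-(2 * (w.re * -Real.sin t + w.im * Real.cos t)) + 0) t := by
    have h1 := (((Real.hasDerivAt_cos t).const_mul w.re).add
      ((Real.hasDerivAt_sin t).const_mul w.im)).const_mul 2
    exact (h1.const_sub (w.re ^ 2 + w.im ^ 2)).add hlam
  -- A critical time makes w a real multiple of e^{it}. With lam = 0, rho = 0 and w ≠ 0 this leaves
  -- only ‖w‖ = 2.
  have hmin : IsLocalMin (fun s => rho E s w) t := by
    filter_upwards [Metric.ball_mem_nhds t hη] with s hs
    rw [ht0]
    exact hcon s hs
  have h2 := hmin.hasDerivAt_eq_zero hd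
  have h3 : w.re ^ 2 + w.im ^ 2 = ‖w‖ ^ 2 := by
    rw [← Complex.normSq_eq_norm_sq, Complex.normSq_apply]; ring
  have h4 : 0 < ‖w‖ := norm_pos_iff.2 hw
  unfold rho at ht0
  rw [hlam0, h3] at ht0
  set X := w.re * Real.cos t + w.im * Real.sin t with hX
  have h5 : X ^ 2 = ‖w‖ ^ 2 := by
    have h6 : w.re * -Real.sin t + w.im * Real.cos t = 0 := by linarith
    rw [← h3, hX]
    linear_combination (w.re ^ 2 + w.im ^ 2) * Real.sin_sq_add_cos_sq t -
      (w.re * -Real.sin t + w.im * Real.cos t) * h6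
  have hXpos : 0 < X := by nlinarith
  have hX2 : X = 2 := mul_left_cancel₀ hXpos.ne' (by linarith)
  nlinarith

/-- The holomorphic function whose real part truncates the lengthened worm. -/
noncomputable def truncation (θ : ℝ) (w : ℂ) : ℂ :=
  ((Real.pi / 2 + 10 * θ : ℝ) : ℂ) + 10 * Complex.exp (Complex.log (w + (θ ^ 4 : ℝ)) / 4)

/-- The principal fourth root has argument at most π/4 in modulus, where cosine exceeds 1/2. -/
theorem half_norm_le_re_exp_log_div_four (v : ℂ) :
    ‖Complex.exp (Complex.log v / 4)‖ / 2 ≤ (Complex.exp (Complex.log v / 4)).re := by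
  have hpi := Real.pi_pos
  have him : (Complex.log v / 4).im = v.arg / 4 := by
    rw [show (4 : ℂ) = ((4 : ℝ) : ℂ) by norm_num, Complex.div_ofReal_im, Complex.log_im]
  rw [Complex.exp_re, Complex.norm_exp, him]
  have h1 : |v.arg / 4| ≤ Real.pi / 3 := by
    rw [abs_div, abs_of_pos (by norm_num : (0 : ℝ) < 4)]
    linarith [Complex.abs_arg_le_pi v]
  have h2 : 1 / 2 ≤ Real.cos (v.arg / 4) := by
    rw [← Real.cos_abs (v.arg / 4), ← Real.cos_pi_div_three]
    exact Real.cos_le_cos_of_nonneg_of_le_pi (abs_nonneg _) (by linarith) h1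
  nlinarith [Real.exp_pos (Complex.log v / 4).re]

theorem norm_exp_log_div_four_pow {v : ℂ} (hv : v ≠ 0) :
    ‖Complex.exp (Complex.log v / 4)‖ ^ 4 = ‖v‖ := by
  rw [← norm_pow, ← Complex.exp_nat_mul, show ((4 : ℕ) : ℂ) * (Complex.log v / 4) = Complex.log v by
    push_cast; ring, Complex.exp_log hv]

theorem truncation_re (θ : ℝ) (w : ℂ) : (truncation θ w).re =
    Real.pi / 2 + 10 * θ + 10 * (Complex.exp (Complex.log (w + (θ ^ 4 : ℝ)) / 4)).re := by
  rw [truncation, add_re, ofReal_re, show (10 : ℂ) = ((10 : ℝ) : ℂ) by norm_num, re_ofReal_mul]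

theorem add_pow_four_mem_slitPlane {E δ θ : ℝ} (hE : 0 ≤ E) (hθ : 0 < θ) (hδ : δ ≤ θ ^ 4) {w : ℂ}
    (hw : w ∈ wormShadow E ∪ ball 0 δ) : w + (θ ^ 4 : ℝ) ∈ slitPlane := by
  have hθ4 : 0 < θ ^ 4 := by positivity
  rw [mem_slitPlane_iff, add_re, add_im, ofReal_re, ofReal_im, add_zero]
  rcases hw with hw | hw
  · rcases mem_slitPlane_iff.1 (mem_slitPlane_of_mem_wormShadow hE hw) with h | h
    · exact Or.inl (by linarith)
    · exact Or.inr h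
  · rw [mem_ball_zero_iff] at hw
    exact Or.inl (by linarith [(abs_le.1 (Complex.abs_re_le_norm w)).1])

theorem differentiableAt_truncation {θ : ℝ} {w : ℂ} (h : w + (θ ^ 4 : ℝ) ∈ slitPlane) :
    DifferentiableAt ℂ (truncation θ) w := by
  have h1 : DifferentiableAt ℂ (fun w : ℂ => Complex.log (w + (θ ^ 4 : ℝ))) w :=
    DifferentiableAt.clog (by fun_prop) h
  unfold truncation
  fun_prop

theorem truncation_re_le {θ a : ℝ} {w : ℂ} (h : w + (θ ^ 4 : ℝ) ∈ slitPlane) (ha : 0 ≤ a)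
    (hw : ‖w‖ + θ ^ 4 ≤ a ^ 4) : (truncation θ w).re ≤ Real.pi / 2 + 10 * θ + 10 * a := by
  rw [truncation_re]
  have h1 := norm_exp_log_div_four_pow (slitPlane_ne_zero h)
  have h2 : ‖w + (θ ^ 4 : ℝ)‖ ≤ ‖w‖ + θ ^ 4 := by
    refine (norm_add_le _ _).trans ?_
    rw [Complex.norm_real, Real.norm_of_nonneg (by positivity)]
  have h3 : ‖Complex.exp (Complex.log (w + (θ ^ 4 : ℝ)) / 4)‖ ≤ a :=
    le_of_pow_le_pow_left₀ four_ne_zero ha (by rw [h1]; linarith)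
  linarith [Complex.re_le_norm (Complex.exp (Complex.log (w + (θ ^ 4 : ℝ)) / 4))]

/-- The truncation does not touch the closed worm. -/
theorem abs_lt_truncation_re {E t θ : ℝ} {w : ℂ} (hE : Real.exp 2 ≤ E) (hθ : 0 < θ)
    (h : rho E t w ≤ 0) : |t| < (truncation θ w).re := by
  have hpi := Real.pi_gt_three
  have hpi4 := Real.pi_le_four
  have hE0 : 0 ≤ E := (Real.exp_pos 2).le.trans hE
  rw [truncation_re]
  set v : ℂ := w + (θ ^ 4 : ℝ) with hv
  set q := ‖Complex.exp (Complex.log v / 4)‖ with hq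
  have hq0 : 0 ≤ q := norm_nonneg _
  have hre : q / 2 ≤ (Complex.exp (Complex.log v / 4)).re := half_norm_le_re_exp_log_div_four v
  have hvq : ‖v‖ ≤ q ^ 4 := by
    by_cases h0 : v = 0
    · rw [h0, norm_zero]; positivity
    · rw [hq, norm_exp_log_div_four_pow h0]
  suffices |t| - Real.pi / 2 < 10 * θ + 5 * q by linarith
  rcases le_or_gt |t| (Real.pi / 2) with ht | ht
  · linarith
  set u := |t| - Real.pi / 2 with hu
  have hu0 : 0 < u := sub_pos.2 ht
  have hu1 : u < 1 := by linarith [abs_lt_of_rho_nonpos hE h]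
  rcases le_or_gt 1 (10 * θ + 5 * q) with hbig | hsmall
  · linarith
  have hlam : lam E t = Real.sin u ^ 2 + E * expNegInvGlue u := by
    rw [← lam_pi_div_two_add hu0.le hu1.le, hu, add_sub_cancel]
    rcases abs_choice t with h | h <;> rw [h]
    rw [lam_neg]
  have hsin : u / 2 ≤ Real.sin u := by
    refine le_trans ?_ (Real.mul_le_sin hu0.le (by linarith))
    have : 1 / 2 ≤ 2 / Real.pi := by rw [div_le_div_iff₀ two_pos (by linarith)]; linarith
    nlinarith
  -- The overhang u of the fibre beyond π/2 is thus at most of order ‖w‖^{1/2}, which a multiple of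
  -- the fourth root dominates for small values.
  have h1 : Real.sin u ^ 2 ≤ 2 * ‖w‖ := by
    have h2 := re_mul_cos_add_le_norm t w
    have h3 := mul_nonneg hE0 (expNegInvGlue.nonneg u)
    unfold rho at h
    nlinarith [sq_nonneg w.re, sq_nonneg w.im]
  have h2 : ‖w‖ ≤ q ^ 4 + θ ^ 4 := by
    have h3 : ‖w‖ ≤ ‖v‖ + ‖((θ ^ 4 : ℝ) : ℂ)‖ := by
      have : w = v - ((θ ^ 4 : ℝ) : ℂ) := by rw [hv]; ring
      rw [this]; exact norm_sub_le _ _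
    rw [Complex.norm_real, Real.norm_of_nonneg (by positivity)] at h3
    linarith
  have h3 : q ^ 4 ≤ q ^ 2 := pow_le_pow_of_le_one hq0 (by linarith) (by norm_num)
  have h4 : θ ^ 4 ≤ θ ^ 2 := pow_le_pow_of_le_one hθ.le (by linarith) (by norm_num)
  have h5 : u ^ 2 < (10 * θ + 5 * q) ^ 2 := by nlinarith
  exact lt_of_pow_lt_pow_left₀ 2 (by positivity) h5

/-- Unless it equals c(w), the retracted time lies between c(w) and t', both in the same interval
fibre. -/
theorem mem_lengthenedWorm_of_near {E κ δ θ t' : ℝ} {c : ℂ → ℝ} (hE : Real.exp 2 ≤ E)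
    (hcneg : ∀ w ∈ wormShadow E, rho E (c w) w < 0) (hθ : 0 < θ) {x : Cn 2} (h0 : x 0 ≠ 0)
    (hx : rho E (Real.log ‖x 0‖) (x 1) ≤ 0) (ht' : rho E t' (x 1) < 0)
    (hd : |t' - Real.log ‖x 0‖| ≤ κ * Real.log (4 / ‖x 1‖)) :
    x ∈ lengthenedWorm E c κ δ (truncation θ) := by
  have hB : x 1 ∈ wormShadow E := ⟨t', ht'⟩
  refine ⟨h0, Or.inl hB, abs_lt_truncation_re hE hθ hx, fun _ σ hσ => ?_⟩
  rcases le_or_gt (σ * Real.log ‖x 0‖ - κ * Real.log (4 / ‖x 1‖)) (σ * c (x 1)) with h | h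
  · rw [retractedTime_of_le hσ h]
    exact hcneg _ hB
  · rw [retractedTime_of_lt hσ h]
    have hd' := abs_le.1 hd
    rcases abs_eq_one_iff.1 hσ with rfl | rfl
    · exact (ordConnected_rho_neg hE (x 1)).out (hcneg _ hB) ht'
        ⟨by linarith, by linarith [hd'.1]⟩
    · exact (ordConnected_rho_neg hE (x 1)).out ht' (hcneg _ hB)
        ⟨by linarith [hd'.2], by linarith⟩

theorem mem_lengthenedWorm_of_mem_wormSublevel {E E₀ κ δ θ : ℝ} {c : ℂ → ℝ} (hE : Real.exp 2 ≤ E)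
    (hE₀ : E < E₀) (hcneg : ∀ w ∈ wormShadow E, rho E (c w) w < 0) (hθ : 0 < θ) (hκ : 0 < κ)
    (hδ : 0 < δ) {x : Cn 2} (hx : x ∈ wormSublevel E₀ 0) (hx1 : ‖x 1‖ < 2) :
    x ∈ lengthenedWorm E c κ δ (truncation θ) := by
  have hE0 : 0 ≤ E := (Real.exp_pos 2).le.trans hE
  have hrho : rho E (Real.log ‖x 0‖) (x 1) ≤ 0 := by
    have := hx.2
    unfold rho at this ⊢
    linarith [lam_le_lam hE₀.le (Real.log ‖x 0‖)]
  by_cases hw : x 1 = 0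
  · refine ⟨hx.1, Or.inr (by rw [hw]; exact mem_ball_self hδ), abs_lt_truncation_re hE hθ hrho,
      fun h => ?_⟩
    exact absurd hw (slitPlane_ne_zero (mem_slitPlane_of_mem_wormShadow hE0 h))
  · have hpos : 0 < κ * Real.log (4 / ‖x 1‖) := by
      refine mul_pos hκ (Real.log_pos ?_)
      rw [one_lt_div (norm_pos_iff.2 hw)]
      linarith
    obtain ⟨t', h1, h2⟩ := exists_rho_neg_near hE0 hE₀ hx.2 hw hx1 hpos
    exact mem_lengthenedWorm_of_near hE hcneg hθ hx.1 hrho h2 h1.le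

theorem exists_near_of_mem_lengthenedWorm {E κ δ : ℝ} {c : ℂ → ℝ} {b : ℂ → ℂ} {x : Cn 2}
    (hcneg : ∀ w ∈ wormShadow E, rho E (c w) w < 0)
    (hx : x ∈ lengthenedWorm E c κ δ b) (hB : x 1 ∈ wormShadow E)
    (hh : 0 ≤ κ * Real.log (4 / ‖x 1‖)) :
    ∃ t', |Real.log ‖x 0‖ - t'| ≤ κ * Real.log (4 / ‖x 1‖) ∧ rho E t' (x 1) < 0 := by
  have h1 := hx.2.2.2 hB 1 (by simp)
  have h2 := hx.2.2.2 hB (-1) (by simp)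
  set t := Real.log ‖x 0‖ with ht
  set h := κ * Real.log (4 / ‖x 1‖) with hh'
  rcases lt_or_ge (1 * c (x 1)) (1 * t - h) with h3 | h3
  · rw [retractedTime_of_lt (by simp) h3] at h1
    exact ⟨_, by rw [one_mul, sub_sub_cancel, abs_of_nonneg hh], h1⟩
  rcases lt_or_ge (-1 * c (x 1)) (-1 * t - h) with h4 | h4
  · rw [retractedTime_of_lt (by simp) h4] at h2
    refine ⟨_, ?_, h2⟩
    rw [← ht, ← hh', sub_sub_cancel, abs_mul, abs_of_nonneg hh]; simp
  · exact ⟨c (x 1), abs_le.2 ⟨by linarith, by linarith⟩, hcneg _ hB⟩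

/-! ### Closeness of the lengthened worm to the closed worm -/

/-- Changing `log ‖x 0‖` to `t` and `x 1` to `w` moves a point only by a controlled amount. -/
theorem exists_log_norm_eq_dist_le {x : Cn 2} (h0 : x 0 ≠ 0) {t : ℝ} (w : ℂ) (ht3 : t ≤ 3)
    (ht : |Real.log ‖x 0‖ - t| ≤ 1) : ∃ y : Cn 2, y 0 ≠ 0 ∧ Real.log ‖y 0‖ = t ∧ y 1 = w ∧
      dist x y ≤ Real.exp 3 * (2 * |Real.log ‖x 0‖ - t|) + ‖x 1 - w‖ := by
  set s := Real.log ‖x 0‖ with hs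
  have hn : ‖x 0‖ = Real.exp s := (Real.exp_log (norm_pos_iff.2 h0)).symm
  have hy : ‖x 0 * (Real.exp (t - s) : ℂ)‖ = Real.exp t := by
    rw [norm_mul, Complex.norm_real, Real.norm_of_nonneg (Real.exp_pos _).le, hn, ← Real.exp_add]
    congr 1; ring
  refine ⟨!₂[x 0 * (Real.exp (t - s) : ℂ), w], ?_, ?_, by simp, ?_⟩
  · exact mul_ne_zero h0 (Complex.ofReal_ne_zero.2 (Real.exp_pos _).ne')
  · change Real.log ‖x 0 * (Real.exp (t - s) : ℂ)‖ = t
    rw [hy, Real.log_exp]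
  · rw [dist_eq_norm]
    refine (norm_le_add_coord _).trans (add_le_add ?_ le_rfl)
    change ‖x 0 - x 0 * (Real.exp (t - s) : ℂ)‖ ≤ _
    have h1 : x 0 - x 0 * (Real.exp (t - s) : ℂ) =
        (x 0 * (Real.exp (t - s) : ℂ)) * ((Real.exp (s - t) - 1 : ℝ) : ℂ) := by
      have h2 : (Real.exp (t - s) : ℂ) * (Real.exp (s - t) : ℂ) = 1 := by
        rw [← Complex.ofReal_mul, ← Real.exp_add]; simp
      rw [Complex.ofReal_sub, Complex.ofReal_one]
      linear_combination (-x 0) * h2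
    rw [h1, norm_mul, hy, Complex.norm_real, Real.norm_eq_abs]
    exact mul_le_mul (Real.exp_le_exp.2 ht3) (Real.abs_exp_sub_one_le ht) (abs_nonneg _)
      (Real.exp_pos _).le

theorem lengthenedWorm_subset_thickening {E E₀ κ δ θ ε : ℝ} {c : ℂ → ℝ} (hE : Real.exp 2 ≤ E)
    (hcneg : ∀ w ∈ wormShadow E, rho E (c w) w < 0)
    (hsub : wormSublevel E 0 ⊆ thickening (ε / 4) (wormSublevel E₀ 0))
    (hθ : 0 < θ) (hδ : δ ≤ θ ^ 4) (hθ1 : 30 * θ ≤ 1)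
    (hθε : Real.exp 3 * (2 * (30 * θ)) + θ ^ 4 < ε / 2) (hκ : 0 < κ)
    (hκ1 : κ * Real.log (4 / θ ^ 4) ≤ 1)
    (hκε : Real.exp 3 * (2 * (κ * Real.log (4 / θ ^ 4))) ≤ ε / 4) :
    lengthenedWorm E c κ δ (truncation θ) ⊆ thickening (ε / 2) (wormSublevel E₀ 0) := by
  have hE0 : 0 ≤ E := (Real.exp_pos 2).le.trans hE
  have hθ4 : 0 < θ ^ 4 := by positivity
  have hpi := Real.pi_lt_d2
  have hpi0 := Real.pi_pos
  intro x hx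
  have hslit := add_pow_four_mem_slitPlane hE0 hθ hδ hx.2.1
  -- For ‖w‖ < θ⁴ the truncation (with a = 2θ, as 2θ⁴ ≤ (2θ)⁴) keeps x near the central annulus over
  -- w = 0. Otherwise the lengthening is at most κ log(4/θ⁴), which is small.
  rcases lt_or_ge ‖x 1‖ (θ ^ 4) with hw | hw
  · have h1 : |Real.log ‖x 0‖| < Real.pi / 2 + 30 * θ := by
      have := truncation_re_le hslit (a := 2 * θ) (by positivity) (by nlinarith)
      linarith [hx.2.2.1]
    obtain ⟨t', ht', hd⟩ : ∃ t', |t'| ≤ Real.pi / 2 ∧ |Real.log ‖x 0‖ - t'| ≤ 30 * θ := by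
      have h1' := abs_lt.1 h1
      refine ⟨max (-(Real.pi / 2)) (min (Real.pi / 2) (Real.log ‖x 0‖)),
        abs_le.2 ⟨le_max_left _ _, max_le (by linarith) (min_le_left _ _)⟩, ?_⟩
      rw [abs_le]
      rcases le_total (Real.pi / 2) (Real.log ‖x 0‖) with h2 | h2
      · rw [min_eq_left h2, max_eq_right (by linarith)]
        constructor <;> linarith
      · rw [min_eq_right h2]
        rcases le_total (-(Real.pi / 2)) (Real.log ‖x 0‖) with h3 | h3
        · rw [max_eq_right h3]
          constructor <;> linarith
        · rw [max_eq_left h3]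
          constructor <;> linarith
    obtain ⟨y, y0, y1, y2, y3⟩ := exists_log_norm_eq_dist_le hx.1 (t := t') 0
      (by linarith [(abs_le.1 ht').2]) (hd.trans hθ1)
    refine mem_thickening_iff.2 ⟨y, ⟨y0, ?_⟩, y3.trans_lt ?_⟩
    · rw [y1, y2, rho, lam_eq_zero ht']; simp
    · rw [sub_zero]
      have := mul_le_mul_of_nonneg_left hd (Real.exp_pos 3).le
      linarith
  · have hB : x 1 ∈ wormShadow E := hx.2.1.resolve_right fun h => by
      linarith [mem_ball_zero_iff.1 h]
    have hpos : 0 < ‖x 1‖ := hθ4.trans_le hw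
    have hlog0 : 0 ≤ Real.log (4 / ‖x 1‖) := by
      refine Real.log_nonneg ?_
      rw [one_le_div hpos]
      linarith [norm_lt_two_of_mem_wormShadow hE0 hB]
    have hlog : Real.log (4 / ‖x 1‖) ≤ Real.log (4 / θ ^ 4) :=
      Real.log_le_log (by positivity) (div_le_div_of_nonneg_left (by norm_num) hθ4 hw)
    obtain ⟨t', h1, h2⟩ := exists_near_of_mem_lengthenedWorm hcneg hx hB (mul_nonneg hκ.le hlog0)
    have h3 := h1.trans (mul_le_mul_of_nonneg_left hlog hκ.le)
    obtain ⟨y, y0, y1, y2, y3⟩ := exists_log_norm_eq_dist_le hx.1 (t := t') (x 1)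
      (by linarith [(abs_lt.1 (abs_lt_of_rho_neg hE h2)).2]) (h3.trans hκ1)
    have hy : y ∈ wormSublevel E 0 := ⟨y0, by rw [y1, y2]; exact h2.le⟩
    obtain ⟨z, hz, hyz⟩ := mem_thickening_iff.1 (hsub hy)
    refine mem_thickening_iff.2 ⟨z, hz, (dist_triangle x y z).trans_lt ?_⟩
    rw [sub_self, norm_zero, add_zero] at y3
    have := mul_le_mul_of_nonneg_left h3 (Real.exp_pos 3).le
    linarith

/-- As E increases to E₀ the compact closed worms decrease to the one for E₀. -/
theorem exists_wormSublevel_subset_thickening {E₀ ε : ℝ} (hE₀ : Real.exp 2 < E₀) (hε : 0 < ε) :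
    ∃ E, Real.exp 2 ≤ E ∧ E < E₀ ∧ wormSublevel E 0 ⊆ thickening ε (wormSublevel E₀ 0) := by
  let e : ℕ → ℝ := fun n => E₀ - (E₀ - Real.exp 2) / (n + 1)
  have hd : 0 < E₀ - Real.exp 2 := sub_pos.2 hE₀
  have he2 : ∀ n, Real.exp 2 ≤ e n := fun n => by
    have : (E₀ - Real.exp 2) / ((n : ℝ) + 1) ≤ E₀ - Real.exp 2 :=
      div_le_self hd.le (by linarith [(Nat.cast_nonneg n : (0 : ℝ) ≤ n)])
    simp only [e]; linarith
  have hmono : Monotone e := fun m n hmn => by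
    have : (m : ℝ) ≤ n := by exact_mod_cast hmn
    simp only [e]; gcongr
  have hlim : Tendsto e atTop (𝓝 E₀) := by
    have := (tendsto_one_div_add_atTop_nhds_zero_nat (𝕜 := ℝ)).const_mul (E₀ - Real.exp 2)
    have := this.const_sub E₀
    simpa [e, div_eq_mul_inv] using this
  have hcpt : ∀ n, IsCompact (wormSublevel (e n) 0) := fun n =>
    isCompact_wormSublevel (he2 n) le_rfl
  have hanti : Antitone fun n => wormSublevel (e n) 0 := fun m n hmn x hx => ⟨hx.1, by
    have := hx.2
    unfold rho at this ⊢
    linarith [lam_le_lam (hmono hmn) (Real.log ‖x 0‖)]⟩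
  obtain ⟨n, hn⟩ := exists_subset_nhds_of_isCompact' hanti.directed_ge hcpt
    (fun n => (hcpt n).isClosed) (U := thickening ε (wormSublevel E₀ 0)) (by
      intro x hx
      rw [mem_iInter] at hx
      refine isOpen_thickening.mem_nhds (self_subset_thickening hε _ ⟨(hx 0).1, ?_⟩)
      have hc : Continuous fun E => rho E (Real.log ‖x 0‖) (x 1) := by
        unfold rho lam; fun_prop
      exact le_of_tendsto ((hc.tendsto E₀).comp hlim) (Eventually.of_forall fun n => (hx n).2))
  exact ⟨e n, he2 n, by simp only [e]; linarith [div_pos hd (by positivity : 0 < (n : ℝ) + 1)], hn⟩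

/-- Some pseudoconvex set in a given thickening of the closed worm contains all of the closed worm
except possibly its points with `‖w‖` near `2`. -/
theorem exists_lengthenedWorm {E₀ ε : ℝ} (hE₀ : Real.exp 2 < E₀) (hε : 0 < ε) :
    ∃ (E : ℝ) (D : Set (Cn 2)), Real.exp 2 ≤ E ∧ E < E₀ ∧ IsOpenPseudoconvex D ∧
      D ⊆ thickening ε (wormSublevel E₀ 0) ∧
      (∀ x ∈ D, ‖x 1‖ ≤ 2) ∧ (∀ x ∈ wormSublevel E₀ 0, ‖x 1‖ < 2 → x ∈ D) ∧
      ∀ x ∈ wormDomain E, x ∈ D := by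
  obtain ⟨E, hE, hEE, hsub⟩ := exists_wormSublevel_subset_thickening hE₀ (half_pos hε)
  have hE0 : 0 ≤ E := (Real.exp_pos 2).le.trans hE
  obtain ⟨c, hc, hcneg⟩ := exists_continuousOn_rho_neg hE
  obtain ⟨θ, hθ, hθ1, hθε⟩ : ∃ θ : ℝ, 0 < θ ∧ 30 * θ ≤ 1 ∧
      Real.exp 3 * (2 * (30 * θ)) + θ ^ 4 < ε := by
    have hcont : Continuous fun θ : ℝ => Real.exp 3 * (2 * (30 * θ)) + θ ^ 4 := by fun_prop
    have h1 : ∀ᶠ θ : ℝ in 𝓝[>] 0, Real.exp 3 * (2 * (30 * θ)) + θ ^ 4 < ε :=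
      nhdsWithin_le_nhds ((hcont.tendsto 0).eventually_lt_const (by simpa using hε))
    have h2 : ∀ᶠ θ : ℝ in 𝓝[>] 0, θ < 1 / 30 :=
      nhdsWithin_le_nhds (gt_mem_nhds (by norm_num))
    obtain ⟨θ, h1, h2, h3⟩ := (h1.and (h2.and self_mem_nhdsWithin)).exists
    exact ⟨θ, h3, by linarith, h1⟩
  have hθ4 : 0 < θ ^ 4 := by positivity
  obtain ⟨κ, hκ, hκ1, hκε⟩ : ∃ κ : ℝ, 0 < κ ∧ κ * Real.log (4 / θ ^ 4) ≤ 1 ∧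
      Real.exp 3 * (2 * (κ * Real.log (4 / θ ^ 4))) ≤ ε / 2 := by
    set l := Real.log (4 / θ ^ 4)
    have h1 : ∀ᶠ κ : ℝ in 𝓝[>] 0, κ * l < 1 := nhdsWithin_le_nhds
      (((by fun_prop : Continuous fun κ : ℝ => κ * l).tendsto 0).eventually_lt_const (by simp))
    have h2 : ∀ᶠ κ : ℝ in 𝓝[>] 0, Real.exp 3 * (2 * (κ * l)) < ε / 2 := nhdsWithin_le_nhds
      (((by fun_prop : Continuous fun κ : ℝ => Real.exp 3 * (2 * (κ * l))).tendsto
        0).eventually_lt_const (by simpa using hε))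
    obtain ⟨κ, h1, h2, h3⟩ := (h1.and (h2.and self_mem_nhdsWithin)).exists
    exact ⟨κ, h3, h1.le, h2.le⟩
  -- The radius at which the lengthening κ log(4/r) equals 35.
  set r := 4 * Real.exp (-(35 / κ)) with hr
  have hr0 : 0 < r := by positivity
  set δ := min (θ ^ 4) (r / 2) with hδ
  have hδ0 : 0 < δ := lt_min hθ4 (half_pos hr0)
  have hδθ : δ ≤ θ ^ 4 := min_le_left _ _
  have hδr : δ < r := (min_le_right _ _).trans_lt (half_lt_self hr0)
  have hθ41 : θ ^ 4 ≤ 1 := pow_le_one₀ hθ.le (by linarith)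
  have hB2 : ∀ w ∈ wormShadow E ∪ ball 0 δ, ‖w‖ ≤ 2 := by
    rintro w (hw | hw)
    · exact (norm_lt_two_of_mem_wormShadow hE0 hw).le
    · linarith [mem_ball_zero_iff.1 hw]
  refine ⟨E, lengthenedWorm E c κ δ (truncation θ), hE, hEE,
    isOpenPseudoconvex_lengthenedWorm hE hc hcneg hδr
      (fun w hw => differentiableAt_truncation (add_pow_four_mem_slitPlane hE0 hθ hδθ hw))
      (fun w hw => ?_) (fun w hw hwr => ?_), ?_, fun x hx => hB2 _ hx.2.1, fun x hx hx2 => ?_,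
      fun x hx => ?_⟩
  · have := truncation_re_le (add_pow_four_mem_slitPlane hE0 hθ hδθ hw) (a := 2) (by norm_num)
      (by linarith [hB2 w hw])
    linarith [Real.pi_lt_d2]
  · have hw0 : 0 < ‖w‖ :=
      norm_pos_iff.2 (slitPlane_ne_zero (mem_slitPlane_of_mem_wormShadow hE0 hw))
    have h1 : 35 / κ ≤ Real.log (4 / ‖w‖) := by
      rw [Real.le_log_iff_exp_le (by positivity), le_div_iff₀ hw0]
      refine (mul_le_mul_of_nonneg_left hwr (Real.exp_pos _).le).trans (le_of_eq ?_)
      rw [hr, mul_left_comm, ← Real.exp_add, add_neg_cancel, Real.exp_zero, mul_one]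
    rwa [div_le_iff₀' hκ] at h1
  · have := lengthenedWorm_subset_thickening (ε := 2 * ε) (c := c) hE hcneg (E₀ := E₀)
      (by convert hsub using 2; ring) hθ hδθ hθ1 (by linarith) hκ hκ1 (by linarith)
    rwa [mul_div_cancel_left₀ ε two_ne_zero] at this
  · exact mem_lengthenedWorm_of_mem_wormSublevel hE hEE hcneg hθ hκ hδ0 hx hx2
  · refine mem_lengthenedWorm_of_near hE hcneg hθ hx.1 hx.2.le hx.2 ?_
    have hB : x 1 ∈ wormShadow E := ⟨_, hx.2⟩
    have hw0 : 0 < ‖x 1‖ :=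
      norm_pos_iff.2 (slitPlane_ne_zero (mem_slitPlane_of_mem_wormShadow hE0 hB))
    rw [sub_self, abs_zero]
    refine mul_nonneg hκ.le (Real.log_nonneg ?_)
    rw [one_le_div hw0]
    linarith [norm_lt_two_of_mem_wormShadow hE0 hB]

/-! ### Dilation and conclusion -/

/-- Shrinking the second coordinate moves the outer part of the closed worm into the open worm for
a smaller parameter. -/
theorem rho_mul_neg {E E₀ t s : ℝ} {w : ℂ} (hE₀ : E ≤ E₀)
    (h : rho E₀ t w ≤ 0) (hs : 7 / 10 < s) (hs1 : s < 1) (hw : 6 / 5 < ‖w‖) :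
    rho E t (s * w) < 0 := by
  have h1 := lam_le_lam hE₀ t
  have h2 : lam E t ≤ 1 := by
    rw [rho_eq_norm] at h
    nlinarith [sq_nonneg ‖w - Complex.exp (t * I)‖]
  have h3 : w.re ^ 2 + w.im ^ 2 = ‖w‖ ^ 2 := by
    rw [← Complex.normSq_eq_norm_sq, Complex.normSq_apply]; ring
  have h4 : rho E t (s * w) = s ^ 2 * ‖w‖ ^ 2 -
      s * (2 * (w.re * Real.cos t + w.im * Real.sin t)) + lam E t := by
    rw [rho, re_ofReal_mul, im_ofReal_mul, ← h3]; ring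
  rw [h4]
  unfold rho at h
  rw [h3] at h
  have h5 : s * (‖w‖ ^ 2 + lam E t) ≤ s * (2 * (w.re * Real.cos t + w.im * Real.sin t)) :=
    mul_le_mul_of_nonneg_left (by linarith) (by linarith)
  -- The constants satisfy (7/10)(6/5)² > 1 ≥ lam; the value to be bounded is at most (1 - s)(lam -
  -- s‖w‖²).
  have h6 : 1 < s * ‖w‖ ^ 2 := by nlinarith
  nlinarith

/-- The linear change of coordinates `(z, w) ↦ (z, s w)`. -/
noncomputable def scaleSecond (s : ℝ) (hs : s ≠ 0) : Cn 2 ≃L[ℂ] Cn 2 :=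
  LinearEquiv.toContinuousLinearEquiv
    { toFun := fun x => !₂[x 0, (s : ℂ) * x 1]
      invFun := fun x => !₂[x 0, (s : ℂ)⁻¹ * x 1]
      map_add' := fun x y => by ext i; fin_cases i <;> simp [mul_add]
      map_smul' := fun a x => by ext i; fin_cases i <;> simp [mul_left_comm]
      left_inv := fun x => by ext i; fin_cases i <;> simp [hs]
      right_inv := fun x => by ext i; fin_cases i <;> simp [hs] }

theorem dist_scaleSecond_le {s : ℝ} (hs : s ≠ 0) (hs1 : s ≤ 1) (x : Cn 2) :
    dist x (scaleSecond s hs x) ≤ (1 - s) * ‖x 1‖ := by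
  rw [dist_eq_norm]
  refine (norm_le_add_coord _).trans (le_of_eq ?_)
  have h0 : (x - scaleSecond s hs x) 0 = 0 := sub_self (x 0)
  have h1 : (x - scaleSecond s hs x) 1 = ((1 - s : ℝ) : ℂ) * x 1 := by
    change x 1 - (s : ℂ) * x 1 = _
    push_cast; ring
  rw [h0, h1, norm_zero, zero_add, norm_mul, Complex.norm_real,
    Real.norm_of_nonneg (by linarith)]

/-- The neighbourhood is the preimage of D under (z, w) ↦ (z, sw) with s < 1 close to 1. The part
‖w‖ ≤ 6/5 is compact in D and tolerates a small move; the rest is pushed into the open worm for E,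
which D contains. -/
theorem hasSteinNhdBasis_wormSublevel {E₀ : ℝ} (hE₀ : Real.exp 2 < E₀) :
    HasSteinNhdBasis (wormSublevel E₀ 0) := by
  intro V hV hKV
  have hK : IsCompact (wormSublevel E₀ 0) := isCompact_wormSublevel hE₀.le le_rfl
  obtain ⟨ε, hε, hεV⟩ := hK.exists_thickening_subset_open hV hKV
  obtain ⟨E, D, hE, hEE, hD, hDε, hD2, hin, hout⟩ := exists_lengthenedWorm hE₀ (half_pos hε)
  have hK1 : IsCompact (wormSublevel E₀ 0 ∩ {x | ‖x 1‖ ≤ 6 / 5}) :=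
    hK.inter_right (isClosed_le (continuous_coord (n := 2) 1).norm continuous_const)
  obtain ⟨r, hr, hrD⟩ := hK1.exists_thickening_subset_open hD.1
    (fun x hx => hin x hx.1 (lt_of_le_of_lt hx.2 (by norm_num)))
  obtain ⟨s, hs, hs1, hsr, hsε⟩ : ∃ s : ℝ, 7 / 10 < s ∧ s < 1 ∧ (1 - s) * (6 / 5) < r ∧
      (1 - s) * 4 < ε / 2 := by
    refine ⟨1 - min (1 / 5) (min (r / 2) (ε / 16)), ?_, ?_, ?_, ?_⟩
    · linarith [min_le_left (1 / 5 : ℝ) (min (r / 2) (ε / 16))]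
    · have : 0 < min (1 / 5 : ℝ) (min (r / 2) (ε / 16)) :=
        lt_min (by norm_num) (lt_min (by linarith) (by linarith))
      linarith
    · linarith [(min_le_right (1 / 5 : ℝ) (min (r / 2) (ε / 16))).trans (min_le_left _ _)]
    · linarith [(min_le_right (1 / 5 : ℝ) (min (r / 2) (ε / 16))).trans (min_le_right _ _)]
  have hs0 : s ≠ 0 := by linarith
  refine ⟨scaleSecond s hs0 ⁻¹' D, hD.preimage _, fun x hx => ?_, fun x hx => hεV ?_⟩
  · rcases le_or_gt ‖x 1‖ (6 / 5) with h | h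
    · refine hrD (mem_thickening_iff.2 ⟨x, ⟨hx, h⟩, ?_⟩)
      rw [dist_comm]
      refine (dist_scaleSecond_le hs0 hs1.le x).trans_lt (lt_of_le_of_lt ?_ hsr)
      exact mul_le_mul_of_nonneg_left h (by linarith)
    · exact hout _ ⟨hx.1, rho_mul_neg hEE.le hx.2 hs hs1 h⟩
  · obtain ⟨y, hy, hxy⟩ := mem_thickening_iff.1 (hDε hx)
    refine mem_thickening_iff.2 ⟨y, hy, (dist_triangle x (scaleSecond s hs0 x) y).trans_lt ?_⟩
    have h1 := dist_scaleSecond_le hs0 hs1.le x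
    have h2 : ‖(s : ℂ) * x 1‖ ≤ 2 := hD2 _ hx
    rw [norm_mul, Complex.norm_real, Real.norm_of_nonneg (by linarith)] at h2
    have h3 : ‖x 1‖ ≤ 4 := by nlinarith [norm_nonneg (x 1)]
    have h4 : (1 - s) * ‖x 1‖ ≤ (1 - s) * 4 := mul_le_mul_of_nonneg_left h3 (by linarith)
    linarith

theorem theorem1 :
    ∃ Ω : Set (Cn 2),
      IsOpen Ω ∧ IsConnected Ω ∧ Bornology.IsBounded Ω ∧
      IsOpenPseudoconvex Ω ∧
      HasC11Boundary Ω ∧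
      HasSteinNhdBasis (closure Ω) ∧
      ∀ s : ℝ, 1 ≤ s → ¬ IsSHConvex s (closure Ω) := by
  -- Any parameter above e² works; strictness leaves room for the smaller parameters used in the
  -- Stein neighbourhoods.
  have hlt : Real.exp 2 < 2 * Real.exp 2 := by linarith [Real.exp_pos 2]
  refine ⟨wormDomain (2 * Real.exp 2), isOpen_wormDomain _, isConnected_wormDomain hlt.le,
    isBounded_wormDomain hlt.le, isOpenPseudoconvex_wormDomain hlt.le,
    hasC11Boundary_wormDomain hlt.le, ?_, fun s hs => not_isSHConvex_closure_wormDomain hlt.le hs⟩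
  rw [closure_wormDomain hlt.le]
  exact hasSteinNhdBasis_wormSublevel hlt
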